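/- Let $(M,g,J)$ be a compact connected Kähler manifold of real dimension $2n\ge 4$, with Levi-Civita connection $\nabla$ and $\omega(X,Y)=g(JX,Y)$. Let $\tau\in C^\infty(M)$ be a special Kähler potential, that is: $\tau$ is nonconstant, $J\nabla\tau$ is a Killing vector field, and at every point of $U=\{x\in M: d\tau(x)\neq 0\}$ all nonzero vectors orthogonal to $\nabla\tau$ and $J\nabla\tau$ are eigenvectors of the Hessian $\nabla d\tau$. If $\dim M=4$, assume in addition that $\nabla\tau$ is an eigenfield of the Ricci tensor. On $U$ put $\mathcal V=\mathrm{span}\{\nabla\tau,J\nabla\tau\}$ and $\mathcal H=\mathcal V^{\perp}$, let $\Theta$ be the eigenvalue of $\nabla d\tau$ on $\mathcal H$, and assume that $\Theta\ne 0$ at every point of $U$. Write $Q=g(\nabla\tau,\nabla\tau)$ and $d^c\tau=-d\tau\circ J$ (so $d^c\tau(X)=g(J\nabla\tau,X)$). Then there is a constant $c\in\mathbb R$ with $\dfrac{Q}{\Theta}=2(\tau-c)$ on $U$, and the following hold. 1. The 2-form $\phi=(\tau-c)\dfrac{d\tau\wedge d^c\tau}{Q}$ on $U$, where $(\alpha\wedge\beta)(X,Y)=\alpha(X)\beta(Y)-\alpha(Y)\beta(X)$,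 extends to a smooth Hamiltonian 2-form on all of $M$, with $\mathrm{tr}_\omega\phi=\tau-c$. Here a Hamiltonian 2-form is a smooth $J$-invariant 2-form $\phi$ with $$\nabla_X\phi=\tfrac12\left(d\sigma\wedge (JX)^\flat-d^c\sigma\wedge X^\flat\right)\quad\text{for all }X,\qquad \sigma=\mathrm{tr}_\omega\phi=\tfrac12\sum_i\phi(e_i,Je_i),$$ $(e_i)$ being a local orthonormal frame. 2. Correspondingly, the tensor field $S$ on $U$ that is $0$ on $\mathcal V$ and $(\tau-c)\,\mathrm{Id}$ on $\mathcal H$ extends to a smooth Killing tensor $S$ on all of $M$, i.e. a smooth $g$-symmetric $(1,1)$-tensor field with $g((\nabla_XS)Y,Z)+g((\nabla_ZS)X,Y)+g((\nabla_YS)Z,X)=0$ for all $X,Y,Z$. It satisfies $S_x=0$ wherever $\tau(x)=c$, and $g(SJX,Y)=(\tau-c)\,\omega(X,Y)-\phi(X,Y)$ on $M$ for the extension $\phi$ of part 1. -/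

import Mathlib

open Bundle Manifold
open scoped ContDiff Topology

noncomputable section

namespace KahlerGeom

section LeviCivita

set_option linter.unusedSectionVars false

variable {E : Type*} [NormedAddCommGroup E] [NormedSpace ℝ E] [FiniteDimensional ℝ E]
  {M : Type*} [TopologicalSpace M] [ChartedSpace E M] [IsManifold 𝓘(ℝ, E) ∞ M]
  [RiemannianBundle (fun x : M => TangentSpace 𝓘(ℝ, E) x)]
  [IsContMDiffRiemannianBundle 𝓘(ℝ, E) ∞ E (fun x : M => TangentSpace 𝓘(ℝ, E) x)]

instance (x : M) : FiniteDimensional ℝ (TangentSpace 𝓘(ℝ, E) x) :=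
  inferInstanceAs (FiniteDimensional ℝ E)

instance (x : M) : CompleteSpace (TangentSpace 𝓘(ℝ, E) x) :=
  FiniteDimensional.complete ℝ (TangentSpace 𝓘(ℝ, E) x)

local notation "⟪" v ", " w "⟫" => inner ℝ v w

theorem mdiffAt_inner {X Y : Π x : M, TangentSpace 𝓘(ℝ, E) x} {x : M}
    (hX : MDiffAt (T% X) x) (hY : MDiffAt (T% Y) x) :
    MDiffAt (fun y => ⟪X y, Y y⟫) x :=
  MDifferentiableAt.inner_bundle (F := E) (E := fun x : M => TangentSpace 𝓘(ℝ, E) x)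
    (b := fun y => y) (v := X) (w := Y) hX hY

/-- Half of the right-hand side of the Koszul formula, so that it equals `⟪∇_X Y, Z⟫`. -/
def koszul (X Y Z : Π x : M, TangentSpace 𝓘(ℝ, E) x) (x : M) : ℝ :=
  (1 / 2) * (mvfderiv 𝓘(ℝ, E) (fun y => ⟪Y y, Z y⟫) x (X x)
    + mvfderiv 𝓘(ℝ, E) (fun y => ⟪Z y, X y⟫) x (Y x)
    - mvfderiv 𝓘(ℝ, E) (fun y => ⟪X y, Y y⟫) x (Z x)
    + ⟪VectorField.mlieBracket 𝓘(ℝ, E) X Y x, Z x⟫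
    - ⟪VectorField.mlieBracket 𝓘(ℝ, E) X Z x, Y x⟫
    - ⟪VectorField.mlieBracket 𝓘(ℝ, E) Y Z x, X x⟫)

variable {X Y Z : Π x : M, TangentSpace 𝓘(ℝ, E) x} {x : M}

theorem koszul_tensorial_left (hY : MDiffAt (T% Y) x) (hZ : MDiffAt (T% Z) x) :
    TensorialAt 𝓘(ℝ, E) E (fun X => koszul X Y Z x) x where
  smul {f X} hf hX := by
    have h := real_inner_comm (X x) (Z x)
    simp [koszul, mvfderiv_fun_mul hf (mdiffAt_inner hZ hX),
      mvfderiv_fun_mul hf (mdiffAt_inner hX hY), VectorField.mlieBracket_smul_left hf hX,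
      inner_add_left, inner_smul_left, inner_smul_right, h]
    ring
  add hX hX' := by
    simp [koszul, mvfderiv_fun_add (mdiffAt_inner hZ hX) (mdiffAt_inner hZ hX'),
      mvfderiv_fun_add (mdiffAt_inner hX hY) (mdiffAt_inner hX' hY),
      VectorField.mlieBracket_add_left hX hX', inner_add_left, inner_add_right]
    ring

theorem koszul_tensorial_right (hX : MDiffAt (T% X) x) (hY : MDiffAt (T% Y) x) :
    TensorialAt 𝓘(ℝ, E) E (fun Z => koszul X Y Z x) x where
  smul {f Z} hf hZ := by
    have h := real_inner_comm (X x) (Z x)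
    have h' := real_inner_comm (Y x) (Z x)
    simp [koszul, mvfderiv_fun_mul hf (mdiffAt_inner hY hZ),
      mvfderiv_fun_mul hf (mdiffAt_inner hZ hX), VectorField.mlieBracket_smul_right hf hZ,
      inner_add_left, inner_smul_left, inner_smul_right, h, h']
    ring
  add hZ hZ' := by
    simp [koszul, mvfderiv_fun_add (mdiffAt_inner hY hZ) (mdiffAt_inner hY hZ'),
      mvfderiv_fun_add (mdiffAt_inner hZ hX) (mdiffAt_inner hZ' hX),
      VectorField.mlieBracket_add_right hZ hZ', inner_add_left, inner_add_right]
    ring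

theorem koszul_add (hX : MDiffAt (T% X) x) {Y' : Π x : M, TangentSpace 𝓘(ℝ, E) x}
    (hY : MDiffAt (T% Y) x) (hY' : MDiffAt (T% Y') x) (hZ : MDiffAt (T% Z) x) :
    koszul X (Y + Y') Z x = koszul X Y Z x + koszul X Y' Z x := by
  simp [koszul, mvfderiv_fun_add (mdiffAt_inner hY hZ) (mdiffAt_inner hY' hZ),
    mvfderiv_fun_add (mdiffAt_inner hX hY) (mdiffAt_inner hX hY'),
    VectorField.mlieBracket_add_right hY hY', VectorField.mlieBracket_add_left hY hY',
    inner_add_left, inner_add_right]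
  ring

theorem koszul_leibniz (hX : MDiffAt (T% X) x) {f : M → ℝ} (hf : MDiffAt f x)
    (hY : MDiffAt (T% Y) x) (hZ : MDiffAt (T% Z) x) :
    koszul X (f • Y) Z x
      = f x * koszul X Y Z x + mvfderiv 𝓘(ℝ, E) f x (X x) * ⟪Y x, Z x⟫ := by
  have h := real_inner_comm (X x) (Y x)
  simp [koszul, mvfderiv_fun_mul hf (mdiffAt_inner hY hZ),
    mvfderiv_fun_mul hf (mdiffAt_inner hX hY), VectorField.mlieBracket_smul_right hf hY,
    VectorField.mlieBracket_smul_left hf hY, inner_add_left, inner_smul_left, inner_smul_right, h]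
  ring

theorem koszul_add_swap (X Y Z : Π x : M, TangentSpace 𝓘(ℝ, E) x) (x : M) :
    koszul X Y Z x + koszul X Z Y x = mvfderiv 𝓘(ℝ, E) (fun y => ⟪Y y, Z y⟫) x (X x) := by
  have h1 : (fun y => ⟪X y, Y y⟫) = fun y => ⟪Y y, X y⟫ := by
    ext y; exact real_inner_comm _ _
  have h2 : (fun y => ⟪Z y, X y⟫) = fun y => ⟪X y, Z y⟫ := by
    ext y; exact real_inner_comm _ _
  have h3 : (fun y => ⟪Z y, Y y⟫) = fun y => ⟪Y y, Z y⟫ := by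
    ext y; exact real_inner_comm _ _
  have h4 := VectorField.mlieBracket_swap_apply (I := 𝓘(ℝ, E)) (V := Z) (W := Y) (x := x)
  simp only [koszul, h1, h2, h3, h4, inner_neg_left]
  ring

theorem koszul_sub_swap (X Y Z : Π x : M, TangentSpace 𝓘(ℝ, E) x) (x : M) :
    koszul X Y Z x - koszul Y X Z x = ⟪VectorField.mlieBracket 𝓘(ℝ, E) X Y x, Z x⟫ := by
  have h1 : (fun y => ⟪X y, Y y⟫) = fun y => ⟪Y y, X y⟫ := by
    ext y; exact real_inner_comm _ _
  have h2 : (fun y => ⟪Z y, X y⟫) = fun y => ⟪X y, Z y⟫ := by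
    ext y; exact real_inner_comm _ _
  have h3 : (fun y => ⟪Z y, Y y⟫) = fun y => ⟪Y y, Z y⟫ := by
    ext y; exact real_inner_comm _ _
  have h4 := VectorField.mlieBracket_swap_apply (I := 𝓘(ℝ, E)) (V := Y) (W := X) (x := x)
  simp only [koszul, h1, h2, h3, h4, inner_neg_left]
  ring

open scoped Classical in
/-- `∇ Y` at `x`, as the endomorphism `v ↦ ∇_v Y` of the tangent space
(by convention `0` where `Y` is not differentiable). -/
def leviCivitaFun (Y : Π x : M, TangentSpace 𝓘(ℝ, E) x) (x : M) :
    TangentSpace 𝓘(ℝ, E) x →L[ℝ] TangentSpace 𝓘(ℝ, E) x :=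
  if hY : MDiffAt (T% Y) x then
    LinearMap.toContinuousLinearMap
      { toFun := fun v => (InnerProductSpace.toDual ℝ (TangentSpace 𝓘(ℝ, E) x)).symm
          (TensorialAt.mkHom₂ (fun X Z => koszul X Y Z x) x
            (fun _ hZ => koszul_tensorial_left hY hZ)
            (fun _ hX => koszul_tensorial_right hX hY) v)
        map_add' := by intro v w; simp
        map_smul' := by intro a v; simp }
  else 0

theorem inner_leviCivitaFun (hX : MDiffAt (T% X) x) (hY : MDiffAt (T% Y) x)
    (hZ : MDiffAt (T% Z) x) : ⟪leviCivitaFun Y x (X x), Z x⟫ = koszul X Y Z x := by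
  simp only [leviCivitaFun, hY, dite_true, LinearMap.coe_toContinuousLinearMap', LinearMap.coe_mk,
    AddHom.coe_mk, InnerProductSpace.toDual_symm_apply]
  exact TensorialAt.mkHom₂_apply _ _ hX hZ

theorem leviCivitaFun_ext {v : TangentSpace 𝓘(ℝ, E) x} {u : TangentSpace 𝓘(ℝ, E) x}
    (h : ∀ Z : Π x : M, TangentSpace 𝓘(ℝ, E) x, MDiffAt (T% Z) x → ⟪v, Z x⟫ = ⟪u, Z x⟫) :
    v = u := by
  refine ext_inner_right ℝ fun w => ?_
  have := h (FiberBundle.extend E w) (FiberBundle.mdifferentiableAt_extend ..)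
  simpa using this

variable (E M) in
/-- The Levi-Civita connection `∇` of the Riemannian metric. -/
def leviCivita : CovariantDerivative 𝓘(ℝ, E) E (fun x : M => TangentSpace 𝓘(ℝ, E) x) where
  toFun := leviCivitaFun
  isCovariantDerivativeOnUniv :=
    { add := by
        intro Y Y' x hY hY' _
        have hYY' : MDiffAt (T% (Y + Y')) x := mdifferentiableAt_add_section hY hY'
        ext v
        refine leviCivitaFun_ext fun Z hZ => ?_
        have hv : MDiffAt (T% (FiberBundle.extend E v)) x := FiberBundle.mdifferentiableAt_extend ..
        have e : v = FiberBundle.extend E v x := by simp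
        rw [add_apply, inner_add_left, e,
          inner_leviCivitaFun hv hYY' hZ, inner_leviCivitaFun hv hY hZ,
          inner_leviCivitaFun hv hY' hZ, koszul_add hv hY hY' hZ]
      leibniz := by
        intro Y f x hY hf _
        have hfY : MDiffAt (T% (f • Y)) x := hf.smul_section hY
        ext v
        refine leviCivitaFun_ext fun Z hZ => ?_
        have hv : MDiffAt (T% (FiberBundle.extend E v)) x := FiberBundle.mdifferentiableAt_extend ..
        have e : v = FiberBundle.extend E v x := by simp
        rw [add_apply, smul_apply,
          ContinuousLinearMap.smulRight_apply, inner_add_left, real_inner_smul_left,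
          real_inner_smul_left, e, inner_leviCivitaFun hv hfY hZ, inner_leviCivitaFun hv hY hZ,
          koszul_leibniz hv hf hY hZ] }

theorem leviCivita_metric (hX : MDiffAt (T% X) x) (hY : MDiffAt (T% Y) x)
    (hZ : MDiffAt (T% Z) x) :
    mvfderiv 𝓘(ℝ, E) (fun y => ⟪Y y, Z y⟫) x (X x)
      = ⟪leviCivita E M Y x (X x), Z x⟫ + ⟪Y x, leviCivita E M Z x (X x)⟫ := by
  have h1 := inner_leviCivitaFun hX hY hZ
  have h2 := inner_leviCivitaFun hX hZ hY
  rw [real_inner_comm] at h2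
  rw [← koszul_add_swap X Y Z x, ← h1, ← h2]
  rfl

theorem leviCivita_torsion : (leviCivita E M).torsion = 0 := by
  rw [CovariantDerivative.torsion_eq_zero_iff]
  intro X Y x hX hY
  refine leviCivitaFun_ext fun Z hZ => ?_
  rw [inner_sub_left, ← koszul_sub_swap X Y Z x, ← inner_leviCivitaFun hX hY hZ,
    ← inner_leviCivitaFun hY hX hZ]
  rfl

end LeviCivita

section Riemannian

variable {E : Type*} [NormedAddCommGroup E] [NormedSpace ℝ E] [FiniteDimensional ℝ E]
  {M : Type*} [TopologicalSpace M] [ChartedSpace E M] [IsManifold 𝓘(ℝ, E) ∞ M]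
  [RiemannianBundle (fun x : M => TangentSpace 𝓘(ℝ, E) x)]
  [IsContMDiffRiemannianBundle 𝓘(ℝ, E) ∞ E (fun x : M => TangentSpace 𝓘(ℝ, E) x)]

local notation "⟪" v ", " w "⟫" => inner ℝ v w

/-! ### Smooth tensor fields and their covariant derivatives -/

/-- `X` is a smooth vector field. -/
def IsSmoothField (X : Π x : M, TangentSpace 𝓘(ℝ, E) x) : Prop :=
  ContMDiff 𝓘(ℝ, E) (𝓘(ℝ, E).prod 𝓘(ℝ, E)) ∞
    (fun x => TotalSpace.mk' E (E := fun x : M => TangentSpace 𝓘(ℝ, E) x) x (X x))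

/-- `S` is a smooth (1,1)-tensor field. -/
def IsSmoothEnd
    (S : Π x : M, TangentSpace 𝓘(ℝ, E) x →L[ℝ] TangentSpace 𝓘(ℝ, E) x) : Prop :=
  ContMDiff 𝓘(ℝ, E) (𝓘(ℝ, E).prod 𝓘(ℝ, E →L[ℝ] E)) ∞
    (fun x => TotalSpace.mk' (E →L[ℝ] E)
      (E := fun x : M => TangentSpace 𝓘(ℝ, E) x →L[ℝ] TangentSpace 𝓘(ℝ, E) x) x (S x))

/-- `B` is a smooth field of bilinear forms on the tangent spaces. -/
def IsSmoothBilin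
    (B : Π x : M, TangentSpace 𝓘(ℝ, E) x →L[ℝ] TangentSpace 𝓘(ℝ, E) x →L[ℝ] ℝ) : Prop :=
  ContMDiff 𝓘(ℝ, E) (𝓘(ℝ, E).prod 𝓘(ℝ, E →L[ℝ] E →L[ℝ] ℝ)) ∞
    (fun x => TotalSpace.mk' (E →L[ℝ] E →L[ℝ] ℝ)
      (E := fun x : M => TangentSpace 𝓘(ℝ, E) x →L[ℝ] TangentSpace 𝓘(ℝ, E) x →L[ℝ] ℝ) x (B x))

/-- `(∇_X S) Y = ∇_X (S Y) - S (∇_X Y)` at `x`. -/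
def covDerivEnd (S : Π x : M, TangentSpace 𝓘(ℝ, E) x →L[ℝ] TangentSpace 𝓘(ℝ, E) x)
    (X Y : Π x : M, TangentSpace 𝓘(ℝ, E) x) (x : M) : TangentSpace 𝓘(ℝ, E) x :=
  leviCivita E M (fun y => S y (Y y)) x (X x) - S x (leviCivita E M Y x (X x))

/-- `(∇_X B)(Y, Z) = X (B (Y, Z)) - B (∇_X Y, Z) - B (Y, ∇_X Z)` at `x`. -/
def covDerivBilin
    (B : Π x : M, TangentSpace 𝓘(ℝ, E) x →L[ℝ] TangentSpace 𝓘(ℝ, E) x →L[ℝ] ℝ)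
    (X Y Z : Π x : M, TangentSpace 𝓘(ℝ, E) x) (x : M) : ℝ :=
  mvfderiv 𝓘(ℝ, E) (fun y => B y (Y y) (Z y)) x (X x)
    - B x (leviCivita E M Y x (X x)) (Z x) - B x (Y x) (leviCivita E M Z x (X x))

/-- A Killing tensor: a smooth symmetric (1,1)-tensor field `S` for which the cyclic sum of
`g((∇_X S) Y, Z)` vanishes. -/
structure IsKillingTensor
    (S : Π x : M, TangentSpace 𝓘(ℝ, E) x →L[ℝ] TangentSpace 𝓘(ℝ, E) x) : Prop where
  smooth : IsSmoothEnd S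
  symm : ∀ (x : M) (v w : TangentSpace 𝓘(ℝ, E) x), ⟪S x v, w⟫ = ⟪v, S x w⟫
  cyclic : ∀ X Y Z : Π x : M, TangentSpace 𝓘(ℝ, E) x,
    IsSmoothField X → IsSmoothField Y → IsSmoothField Z → ∀ x : M,
      ⟪covDerivEnd S X Y x, Z x⟫ + ⟪covDerivEnd S Z X x, Y x⟫
        + ⟪covDerivEnd S Y Z x, X x⟫ = 0

/-- A Killing vector field: a smooth vector field `ξ` with `∇ξ` skew-adjoint. -/
structure IsKillingField (ξ : Π x : M, TangentSpace 𝓘(ℝ, E) x) : Prop where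
  smooth : IsSmoothField ξ
  skew : ∀ (x : M) (v w : TangentSpace 𝓘(ℝ, E) x),
    ⟪leviCivita E M ξ x v, w⟫ + ⟪v, leviCivita E M ξ x w⟫ = 0

/-! ### Gradient, Hessian, Ricci tensor -/

/-- The gradient `∇τ`. -/
def grad (τ : M → ℝ) (x : M) : TangentSpace 𝓘(ℝ, E) x :=
  (InnerProductSpace.toDual ℝ (TangentSpace 𝓘(ℝ, E) x)).symm (mvfderiv 𝓘(ℝ, E) τ x)

/-- The Hessian `∇dτ`, as the endomorphism `v ↦ ∇_v (∇τ)`. -/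
def hess (τ : M → ℝ) (x : M) : TangentSpace 𝓘(ℝ, E) x →L[ℝ] TangentSpace 𝓘(ℝ, E) x :=
  leviCivita E M (grad τ) x

/-- `R(X, Y) Z = ∇_X ∇_Y Z - ∇_Y ∇_X Z - ∇_[X, Y] Z` at `x`. -/
def curvature (X Y Z : Π x : M, TangentSpace 𝓘(ℝ, E) x) (x : M) : TangentSpace 𝓘(ℝ, E) x :=
  leviCivita E M (fun y => leviCivita E M Z y (Y y)) x (X x)
    - leviCivita E M (fun y => leviCivita E M Z y (X y)) x (Y x)
    - leviCivita E M Z x (VectorField.mlieBracket 𝓘(ℝ, E) X Y x)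

/-- The Ricci tensor `Ric(v, w) = tr (u ↦ R(u, v) w)`, computed in an orthonormal basis of the
tangent space; tangent vectors are extended to vector fields that are smooth near `x`. -/
def ricci (x : M) (v w : TangentSpace 𝓘(ℝ, E) x) : ℝ :=
  ∑ i, ⟪curvature
      (FiberBundle.extend E (stdOrthonormalBasis ℝ (TangentSpace 𝓘(ℝ, E) x) i))
      (FiberBundle.extend E v) (FiberBundle.extend E w) x,
    stdOrthonormalBasis ℝ (TangentSpace 𝓘(ℝ, E) x) i⟫

end Riemannian

section Kahler

variable {E : Type*} [NormedAddCommGroup E] [NormedSpace ℝ E] [FiniteDimensional ℝ E]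
  {M : Type*} [TopologicalSpace M] [ChartedSpace E M] [IsManifold 𝓘(ℝ, E) ∞ M]
  [RiemannianBundle (fun x : M => TangentSpace 𝓘(ℝ, E) x)]
  [IsContMDiffRiemannianBundle 𝓘(ℝ, E) ∞ E (fun x : M => TangentSpace 𝓘(ℝ, E) x)]

local notation "⟪" v ", " w "⟫" => inner ℝ v w

/-- `(M, g, J)` is Kähler: `J` is a smooth `g`-orthogonal almost complex structure with `∇J = 0`. -/
structure IsKahler
    (J : Π x : M, TangentSpace 𝓘(ℝ, E) x →L[ℝ] TangentSpace 𝓘(ℝ, E) x) : Prop where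
  smooth : IsSmoothEnd J
  sq : ∀ (x : M) (v : TangentSpace 𝓘(ℝ, E) x), J x (J x v) = -v
  orthogonal : ∀ (x : M) (v w : TangentSpace 𝓘(ℝ, E) x), ⟪J x v, J x w⟫ = ⟪v, w⟫
  parallel : ∀ X Y : Π x : M, TangentSpace 𝓘(ℝ, E) x,
    IsSmoothField X → IsSmoothField Y → ∀ x : M, covDerivEnd J X Y x = 0

variable (J : Π x : M, TangentSpace 𝓘(ℝ, E) x →L[ℝ] TangentSpace 𝓘(ℝ, E) x)

/-- The distribution `𝓥 = span {∇τ, J∇τ}`. -/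
def vert (τ : M → ℝ) (x : M) : Submodule ℝ (TangentSpace 𝓘(ℝ, E) x) :=
  Submodule.span ℝ {grad τ x, J x (grad τ x)}

/-- The distribution `𝓗 = 𝓥ᗮ`. -/
def horiz (τ : M → ℝ) (x : M) : Submodule ℝ (TangentSpace 𝓘(ℝ, E) x) := (vert J τ x)ᗮ

/-- `d^c f = -df ∘ J`, i.e. `d^c f (v) = g(J∇f, v)`. -/
def dc (f : M → ℝ) (x : M) (v : TangentSpace 𝓘(ℝ, E) x) : ℝ :=
  -mvfderiv 𝓘(ℝ, E) f x (J x v)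

/-- A special Kähler potential (without the Ricci condition in real dimension four): a nonconstant
smooth function `τ` such that `J∇τ` is a Killing vector field and, wherever `dτ ≠ 0`, every nonzero
vector orthogonal to `∇τ` and `J∇τ` is an eigenvector of `∇dτ`. -/
structure IsSpecialKahlerPotential (τ : M → ℝ) : Prop where
  smooth : ContMDiff 𝓘(ℝ, E) 𝓘(ℝ, ℝ) ∞ τ
  nonconstant : ∃ x y : M, τ x ≠ τ y
  killing : IsKillingField (fun x => J x (grad τ x))
  eigen : ∀ x : M, mvfderiv 𝓘(ℝ, E) τ x ≠ 0 → ∀ v ∈ horiz J τ x, v ≠ 0 →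
    ∃ a : ℝ, hess τ x v = a • v

/-- `∇τ` is an eigenfield of the Ricci tensor. -/
def IsRicciEigenGrad (τ : M → ℝ) : Prop :=
  ∀ x : M, ∃ a : ℝ, ∀ w : TangentSpace 𝓘(ℝ, E) x, ricci x (grad τ x) w = a * ⟪grad τ x, w⟫

/-- The trace of a 2-form with respect to `ω = g(J·, ·)`: `tr_ω φ = (1/2) ∑ φ(e_i, J e_i)` for an
orthonormal basis `e_i`; thus `tr_ω ω = n` in real dimension `2n`. -/
def omegaTrace
    (φ : Π x : M, TangentSpace 𝓘(ℝ, E) x →L[ℝ] TangentSpace 𝓘(ℝ, E) x →L[ℝ] ℝ) (x : M) : ℝ :=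
  (1 / 2) * ∑ i, φ x (stdOrthonormalBasis ℝ (TangentSpace 𝓘(ℝ, E) x) i)
    (J x (stdOrthonormalBasis ℝ (TangentSpace 𝓘(ℝ, E) x) i))

/-- A Hamiltonian 2-form: a smooth `J`-invariant 2-form `φ` such that
`∇_X φ = (1/2) (dσ ∧ (JX)♭ - d^cσ ∧ X♭)` for every `X`, where `σ = tr_ω φ`. -/
structure IsHamiltonianTwoForm
    (φ : Π x : M, TangentSpace 𝓘(ℝ, E) x →L[ℝ] TangentSpace 𝓘(ℝ, E) x →L[ℝ] ℝ) : Prop where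
  smooth : IsSmoothBilin φ
  alternating : ∀ (x : M) (v : TangentSpace 𝓘(ℝ, E) x), φ x v v = 0
  invariant : ∀ (x : M) (v w : TangentSpace 𝓘(ℝ, E) x), φ x (J x v) (J x w) = φ x v w
  equation : ∃ σ : M → ℝ, ContMDiff 𝓘(ℝ, E) 𝓘(ℝ, ℝ) ∞ σ ∧ (∀ x : M, σ x = omegaTrace J φ x) ∧
    ∀ X Y Z : Π x : M, TangentSpace 𝓘(ℝ, E) x,
      IsSmoothField X → IsSmoothField Y → IsSmoothField Z → ∀ x : M,
        covDerivBilin φ X Y Z x = (1 / 2) *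
          ((mvfderiv 𝓘(ℝ, E) σ x (Y x) * ⟪J x (X x), Z x⟫
              - mvfderiv 𝓘(ℝ, E) σ x (Z x) * ⟪J x (X x), Y x⟫)
            - (dc J σ x (Y x) * ⟪X x, Z x⟫ - dc J σ x (Z x) * ⟪X x, Y x⟫))

end Kahler

end KahlerGeom

end

/-!
Write `Q = |∇τ|²`, and let `H = ∇∇τ` be the Hessian, with eigenvalue `la` on `∇τ`, `J∇τ` and `th` on
their orthogonal complement.

*The critical set.* Kostant's formula for the Killing field `J∇τ` expresses the derivative of `H` by
the curvature and `∇τ`, so the pair `(∇τ, H)` solves a linear first order system. On a connected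
manifold it vanishes nowhere unless `τ` is constant (`IsKillingPotential.eventually_grad_eq_zero`).
Hence `H ≠ 0` at each critical point (`IsKillingPotential.hess_ne_zero_of_grad_eq_zero`), and the
regular points are dense (`IsKillingPotential.dense_mvfderiv_ne_zero`). Moreover `la` extends smoothly
over the critical points, by Hadamard division of `⟨H∇τ, X⟩` by `⟨∇τ, X⟩`, and then so does `th`, by
means of `tr H` (`IsKillingPotential.exists_isSpecialPotential`).

*The constant.* The 2-form `⟨∇(J∇τ), ·⟩` is closed. Together with the eigenvalue form of `H`, and in
real dimension four with the Ricci condition, this yields `Q dth = 2 th (la - th) dτ`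
(`IsSpecialPotential.inner_mul_mvfderiv_th`). As `dQ = 2 la dτ`, the function `τ - Q / (2 th)` is
locally constant off the critical set. Near a critical point this set lies in the common zero set of
two functions `dτ(X)`, `d^cτ(X)` with independent differentials, so it separates nowhere, and there is
one constant `c` with `Q = 2 th (τ - c)` (`IsSpecialPotential.exists_isNormalizedPotential`).

*The tensors.* Where `th ≠ 0`, the tensor `S` equals
`(τ - c) Id - (∇τ ⊗ ∇τ + J∇τ ⊗ J∇τ) / (2 th)`, which is smooth. Where `la ≠ th`, it equals
`(τ - c) (la Id - H) / (la - th)`. These two cases exhaust the manifold: `(H - th) (H - la) = 0`, so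
`th = la = 0` would force `H = 0` at a critical point. Thus `S` and `φ = (τ - c) ω - g(SJ·, ·)` are
globally smooth (`IsNormalizedPotential.isSmoothEnd_killingTensor`). Since `2 th φ = dτ ∧ d^cτ`,
differentiating and inserting the formula for `dth` gives the Hamiltonian equation at regular points,
hence everywhere by density (`IsNormalizedPotential.covDerivBilin_hamiltonianForm`). The resulting
formula for `∇S` has vanishing cyclic sum (`IsNormalizedPotential.isKillingTensor`).
-/

noncomputable section

namespace KahlerGeom

/-! ### Smooth vector fields and tensor fields -/

section Smooth

set_option linter.unusedSectionVars false

variable {E : Type*} [NormedAddCommGroup E] [NormedSpace ℝ E]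
  {M : Type*} [TopologicalSpace M] [ChartedSpace E M] [IsManifold 𝓘(ℝ, E) ∞ M]

/-- `X` is smooth at the point `x`. -/
def SmoothFieldAt (X : Π x : M, TangentSpace 𝓘(ℝ, E) x) (x : M) : Prop :=
  ContMDiffAt 𝓘(ℝ, E) (𝓘(ℝ, E).prod 𝓘(ℝ, E)) ∞
    (fun x => TotalSpace.mk' E (E := fun x : M => TangentSpace 𝓘(ℝ, E) x) x (X x)) x

variable {X Y Z : Π x : M, TangentSpace 𝓘(ℝ, E) x} {x : M} {f : M → ℝ}

theorem IsSmoothField.smoothAt (h : IsSmoothField X) (x : M) : SmoothFieldAt X x := h x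

theorem IsSmoothField.mdiffAt (h : IsSmoothField X) (x : M) : MDiffAt (T% X) x :=
  ContMDiffAt.mdifferentiableAt (h x) (by simp)

theorem SmoothFieldAt.mdiffAt (h : SmoothFieldAt X x) : MDiffAt (T% X) x :=
  ContMDiffAt.mdifferentiableAt h (by simp)

theorem SmoothFieldAt.congr (h : SmoothFieldAt X x) (hY : ∀ᶠ y in 𝓝 x, Y y = X y) :
    SmoothFieldAt Y x := by
  refine ContMDiffAt.congr_of_eventuallyEq h ?_
  filter_upwards [hY] with y hy
  simp [hy]

theorem SmoothFieldAt.add (hX : SmoothFieldAt X x) (hY : SmoothFieldAt Y x) :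
    SmoothFieldAt (fun y => X y + Y y) x :=
  ContMDiffAt.add_section hX hY

theorem SmoothFieldAt.sub (hX : SmoothFieldAt X x) (hY : SmoothFieldAt Y x) :
    SmoothFieldAt (fun y => X y - Y y) x :=
  ContMDiffAt.sub_section hX hY

theorem SmoothFieldAt.smul (hf : ContMDiffAt 𝓘(ℝ, E) 𝓘(ℝ, ℝ) ∞ f x) (hX : SmoothFieldAt X x) :
    SmoothFieldAt (fun y => f y • X y) x :=
  ContMDiffAt.smul_section hf hX

variable [FiniteDimensional ℝ E] [T2Space M]

/-- The coordinate vector fields at `x`, cut off by a bump function, are global smooth fields. -/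
theorem exists_contMDiff_eventuallyEq_symm (x : M) (w : E) :
    ∃ W : Π x : M, TangentSpace 𝓘(ℝ, E) x, IsSmoothField W ∧
      ∀ᶠ y in 𝓝 x, W y
        = (trivializationAt E (fun x : M => TangentSpace 𝓘(ℝ, E) x) x).symm y w := by
  set e := trivializationAt E (fun x : M => TangentSpace 𝓘(ℝ, E) x) x with he
  obtain ⟨f, -, hf⟩ := (SmoothBumpFunction.nhds_basis_tsupport (I := 𝓘(ℝ, E)) x).mem_iff.1
    (e.open_baseSet.mem_nhds (FiberBundle.mem_baseSet_trivializationAt' x))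
  refine ⟨fun y => f y • e.symm y w, ?_, ?_⟩
  · have h1 : ContMDiffOn 𝓘(ℝ, E) (𝓘(ℝ, E).prod 𝓘(ℝ, E)) ∞
        (fun y => TotalSpace.mk' E (E := fun x : M => TangentSpace 𝓘(ℝ, E) x) y (e.symm y w))
        e.baseSet := by
      intro y hy
      rw [e.contMDiffWithinAt_section _ hy]
      have : CMDiff[e.baseSet] ∞ (fun (_x : M) ↦ w) := contMDiffOn_const
      exact this.congr (fun x hx ↦ by simp [hx]) y hy
    have := ContMDiffOn.smul_section_of_tsupport (ψ := f) (n := ∞) (f.contMDiff.contMDiffOn)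
      e.open_baseSet hf h1
    exact this
  · filter_upwards [f.eventuallyEq_one] with y hy
    simp [hy]

/-- Every tangent vector is the value of a global smooth field, so tensor identities can be verified on
smooth fields. The last clause relates the field to the extension in the definition of `ricci`. -/
theorem exists_contMDiff_extend {x : M} (v : TangentSpace 𝓘(ℝ, E) x) :
    ∃ W : Π x : M, TangentSpace 𝓘(ℝ, E) x, IsSmoothField W ∧ W x = v ∧
      ∀ᶠ y in 𝓝 x, W y = FiberBundle.extend E v y := by
  obtain ⟨W, hW, h⟩ := exists_contMDiff_eventuallyEq_symm x
    (trivializationAt E (fun x : M => TangentSpace 𝓘(ℝ, E) x) x ⟨x, v⟩).2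
  refine ⟨W, hW, ?_, h⟩
  rw [h.self_of_nhds]
  exact FiberBundle.extend_apply_self (F := E) v

omit [FiniteDimensional ℝ E] [T2Space M] in
theorem contMDiffAt_clm_of_apply [FiniteDimensional ℝ E] {F : Type*} [NormedAddCommGroup F]
    [NormedSpace ℝ F] {A : M → E →L[ℝ] F}
    (h : ∀ w, ContMDiffAt 𝓘(ℝ, E) 𝓘(ℝ, F) ∞ (fun y => A y w) x) :
    ContMDiffAt 𝓘(ℝ, E) 𝓘(ℝ, E →L[ℝ] F) ∞ A x := by
  let b := Module.finBasis ℝ E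
  have h2 : A = fun y => ∑ i, ContinuousLinearMap.smulRightL ℝ E F
      (LinearMap.toContinuousLinearMap (b.coord i)) (A y (b i)) := by
    funext y
    ext w
    conv_lhs => rw [← b.sum_repr w]
    simp only [map_sum, map_smul, sum_apply]
    simp
  rw [h2]
  refine ContMDiffAt.sum fun i _ => ?_
  exact (ContinuousLinearMap.contMDiff _).contMDiffAt.comp x (h (b i))

/-- A section of the bundle of homomorphisms from the tangent bundle to `V` is smooth at `x` as
soon as it maps smooth vector fields to sections of `V` smooth at `x`. -/
theorem contMDiffAt_hom_of_forall {F : Type*} [NormedAddCommGroup F] [NormedSpace ℝ F]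
    {V : M → Type*} [TopologicalSpace (TotalSpace F V)] [∀ x, AddCommGroup (V x)]
    [∀ x, Module ℝ (V x)] [∀ x, TopologicalSpace (V x)] [∀ x, IsTopologicalAddGroup (V x)]
    [∀ x, ContinuousSMul ℝ (V x)] [FiberBundle F V] [VectorBundle ℝ F V]
    {S : Π x : M, TangentSpace 𝓘(ℝ, E) x →L[ℝ] V x}
    (h : ∀ Y : Π x : M, TangentSpace 𝓘(ℝ, E) x, IsSmoothField Y →
      ContMDiffAt 𝓘(ℝ, E) (𝓘(ℝ, E).prod 𝓘(ℝ, F)) ∞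
        (fun y => TotalSpace.mk' F (E := V) y (S y (Y y))) x) :
    ContMDiffAt 𝓘(ℝ, E) (𝓘(ℝ, E).prod 𝓘(ℝ, E →L[ℝ] F)) ∞
    (fun x => TotalSpace.mk' (E →L[ℝ] F)
      (E := fun x : M => TangentSpace 𝓘(ℝ, E) x →L[ℝ] V x) x (S x)) x := by
  rw [contMDiffAt_hom_bundle]
  refine ⟨contMDiffAt_id, contMDiffAt_clm_of_apply fun w => ?_⟩
  obtain ⟨W, hW, hWx⟩ := exists_contMDiff_eventuallyEq_symm x w
  have h1 := h W hW
  rw [contMDiffAt_section] at h1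
  refine h1.congr_of_eventuallyEq ?_
  filter_upwards [hWx, (trivializationAt E (TangentSpace 𝓘(ℝ, E)) x).open_baseSet.mem_nhds
    (FiberBundle.mem_baseSet_trivializationAt' x), (trivializationAt F V x).open_baseSet.mem_nhds
    (FiberBundle.mem_baseSet_trivializationAt' x)] with y hy hy2 hy3
  rw [hy]
  simp [ContinuousLinearMap.inCoordinates, Trivialization.coe_linearMapAt_of_mem _ hy3,
    Trivialization.symmL_apply _ hy2]

theorem contMDiffAt_end_of_forall
    {S : Π x : M, TangentSpace 𝓘(ℝ, E) x →L[ℝ] TangentSpace 𝓘(ℝ, E) x}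
    (h : ∀ Y : Π x : M, TangentSpace 𝓘(ℝ, E) x, IsSmoothField Y →
      SmoothFieldAt (fun y => S y (Y y)) x) :
    ContMDiffAt 𝓘(ℝ, E) (𝓘(ℝ, E).prod 𝓘(ℝ, E →L[ℝ] E)) ∞
    (fun x => TotalSpace.mk' (E →L[ℝ] E)
      (E := fun x : M => TangentSpace 𝓘(ℝ, E) x →L[ℝ] TangentSpace 𝓘(ℝ, E) x) x (S x)) x :=
  contMDiffAt_hom_of_forall h

theorem contMDiffAt_bilin_of_forall
    {B : Π x : M, TangentSpace 𝓘(ℝ, E) x →L[ℝ] TangentSpace 𝓘(ℝ, E) x →L[ℝ] ℝ}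
    (h : ∀ Y Z : Π x : M, TangentSpace 𝓘(ℝ, E) x, IsSmoothField Y →
      IsSmoothField Z → ContMDiffAt 𝓘(ℝ, E) 𝓘(ℝ, ℝ) ∞ (fun y => B y (Y y) (Z y)) x) :
    ContMDiffAt 𝓘(ℝ, E) (𝓘(ℝ, E).prod 𝓘(ℝ, E →L[ℝ] E →L[ℝ] ℝ)) ∞
    (fun x => TotalSpace.mk' (E →L[ℝ] E →L[ℝ] ℝ)
      (E := fun x : M => TangentSpace 𝓘(ℝ, E) x →L[ℝ] TangentSpace 𝓘(ℝ, E) x →L[ℝ] ℝ) x (B x)) x := by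
  refine contMDiffAt_hom_of_forall fun Y hY => ?_
  refine contMDiffAt_hom_of_forall (V := Bundle.Trivial M ℝ) fun Z hZ => ?_
  rw [contMDiffAt_section]
  exact h Y Z hY hZ

end Smooth

/-! ### Smoothness of the Riemannian operations -/

section Riem

set_option linter.unusedSectionVars false

variable {E : Type*} [NormedAddCommGroup E] [NormedSpace ℝ E] [FiniteDimensional ℝ E]
  {M : Type*} [TopologicalSpace M] [ChartedSpace E M] [IsManifold 𝓘(ℝ, E) ∞ M] [T2Space M]
  [RiemannianBundle (fun x : M => TangentSpace 𝓘(ℝ, E) x)]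
  [IsContMDiffRiemannianBundle 𝓘(ℝ, E) ∞ E (fun x : M => TangentSpace 𝓘(ℝ, E) x)]
variable {X Y Z : Π x : M, TangentSpace 𝓘(ℝ, E) x} {x : M} {f : M → ℝ}
local notation "⟪" v ", " w "⟫" => inner ℝ v w

omit [FiniteDimensional ℝ E] [T2Space M] in
theorem SmoothFieldAt.inner (hX : SmoothFieldAt X x) (hY : SmoothFieldAt Y x) :
    ContMDiffAt 𝓘(ℝ, E) 𝓘(ℝ, ℝ) ∞ (fun y => ⟪X y, Y y⟫) x :=
  ContMDiffAt.inner_bundle (F := E) (E := fun x : M => TangentSpace 𝓘(ℝ, E) x)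
    (b := fun y => y) (v := X) (w := Y) hX hY

/-- The metric is nondegenerate, so smoothness of a field can be tested on inner products. -/
theorem smoothFieldAt_of_inner
    (h : ∀ Z : Π x : M, TangentSpace 𝓘(ℝ, E) x, IsSmoothField Z →
      ContMDiffAt 𝓘(ℝ, E) 𝓘(ℝ, ℝ) ∞ (fun y => ⟪X y, Z y⟫) x) : SmoothFieldAt X x := by
  set e := trivializationAt E (fun x : M => TangentSpace 𝓘(ℝ, E) x) x with he
  have hxe : x ∈ e.baseSet := FiberBundle.mem_baseSet_trivializationAt' x
  choose W hW hWe using fun w : E => exists_contMDiff_eventuallyEq_symm x w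
  -- the matrix of the metric in the coordinates given by the trivialization `e`
  let G : M → E →L[ℝ] E →L[ℝ] ℝ := fun y =>
    ((innerSL ℝ (E := TangentSpace 𝓘(ℝ, E) y)).bilinearComp (e.symmL ℝ y) (e.symmL ℝ y))
  have hG' : ∀ y ∈ e.baseSet, ∀ w w', G y w w' = ⟪e.symm y w, e.symm y w'⟫ := by
    intro y hy w w'
    simp only [G, ContinuousLinearMap.bilinearComp_apply, Trivialization.symmL_apply _ hy]
    rfl
  have hG : ContMDiffAt 𝓘(ℝ, E) 𝓘(ℝ, E →L[ℝ] E →L[ℝ] ℝ) ∞ G x := by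
    refine contMDiffAt_clm_of_apply fun w => contMDiffAt_clm_of_apply fun w' => ?_
    refine (((hW w).smoothAt x).inner ((hW w').smoothAt x)).congr_of_eventuallyEq ?_
    filter_upwards [hWe w, hWe w', e.open_baseSet.mem_nhds hxe] with y h1 h2 hy
    rw [hG' y hy, h1, h2]
  have hinv : ∀ y ∈ e.baseSet, (G y).IsInvertible := by
    intro y hy
    have hinj : Function.Injective (G y) := by
      rw [injective_iff_map_eq_zero]
      intro w hw
      have h1 : e.symm y w = 0 := by
        have := hG' y hy w w
        rw [hw] at this
        exact inner_self_eq_zero.1 this.symm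
      rw [← Trivialization.symmL_apply (R := ℝ) e hy] at h1
      rw [← e.continuousLinearMapAt_symmL (R := ℝ) hy w, h1, map_zero]
    have hdim : Module.finrank ℝ E = Module.finrank ℝ (E →L[ℝ] ℝ) := by
      rw [← (LinearMap.toContinuousLinearMap (𝕜 := ℝ) (E := E) (F' := ℝ)).finrank_eq]
      exact Subspace.dual_finrank_eq.symm
    refine ⟨(LinearEquiv.ofInjectiveOfFinrankEq (G y : E →ₗ[ℝ] E →L[ℝ] ℝ) hinj
      hdim).toContinuousLinearEquiv, ?_⟩
    ext w w'
    rfl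
  have hα : ContMDiffAt 𝓘(ℝ, E) 𝓘(ℝ, E →L[ℝ] ℝ) ∞ (fun y => G y (e ⟨y, X y⟩).2) x := by
    refine contMDiffAt_clm_of_apply fun w => ?_
    refine (h (W w) (hW w)).congr_of_eventuallyEq ?_
    filter_upwards [hWe w, e.open_baseSet.mem_nhds hxe] with y h1 hy
    rw [hG' y hy, h1, e.symm_apply_apply_mk hy]
  have hGi : ContMDiffAt 𝓘(ℝ, E) 𝓘(ℝ, (E →L[ℝ] ℝ) →L[ℝ] E) ∞ (fun y => (G y).inverse) x :=
    ContMDiffAt.comp (I' := 𝓘(ℝ, E →L[ℝ] E →L[ℝ] ℝ)) x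
      ((hinv x hxe).contDiffAt_map_inverse (n := ∞)).contMDiffAt hG
  change ContMDiffAt _ _ _ _ _
  rw [contMDiffAt_section]
  refine (hGi.clm_apply hα).congr_of_eventuallyEq ?_
  filter_upwards [e.open_baseSet.mem_nhds hxe] with y hy
  obtain ⟨A, hA⟩ := hinv y hy
  simp [← hA, ← he]

/-- Smooth endomorphism fields map smooth fields to smooth fields. -/
theorem SmoothFieldAt.end_apply
    {S : Π x : M, TangentSpace 𝓘(ℝ, E) x →L[ℝ] TangentSpace 𝓘(ℝ, E) x}
    (hS : ContMDiffAt 𝓘(ℝ, E) (𝓘(ℝ, E).prod 𝓘(ℝ, E →L[ℝ] E)) ∞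
    (fun x => TotalSpace.mk' (E →L[ℝ] E)
      (E := fun x : M => TangentSpace 𝓘(ℝ, E) x →L[ℝ] TangentSpace 𝓘(ℝ, E) x) x (S x)) x)
    (hX : SmoothFieldAt X x) : SmoothFieldAt (fun y => S y (X y)) x :=
  ContMDiffAt.clm_bundle_apply (b := fun y => y) hS hX

/-- The derivative of a smooth function along a smooth field is smooth. -/
theorem ContMDiffAt.mvfderiv_apply (hf : ContMDiffAt 𝓘(ℝ, E) 𝓘(ℝ, ℝ) ∞ f x)
    (hX : SmoothFieldAt X x) :
    ContMDiffAt 𝓘(ℝ, E) 𝓘(ℝ, ℝ) ∞ (fun y => mvfderiv 𝓘(ℝ, E) f y (X y)) x := by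
  have h1 := hf.mfderiv_const (m := ∞) (by simp)
  have h2 := ContMDiffAt.clm_apply_of_inCoordinates (b₁ := fun y => y) (b₂ := f)
    (E₁ := fun x : M => TangentSpace 𝓘(ℝ, E) x) (E₂ := fun x : ℝ => TangentSpace 𝓘(ℝ, ℝ) x)
    (v := X) (ϕ := fun y => mfderiv 𝓘(ℝ, E) 𝓘(ℝ, ℝ) f y) h1 hX hf
  rw [contMDiffAt_totalSpace] at h2
  refine h2.2.congr_of_eventuallyEq ?_
  filter_upwards with y
  simp [mvfderiv]
  rfl

theorem SmoothFieldAt.grad {τ : M → ℝ} (hτ : ContMDiff 𝓘(ℝ, E) 𝓘(ℝ, ℝ) ∞ τ) (x : M) :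
    SmoothFieldAt (grad (E := E) τ) x := by
  refine smoothFieldAt_of_inner fun Z hZ => ?_
  refine (ContMDiffAt.mvfderiv_apply (hτ x) (hZ x)).congr_of_eventuallyEq ?_
  filter_upwards with y
  simp [KahlerGeom.grad]

theorem SmoothFieldAt.mlieBracket (hX : SmoothFieldAt X x) (hY : SmoothFieldAt Y x) :
    SmoothFieldAt (VectorField.mlieBracket 𝓘(ℝ, E) X Y) x := by
  have : IsManifold 𝓘(ℝ, E) (minSmoothness ℝ 2) M := by
    rw [minSmoothness_of_isRCLikeNormedField]
    exact IsManifold.of_le (n := ∞) (by norm_cast)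
  have : IsManifold 𝓘(ℝ, E) (((⊤ : ℕ∞) : WithTop ℕ∞) + 1) M := ‹IsManifold 𝓘(ℝ, E) ∞ M›
  exact ContMDiffAt.mlieBracket_vectorField (m := ⊤) (n := ⊤) hX hY (by simp)

theorem koszul_contMDiffAt (hX : SmoothFieldAt X x) (hY : SmoothFieldAt Y x)
    (hZ : SmoothFieldAt Z x) : ContMDiffAt 𝓘(ℝ, E) 𝓘(ℝ, ℝ) ∞ (koszul X Y Z) x := by
  unfold koszul
  refine contMDiffAt_const.mul
    (((((?_ : ContMDiffAt 𝓘(ℝ, E) 𝓘(ℝ, ℝ) ∞ _ x).add ?_).sub ?_).add ?_).sub ?_ |>.sub ?_)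
  · exact ContMDiffAt.mvfderiv_apply (hY.inner hZ) hX
  · exact ContMDiffAt.mvfderiv_apply (hZ.inner hX) hY
  · exact ContMDiffAt.mvfderiv_apply (hX.inner hY) hZ
  · exact (hX.mlieBracket hY).inner hZ
  · exact (hX.mlieBracket hZ).inner hY
  · exact (hY.mlieBracket hZ).inner hX

theorem SmoothFieldAt.leviCivita (hX : IsSmoothField X) (hY : IsSmoothField Y) :
    SmoothFieldAt (fun y => leviCivita E M Y y (X y)) x := by
  refine smoothFieldAt_of_inner fun Z hZ => ?_
  refine (koszul_contMDiffAt (hX x) (hY x) (hZ x)).congr_of_eventuallyEq ?_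
  filter_upwards with y
  exact inner_leviCivitaFun (hX.mdiffAt y) (hY.mdiffAt y) (hZ.mdiffAt y)

end Riem

/-! ### Calculus with the Levi-Civita connection -/

section Calculus

set_option linter.unusedSectionVars false

variable {E : Type*} [NormedAddCommGroup E] [NormedSpace ℝ E] [FiniteDimensional ℝ E]
  {M : Type*} [TopologicalSpace M] [ChartedSpace E M] [IsManifold 𝓘(ℝ, E) ∞ M] [T2Space M]
  [RiemannianBundle (fun x : M => TangentSpace 𝓘(ℝ, E) x)]
  [IsContMDiffRiemannianBundle 𝓘(ℝ, E) ∞ E (fun x : M => TangentSpace 𝓘(ℝ, E) x)]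
variable {X Y Z W : Π x : M, TangentSpace 𝓘(ℝ, E) x} {x : M} {f : M → ℝ}
local notation "⟪" v ", " w "⟫" => inner ℝ v w

/-- The field `∇_X Y`. -/
def nabla (X Y : Π x : M, TangentSpace 𝓘(ℝ, E) x) (x : M) : TangentSpace 𝓘(ℝ, E) x :=
  leviCivita E M Y x (X x)

/-- The function `X f`. -/
def lieD (X : Π x : M, TangentSpace 𝓘(ℝ, E) x) (f : M → ℝ) (x : M) : ℝ :=
  mvfderiv 𝓘(ℝ, E) f x (X x)

theorem IsSmoothField.nabla (hX : IsSmoothField X) (hY : IsSmoothField Y) :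
    IsSmoothField (nabla X Y) := fun _ => SmoothFieldAt.leviCivita hX hY

theorem IsSmoothField.sub (hX : IsSmoothField X) (hY : IsSmoothField Y) :
    IsSmoothField (fun y => X y - Y y) := fun x => (hX.smoothAt x).sub (hY.smoothAt x)

theorem IsSmoothField.smul (hf : ContMDiff 𝓘(ℝ, E) 𝓘(ℝ, ℝ) ∞ f) (hX : IsSmoothField X) :
    IsSmoothField (fun y => f y • X y) := fun x => SmoothFieldAt.smul (hf x) (hX.smoothAt x)

theorem IsSmoothField.end_apply
    {S : Π x : M, TangentSpace 𝓘(ℝ, E) x →L[ℝ] TangentSpace 𝓘(ℝ, E) x} (hS : IsSmoothEnd S)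
    (hX : IsSmoothField X) : IsSmoothField (fun y => S y (X y)) :=
  fun x => SmoothFieldAt.end_apply (hS x) (hX.smoothAt x)

theorem IsSmoothField.mlieBracket (hX : IsSmoothField X) (hY : IsSmoothField Y) :
    IsSmoothField (VectorField.mlieBracket 𝓘(ℝ, E) X Y) :=
  fun x => (hX.smoothAt x).mlieBracket (hY.smoothAt x)

theorem IsSmoothField.grad {τ : M → ℝ} (hτ : ContMDiff 𝓘(ℝ, E) 𝓘(ℝ, ℝ) ∞ τ) :
    IsSmoothField (grad (E := E) τ) := fun x => SmoothFieldAt.grad hτ x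

theorem IsSmoothField.inner (hX : IsSmoothField X) (hY : IsSmoothField Y) :
    ContMDiff 𝓘(ℝ, E) 𝓘(ℝ, ℝ) ∞ (fun y => ⟪X y, Y y⟫) :=
  fun x => (hX.smoothAt x).inner (hY.smoothAt x)

theorem IsSmoothField.lieD (hX : IsSmoothField X) (hf : ContMDiff 𝓘(ℝ, E) 𝓘(ℝ, ℝ) ∞ f) :
    ContMDiff 𝓘(ℝ, E) 𝓘(ℝ, ℝ) ∞ (lieD X f) :=
  fun x => ContMDiffAt.mvfderiv_apply (hf x) (hX.smoothAt x)

theorem inner_grad (f : M → ℝ) (x : M) (v : TangentSpace 𝓘(ℝ, E) x) :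
    ⟪grad f x, v⟫ = mvfderiv 𝓘(ℝ, E) f x v := by
  simp [KahlerGeom.grad]

/-- The connection is metric. -/
theorem lieD_inner (hX : IsSmoothField X) (hY : IsSmoothField Y) (hZ : IsSmoothField Z) (x : M) :
    lieD X (fun y => ⟪Y y, Z y⟫) x = ⟪nabla X Y x, Z x⟫ + ⟪Y x, nabla X Z x⟫ :=
  leviCivita_metric (hX.mdiffAt x) (hY.mdiffAt x) (hZ.mdiffAt x)

/-- The connection is torsion-free. -/
theorem nabla_sub_nabla (hX : IsSmoothField X) (hY : IsSmoothField Y) (x : M) :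
    nabla X Y x - nabla Y X x = VectorField.mlieBracket 𝓘(ℝ, E) X Y x := by
  have h := (leviCivita E M).torsion_eq_zero_iff.1 leviCivita_torsion (hX.mdiffAt x) (hY.mdiffAt x)
  exact h

theorem nabla_add (hY : IsSmoothField Y) (hZ : IsSmoothField Z) (x : M) :
    nabla X (fun y => Y y + Z y) x = nabla X Y x + nabla X Z x := by
  have := (leviCivita E M).isCovariantDerivativeOnUniv.add (hY.mdiffAt x) (hZ.mdiffAt x)
  exact congrArg (fun L : TangentSpace 𝓘(ℝ, E) x →L[ℝ] TangentSpace 𝓘(ℝ, E) x => L (X x)) this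

theorem nabla_smul (hf : ContMDiff 𝓘(ℝ, E) 𝓘(ℝ, ℝ) ∞ f) (hY : IsSmoothField Y) (x : M) :
    nabla X (fun y => f y • Y y) x = f x • nabla X Y x + lieD X f x • Y x := by
  have := (leviCivita E M).isCovariantDerivativeOnUniv.leibniz (hY.mdiffAt x)
    ((hf x).mdifferentiableAt (by simp))
  exact congrArg (fun L : TangentSpace 𝓘(ℝ, E) x →L[ℝ] TangentSpace 𝓘(ℝ, E) x => L (X x)) this

theorem nabla_neg (hY : IsSmoothField Y) (x : M) :
    nabla X (fun y => -Y y) x = -nabla X Y x := by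
  have := (leviCivita E M).isCovariantDerivativeOnUniv.smul_const (-1 : ℝ) (hY.mdiffAt x)
  have h2 : (fun y => -Y y) = (-1 : ℝ) • Y := by ext y; simp
  have h3 := congrArg (fun L : TangentSpace 𝓘(ℝ, E) x →L[ℝ] TangentSpace 𝓘(ℝ, E) x => L (X x)) this
  rw [h2]
  refine Eq.trans h3 ?_
  simp [nabla]

theorem IsSmoothField.neg (hY : IsSmoothField Y) : IsSmoothField (fun y => -Y y) := fun x =>
  ContMDiffAt.neg_section (hY x)

theorem nabla_sub (hY : IsSmoothField Y) (hZ : IsSmoothField Z) (x : M) :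
    nabla X (fun y => Y y - Z y) x = nabla X Y x - nabla X Z x := by
  simp only [sub_eq_add_neg]
  rw [nabla_add hY hZ.neg, nabla_neg hZ]

theorem leviCivita_congr {Y Y' : Π x : M, TangentSpace 𝓘(ℝ, E) x} (hY : SmoothFieldAt Y x)
    (h : ∀ᶠ y in 𝓝 x, Y' y = Y y) : leviCivita E M Y' x = leviCivita E M Y x :=
  (leviCivita E M).isCovariantDerivativeOnUniv.congr_of_eventuallyEq
    (hY.congr h).mdiffAt hY.mdiffAt Filter.univ_mem h

theorem lieD_mul {f g : M → ℝ} (hf : MDiffAt f x) (hg : MDiffAt g x) :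
    lieD X (fun y => f y * g y) x = f x * lieD X g x + lieD X f x * g x := by
  unfold lieD
  rw [mvfderiv_fun_mul hf hg]
  simp [mul_comm]

theorem lieD_add {f g : M → ℝ} (hf : MDiffAt f x) (hg : MDiffAt g x) :
    lieD X (fun y => f y + g y) x = lieD X f x + lieD X g x := by
  unfold lieD
  rw [mvfderiv_fun_add hf hg]
  simp

theorem lieD_sub {f g : M → ℝ} (hf : MDiffAt f x) (hg : MDiffAt g x) :
    lieD X (fun y => f y - g y) x = lieD X f x - lieD X g x := by
  unfold lieD
  rw [show (fun y => f y - g y) = f - g from rfl, mvfderiv_sub hf hg]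
  simp

theorem lieD_congr {f g : M → ℝ} (h : ∀ᶠ y in 𝓝 x, f y = g y) : lieD X f x = lieD X g x := by
  have := Filter.EventuallyEq.mfderiv_eq (I := 𝓘(ℝ, E)) (I' := 𝓘(ℝ, ℝ)) h
  exact congrArg (fun L : TangentSpace 𝓘(ℝ, E) x →L[ℝ] ℝ => L (X x)) this

/-- `[X, Y] f = X (Y f) - Y (X f)`, a consequence of the Jacobi identity for `X`, `Y`, `f Z`. -/
theorem mvfderiv_mlieBracket (hX : IsSmoothField X) (hY : IsSmoothField Y)
    (hf : ContMDiff 𝓘(ℝ, E) 𝓘(ℝ, ℝ) ∞ f) (x : M) :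
    mvfderiv 𝓘(ℝ, E) f x (VectorField.mlieBracket 𝓘(ℝ, E) X Y x)
      = lieD X (lieD Y f) x - lieD Y (lieD X f) x := by
  by_cases hall : ∀ v : TangentSpace 𝓘(ℝ, E) x, v = 0
  · simp [lieD, hall (X x), hall (Y x), hall (VectorField.mlieBracket 𝓘(ℝ, E) X Y x)]
  push Not at hall
  obtain ⟨v, hv⟩ := hall
  obtain ⟨Z, hZ, rfl, -⟩ := exists_contMDiff_extend v
  have : IsManifold 𝓘(ℝ, E) (minSmoothness ℝ 3) M := by
    rw [minSmoothness_of_isRCLikeNormedField]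
    exact IsManifold.of_le (n := ∞) (by norm_cast)
  have hfd : ∀ {g : M → ℝ}, ContMDiff 𝓘(ℝ, E) 𝓘(ℝ, ℝ) ∞ g → ∀ y, MDiffAt g y :=
    fun hg y => (hg y).mdifferentiableAt (by simp)
  have hjac : ∀ Z : Π x : M, TangentSpace 𝓘(ℝ, E) x, IsSmoothField Z →
      VectorField.mlieBracket 𝓘(ℝ, E) X (VectorField.mlieBracket 𝓘(ℝ, E) Y Z) x
      = VectorField.mlieBracket 𝓘(ℝ, E) (VectorField.mlieBracket 𝓘(ℝ, E) X Y) Z x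
        + VectorField.mlieBracket 𝓘(ℝ, E) Y (VectorField.mlieBracket 𝓘(ℝ, E) X Z) x := by
    intro Z hZ
    have h2 : minSmoothness ℝ 2 ≤ ∞ := by
      rw [minSmoothness_of_isRCLikeNormedField]; norm_cast
    exact VectorField.leibniz_identity_mlieBracket_apply ((hX x).of_le h2) ((hY x).of_le h2)
      ((hZ x).of_le h2)
  have hsm : ∀ V Z : Π x : M, TangentSpace 𝓘(ℝ, E) x, IsSmoothField Z → ∀ g : M → ℝ,
      ContMDiff 𝓘(ℝ, E) 𝓘(ℝ, ℝ) ∞ g →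
      VectorField.mlieBracket 𝓘(ℝ, E) V (g • Z)
        = lieD V g • Z + g • VectorField.mlieBracket 𝓘(ℝ, E) V Z := by
    intro V Z hZ g hg
    ext y
    exact VectorField.mlieBracket_smul_right (hfd hg y) (hZ.mdiffAt y)
  have e1 := hjac (f • Z) (hZ.smul hf)
  have e2 := hjac Z hZ
  rw [hsm _ Z hZ f hf, hsm _ Z hZ f hf, hsm _ Z hZ f hf] at e1
  have hadd : ∀ V A B : Π x : M, TangentSpace 𝓘(ℝ, E) x, IsSmoothField A → IsSmoothField B →
      VectorField.mlieBracket 𝓘(ℝ, E) V (A + B) x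
        = VectorField.mlieBracket 𝓘(ℝ, E) V A x + VectorField.mlieBracket 𝓘(ℝ, E) V B x :=
    fun V A B hA hB => VectorField.mlieBracket_add_right (hA.mdiffAt x) (hB.mdiffAt x)
  rw [hadd X (lieD Y f • Z) (f • VectorField.mlieBracket 𝓘(ℝ, E) Y Z) (hZ.smul (hY.lieD hf))
      ((hY.mlieBracket hZ).smul hf),
    hadd Y (lieD X f • Z) (f • VectorField.mlieBracket 𝓘(ℝ, E) X Z) (hZ.smul (hX.lieD hf))
      ((hX.mlieBracket hZ).smul hf),
    hsm _ Z hZ _ (hY.lieD hf), hsm _ Z hZ _ (hX.lieD hf), hsm _ _ (hY.mlieBracket hZ) f hf,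
    hsm _ _ (hX.mlieBracket hZ) f hf] at e1
  simp only [Pi.add_apply, Pi.smul_apply', e2] at e1
  have e3 : (mvfderiv 𝓘(ℝ, E) f x (VectorField.mlieBracket 𝓘(ℝ, E) X Y x)
      - (lieD X (lieD Y f) x - lieD Y (lieD X f) x)) • Z x = 0 := by
    rw [sub_smul, sub_smul]
    change lieD (VectorField.mlieBracket 𝓘(ℝ, E) X Y) f x • Z x - _ = 0
    rw [smul_add] at e1
    linear_combination (norm := module) -e1
  exact sub_eq_zero.1 ((smul_eq_zero.1 e3).resolve_right hv)

/-! ### Symmetries of the curvature -/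

theorem curvature_eq (X Y Z : Π x : M, TangentSpace 𝓘(ℝ, E) x) (x : M) :
    curvature X Y Z x = nabla X (nabla Y Z) x - nabla Y (nabla X Z) x
      - leviCivita E M Z x (VectorField.mlieBracket 𝓘(ℝ, E) X Y x) := rfl

/-- The curvature `(0,4)`-tensor `⟨R(X, Y) Z, W⟩`. -/
def riem (X Y Z W : Π x : M, TangentSpace 𝓘(ℝ, E) x) (x : M) : ℝ :=
  ⟪curvature X Y Z x, W x⟫

theorem riem_swap_left (X Y Z W : Π x : M, TangentSpace 𝓘(ℝ, E) x) (x : M) :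
    riem X Y Z W x = -riem Y X Z W x := by
  simp only [riem, curvature_eq]
  rw [VectorField.mlieBracket_swap_apply, map_neg, ← inner_neg_left]
  congr 1
  abel

/-- `⟨R(X, Y) Z, W⟩` is skew in `Z`, `W`: `[X, Y]` acts on the function `⟨Z, W⟩` as the commutator of
`X` and `Y`, and the connection is metric. -/
theorem riem_swap_right (hX : IsSmoothField X) (hY : IsSmoothField Y) (hZ : IsSmoothField Z)
    (hW : IsSmoothField W) (x : M) : riem X Y Z W x = -riem X Y W Z x := by
  have h0 := mvfderiv_mlieBracket hX hY (hZ.inner hW) x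
  have h1 := lieD_inner (hX.mlieBracket hY) hZ hW x
  have key : ∀ {X Y : Π x : M, TangentSpace 𝓘(ℝ, E) x}, IsSmoothField X → IsSmoothField Y →
      lieD X (lieD Y (fun y => ⟪Z y, W y⟫)) x
        = (⟪nabla X (nabla Y Z) x, W x⟫ + ⟪nabla Y Z x, nabla X W x⟫)
          + (⟪nabla X Z x, nabla Y W x⟫ + ⟪Z x, nabla X (nabla Y W) x⟫) := by
    intro X Y hX hY
    have : lieD Y (fun y => ⟪Z y, W y⟫)
        = fun y => ⟪nabla Y Z y, W y⟫ + ⟪Z y, nabla Y W y⟫ :=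
      funext fun y => lieD_inner hY hZ hW y
    rw [this, lieD_add ((((hY.nabla hZ).inner hW) x).mdifferentiableAt (by simp))
      (((hZ.inner (hY.nabla hW)) x).mdifferentiableAt (by simp)),
      lieD_inner hX (hY.nabla hZ) hW, lieD_inner hX hZ (hY.nabla hW)]
  rw [key hX hY, key hY hX] at h0
  simp only [riem, curvature_eq, inner_sub_left]
  have h2 : lieD (VectorField.mlieBracket 𝓘(ℝ, E) X Y) (fun y => ⟪Z y, W y⟫) x
    = mvfderiv 𝓘(ℝ, E) (fun y => ⟪Z y, W y⟫) x (VectorField.mlieBracket 𝓘(ℝ, E) X Y x) := rfl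
  have h3 : ∀ V : Π x : M, TangentSpace 𝓘(ℝ, E) x,
      leviCivita E M V x (VectorField.mlieBracket 𝓘(ℝ, E) X Y x)
        = nabla (VectorField.mlieBracket 𝓘(ℝ, E) X Y) V x := fun V => rfl
  rw [h3, h3]
  have c1 := real_inner_comm (Z x) (nabla X (nabla Y W) x)
  have c2 := real_inner_comm (Z x) (nabla Y (nabla X W) x)
  have c3 := real_inner_comm (Z x) (nabla (VectorField.mlieBracket 𝓘(ℝ, E) X Y) W x)
  linarith

/-- The first Bianchi identity. -/
theorem riem_cyclic (hX : IsSmoothField X) (hY : IsSmoothField Y) (hZ : IsSmoothField Z)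
    (W : Π x : M, TangentSpace 𝓘(ℝ, E) x) (x : M) :
    riem X Y Z W x + riem Y Z X W x + riem Z X Y W x = 0 := by
  have : IsManifold 𝓘(ℝ, E) (minSmoothness ℝ 3) M := by
    rw [minSmoothness_of_isRCLikeNormedField]
    exact IsManifold.of_le (n := ∞) (by norm_cast)
  have h2 : minSmoothness ℝ 2 ≤ ∞ := by
    rw [minSmoothness_of_isRCLikeNormedField]; norm_cast
  have hjac := VectorField.leibniz_identity_mlieBracket_apply ((hX x).of_le h2) ((hY x).of_le h2)
      ((hZ x).of_le h2)
  have key : ∀ {X Y Z : Π x : M, TangentSpace 𝓘(ℝ, E) x}, IsSmoothField X → IsSmoothField Y →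
      IsSmoothField Z → nabla X (nabla Y Z) x - nabla X (nabla Z Y) x
        = leviCivita E M X x (VectorField.mlieBracket 𝓘(ℝ, E) Y Z x)
          + VectorField.mlieBracket 𝓘(ℝ, E) X (VectorField.mlieBracket 𝓘(ℝ, E) Y Z) x := by
    intro X Y Z hX hY hZ
    rw [← nabla_sub (hY.nabla hZ) (hZ.nabla hY), ← nabla_sub_nabla hX (hY.mlieBracket hZ)]
    have : (fun y => nabla Y Z y - nabla Z Y y) = VectorField.mlieBracket 𝓘(ℝ, E) Y Z :=
      funext fun y => nabla_sub_nabla hY hZ y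
    rw [this]
    simp [nabla]
  have k1 := key hX hY hZ
  have k2 := key hY hZ hX
  have k3 := key hZ hX hY
  have h : curvature X Y Z x + curvature Y Z X x + curvature Z X Y x = 0 := by
    simp only [curvature_eq]
    have s1 : VectorField.mlieBracket 𝓘(ℝ, E) (VectorField.mlieBracket 𝓘(ℝ, E) X Y) Z x
      = -VectorField.mlieBracket 𝓘(ℝ, E) Z (VectorField.mlieBracket 𝓘(ℝ, E) X Y) x :=
      VectorField.mlieBracket_swap_apply
    have s2 : VectorField.mlieBracket 𝓘(ℝ, E) Y (VectorField.mlieBracket 𝓘(ℝ, E) X Z) x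
      = -VectorField.mlieBracket 𝓘(ℝ, E) Y (VectorField.mlieBracket 𝓘(ℝ, E) Z X) x := by
      have a1 : VectorField.mlieBracket 𝓘(ℝ, E) X Z
        = fun y => -VectorField.mlieBracket 𝓘(ℝ, E) Z X y :=
        funext fun y => VectorField.mlieBracket_swap_apply
      rw [← nabla_sub_nabla hY (hX.mlieBracket hZ), ← nabla_sub_nabla hY (hZ.mlieBracket hX), a1,
        nabla_neg (hZ.mlieBracket hX)]
      simp only [nabla, map_neg]
      abel
    rw [s1, s2] at hjac
    linear_combination (norm := module) k1 + k2 + k3 + hjac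
  simp only [riem, ← inner_add_left, h, inner_zero_left]

/-- Pair symmetry of the curvature. -/
theorem riem_pair_symm (hX : IsSmoothField X) (hY : IsSmoothField Y) (hZ : IsSmoothField Z)
    (hW : IsSmoothField W) (x : M) : riem X Y Z W x = riem Z W X Y x := by
  have b1 := riem_cyclic hX hY hZ W x
  have b2 := riem_cyclic hY hZ hW X x
  have b3 := riem_cyclic hZ hW hX Y x
  have b4 := riem_cyclic hW hX hY Z x
  have l := fun X Y Z W : Π x : M, TangentSpace 𝓘(ℝ, E) x => riem_swap_left X Y Z W x
  linarith [l X Y Z W, riem_swap_right hX hY hZ hW x, riem_swap_right hY hZ hX hW x,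
    riem_swap_right hZ hX hY hW x, riem_swap_right hY hZ hW hX x, riem_swap_right hZ hW hY hX x,
    riem_swap_right hW hY hZ hX x, riem_swap_right hZ hW hX hY x, riem_swap_right hW hX hZ hY x,
    riem_swap_right hX hZ hW hY x, riem_swap_right hW hX hY hZ x, riem_swap_right hX hY hW hZ x,
    riem_swap_right hY hW hX hZ x, l X Z W Y, l X Z Y W, l W Y Z X, l W Y X Z, l Y W X Z,
    l Z X Y W, l Y Z X W, l X Y W Z, l Z W X Y, l W X Y Z, l W X Z Y, l Y Z W X]

end Calculus

/-! ### The Hessian of a Killing potential -/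

section Killing

set_option linter.unusedSectionVars false

variable {E : Type*} [NormedAddCommGroup E] [NormedSpace ℝ E] [FiniteDimensional ℝ E]
  {M : Type*} [TopologicalSpace M] [ChartedSpace E M] [IsManifold 𝓘(ℝ, E) ∞ M] [T2Space M]
  [RiemannianBundle (fun x : M => TangentSpace 𝓘(ℝ, E) x)]
  [IsContMDiffRiemannianBundle 𝓘(ℝ, E) ∞ E (fun x : M => TangentSpace 𝓘(ℝ, E) x)]
variable {X Y Z W : Π x : M, TangentSpace 𝓘(ℝ, E) x} {x : M} {τ : M → ℝ}
local notation "⟪" v ", " w "⟫" => inner ℝ v w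

theorem isSmoothEnd_hess (hτ : ContMDiff 𝓘(ℝ, E) 𝓘(ℝ, ℝ) ∞ τ) : IsSmoothEnd (hess (E := E) τ) :=
  fun _ => contMDiffAt_end_of_forall fun _ hY => (hY.nabla (IsSmoothField.grad hτ)).smoothAt _

/-- The Hessian is self-adjoint, because the Levi-Civita connection is torsion-free. -/
theorem inner_hess_comm (hτ : ContMDiff 𝓘(ℝ, E) 𝓘(ℝ, ℝ) ∞ τ) (x : M)
    (v w : TangentSpace 𝓘(ℝ, E) x) : ⟪hess τ x v, w⟫ = ⟪v, hess τ x w⟫ := by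
  obtain ⟨X, hX, rfl, -⟩ := exists_contMDiff_extend v
  obtain ⟨Y, hY, rfl, -⟩ := exists_contMDiff_extend w
  have hg := IsSmoothField.grad (E := E) hτ
  have h0 := mvfderiv_mlieBracket hX hY hτ x
  have e : ∀ {Y : Π x : M, TangentSpace 𝓘(ℝ, E) x}, lieD Y τ = fun y => ⟪grad τ y, Y y⟫ :=
    funext fun y => (inner_grad τ y _).symm
  rw [e, e, lieD_inner hX hg hY, lieD_inner hY hg hX, ← inner_grad, ← nabla_sub_nabla hX hY,
    inner_sub_right] at h0
  have : ⟪nabla X (grad τ) x, Y x⟫ = ⟪nabla Y (grad τ) x, X x⟫ := by linarith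
  rw [real_inner_comm] at this
  rw [real_inner_comm]
  exact this.trans (real_inner_comm _ _)

/-- Kostant's formula `∇_Z ∇ξ = R(Z, ξ)` for a Killing field `ξ`, in terms of inner products and
rewritten by the pair symmetry of the curvature. -/
theorem IsKillingField.riem_eq {ξ : Π x : M, TangentSpace 𝓘(ℝ, E) x} (hξ : IsKillingField ξ)
    (hX : IsSmoothField X) (hY : IsSmoothField Y) (hZ : IsSmoothField Z) (x : M) :
    riem X Y ξ Z x = -⟪nabla Z (nabla X ξ) x - nabla (nabla Z X) ξ x, Y x⟫ := by
  have hs := hξ.smooth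
  -- `∇_X ∇ξ` is skew-adjoint
  have skew : ∀ {X Y Z : Π x : M, TangentSpace 𝓘(ℝ, E) x}, IsSmoothField X → IsSmoothField Y →
      IsSmoothField Z → ⟪nabla X (nabla Y ξ) x - nabla (nabla X Y) ξ x, Z x⟫
        = -⟪nabla X (nabla Z ξ) x - nabla (nabla X Z) ξ x, Y x⟫ := by
    intro X Y Z hX hY hZ
    have h1 := lieD_inner hX (hY.nabla hs) hZ x
    have h2 := lieD_inner hX (hZ.nabla hs) hY x
    have h3 : (fun y => ⟪nabla Y ξ y, Z y⟫) = fun y => 0 - ⟪nabla Z ξ y, Y y⟫ := by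
      funext y
      have := hξ.skew y (Y y) (Z y)
      rw [real_inner_comm (leviCivita E M ξ y (Z y)) (Y y)] at this
      simp only [nabla]
      linarith
    rw [h3, lieD_sub mdifferentiableAt_const
      ((((hZ.nabla hs).inner hY) x).mdifferentiableAt (by simp))] at h1
    have h4 : lieD X (fun _ : M => (0 : ℝ)) x = 0 := by
      unfold lieD; rw [mvfderiv_const]; rfl
    have h5 := hξ.skew x (nabla X Y x) (Z x)
    have h6 := hξ.skew x (nabla X Z x) (Y x)
    rw [inner_sub_left, inner_sub_left]
    have c1 := real_inner_comm (nabla X Y x) (leviCivita E M ξ x (Z x))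
    have c2 := real_inner_comm (nabla X Z x) (leviCivita E M ξ x (Y x))
    simp only [nabla] at *
    linarith
  -- the alternation of `∇_X ∇ξ` in its first two arguments is the curvature
  have alt : ∀ {X Y : Π x : M, TangentSpace 𝓘(ℝ, E) x}, IsSmoothField X → IsSmoothField Y →
      ∀ Z, riem X Y ξ Z x = ⟪nabla X (nabla Y ξ) x - nabla (nabla X Y) ξ x, Z x⟫
        - ⟪nabla Y (nabla X ξ) x - nabla (nabla Y X) ξ x, Z x⟫ := by
    intro X Y hX hY Z
    rw [riem, curvature_eq, ← nabla_sub_nabla hX hY, map_sub, ← inner_sub_left]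
    congr 1
    simp only [nabla]
    abel
  have b := riem_cyclic hX hY hZ ξ x
  rw [riem_swap_right hX hY hZ hs, riem_swap_right hY hZ hX hs, riem_swap_right hZ hX hY hs] at b
  have a1 := alt hX hY Z
  have a2 := alt hY hZ X
  have a3 := alt hZ hX Y
  have s1 := skew hX hY hZ
  have s2 := skew hY hZ hX
  have s3 := skew hZ hX hY
  linarith

variable {J : Π x : M, TangentSpace 𝓘(ℝ, E) x →L[ℝ] TangentSpace 𝓘(ℝ, E) x}

theorem IsKahler.inner_J_left (hJ : IsKahler J) (x : M) (v w : TangentSpace 𝓘(ℝ, E) x) :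
    ⟪J x v, w⟫ = -⟪v, J x w⟫ := by
  have := hJ.orthogonal x v (J x w)
  rw [hJ.sq, inner_neg_right] at this
  linarith

theorem IsKahler.nabla_J (hJ : IsKahler J) (hX : IsSmoothField X) (hY : IsSmoothField Y) (x : M) :
    nabla X (fun y => J y (Y y)) x = J x (nabla X Y x) :=
  sub_eq_zero.1 (hJ.parallel X Y hX hY x)

/-- Since `∇J = 0`, the curvature endomorphisms are complex linear. -/
theorem IsKahler.curvature_J (hJ : IsKahler J) (hX : IsSmoothField X) (hY : IsSmoothField Y)
    (hZ : IsSmoothField Z) (x : M) :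
    curvature X Y (fun y => J y (Z y)) x = J x (curvature X Y Z x) := by
  have e : ∀ {Y : Π x : M, TangentSpace 𝓘(ℝ, E) x}, IsSmoothField Y →
      nabla Y (fun y => J y (Z y)) = fun y => J y (nabla Y Z y) :=
    fun hY => funext fun y => hJ.nabla_J hY hZ y
  rw [curvature_eq, curvature_eq, e hX, e hY, hJ.nabla_J hX (hY.nabla hZ),
    hJ.nabla_J hY (hX.nabla hZ), map_sub, map_sub]
  congr 1
  exact hJ.nabla_J (hX.mlieBracket hY) hZ x

/-- `⟨(∇_X H) Y, Z⟩` for the Hessian `H` of `τ`. -/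
def hessD (τ : M → ℝ) (X Y Z : Π x : M, TangentSpace 𝓘(ℝ, E) x) (x : M) : ℝ :=
  ⟪covDerivEnd (hess τ) X Y x, Z x⟫

/-- The Ricci identity for the gradient. -/
theorem hessD_sub_hessD (hX : IsSmoothField X) (hY : IsSmoothField Y) (x : M) :
    hessD τ X Y Z x - hessD τ Y X Z x = riem X Y (grad τ) Z x := by
  simp only [hessD, riem, curvature_eq, covDerivEnd, ← inner_sub_left]
  congr 1
  rw [← nabla_sub_nabla hX hY, map_sub]
  change nabla X (nabla Y (grad τ)) x - nabla (nabla X Y) (grad τ) x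
      - (nabla Y (nabla X (grad τ)) x - nabla (nabla Y X) (grad τ) x)
    = nabla X (nabla Y (grad τ)) x - nabla Y (nabla X (grad τ)) x
      - (nabla (nabla X Y) (grad τ) x - nabla (nabla Y X) (grad τ) x)
  abel

/-- A Killing potential on a Kähler manifold: a smooth function `τ` such that `J∇τ` is a Killing
field. -/
structure IsKillingPotential
    (J : Π x : M, TangentSpace 𝓘(ℝ, E) x →L[ℝ] TangentSpace 𝓘(ℝ, E) x) (τ : M → ℝ) : Prop where
  kahler : IsKahler J
  smooth : ContMDiff 𝓘(ℝ, E) 𝓘(ℝ, ℝ) ∞ τ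
  killing : IsKillingField (fun x => J x (grad τ x))

namespace IsKillingPotential

variable (h : IsKillingPotential J τ)
include h

theorem smooth_grad : IsSmoothField (grad (E := E) τ) := IsSmoothField.grad h.smooth

theorem nabla_J_grad (hX : IsSmoothField X) (x : M) :
    nabla X (fun y => J y (grad τ y)) x = J x (hess τ x (X x)) :=
  h.kahler.nabla_J hX h.smooth_grad x

/-- The field `J∇τ` is Killing exactly if the Hessian commutes with `J`. -/
theorem hess_J (x : M) (v : TangentSpace 𝓘(ℝ, E) x) : hess τ x (J x v) = J x (hess τ x v) := by
  have hB : ∀ v : TangentSpace 𝓘(ℝ, E) x,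
      leviCivita E M (fun y => J y (grad τ y)) x v = J x (hess τ x v) := by
    intro v
    obtain ⟨X, hX, rfl, -⟩ := exists_contMDiff_extend v
    exact h.nabla_J_grad hX x
  refine ext_inner_right ℝ fun w => ?_
  have h1 := h.killing.skew x v w
  rw [hB, hB] at h1
  have h2 := h.kahler.inner_J_left x v (hess τ x w)
  have h3 := inner_hess_comm h.smooth x (J x v) w
  linarith

/-- Kostant's formula for `ξ = J∇τ`, where `∇ξ = J ∘ ∇∇τ`. -/
theorem hessD_J_right (hX : IsSmoothField X) (hY : IsSmoothField Y) (hZ : IsSmoothField Z) (x : M) :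
    hessD τ Z X (fun y => J y (Y y)) x = riem X Y (fun y => J y (grad τ y)) Z x := by
  rw [h.killing.riem_eq hX hY hZ]
  have e : ∀ {X : Π x : M, TangentSpace 𝓘(ℝ, E) x}, IsSmoothField X →
      nabla X (fun y => J y (grad τ y)) = fun y => J y (nabla X (grad τ) y) :=
    fun hX => funext fun y => h.kahler.nabla_J hX h.smooth_grad y
  rw [e hX, h.kahler.nabla_J hZ (hX.nabla h.smooth_grad), e (hZ.nabla hX), ← map_sub,
    h.kahler.inner_J_left, neg_neg]
  rfl

/-- Kostant's formula for `ξ = J∇τ`, solved for the derivative of the Hessian. -/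
theorem hessD_eq_riem (hX : IsSmoothField X) (hY : IsSmoothField Y) (hZ : IsSmoothField Z) (x : M) :
    hessD τ Z X Y x = -riem X (fun y => J y (Y y)) (fun y => J y (grad τ y)) Z x := by
  rw [← h.hessD_J_right hX (hY.end_apply h.kahler.smooth) hZ, hessD, hessD, h.kahler.sq,
    inner_neg_right, neg_neg]

/-- The closedness of the 2-form `⟨∇ξ, ·⟩`, `ξ = J∇τ`: Kostant's formula and the Ricci identity
express the same curvature term. -/
theorem hessD_cyclic (hX : IsSmoothField X) (hY : IsSmoothField Y) (hZ : IsSmoothField Z) (x : M) :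
    hessD τ X Y Z x = hessD τ Y X Z x
      + hessD τ (fun y => J y (Z y)) X (fun y => J y (Y y)) x := by
  rw [h.hessD_J_right hX hY (hZ.end_apply h.kahler.smooth), riem,
    h.kahler.curvature_J hX hY h.smooth_grad, h.kahler.orthogonal]
  have := hessD_sub_hessD (τ := τ) (Z := Z) hX hY x
  rw [riem] at this
  linarith

end IsKillingPotential
end Killing

/-! ### Division by a function with nonzero differential -/

section Division

variable {D : Type*} [NormedAddCommGroup D] [NormedSpace ℝ D] [FiniteDimensional ℝ D]

/-- Differentiation under the integral sign, iterated. -/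
theorem contDiff_intervalIntegral (n : ℕ) {F : D → ℝ → ℝ}
    (hF : ContDiff ℝ ∞ (fun p : D × ℝ => F p.1 p.2)) :
    ContDiff ℝ n (fun x => ∫ t in (0 : ℝ)..1, F x t) := by
  induction n generalizing F with
  | zero =>
    rw [Nat.cast_zero, contDiff_zero]
    exact intervalIntegral.continuous_parametric_intervalIntegral_of_continuous' hF.continuous 0 1
  | succ n ih =>
    set F' : D → ℝ → D →L[ℝ] ℝ := fun x t =>
      (fderiv ℝ (fun p : D × ℝ => F p.1 p.2) (x, t)).comp (ContinuousLinearMap.inl ℝ D ℝ) with hF'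
    have hF's : ContDiff ℝ ∞ (fun p : D × ℝ => F' p.1 p.2) :=
      (hF.fderiv_right (m := ∞) (by simp)).clm_comp contDiff_const
    have hpart : ∀ x t, HasFDerivAt (fun x => F x t) (F' x t) x := fun x t =>
      HasFDerivAt.comp (f := fun x => (x, t)) (g := fun p : D × ℝ => F p.1 p.2) x
        ((hF.differentiable (by simp)) (x, t)).hasFDerivAt (hasFDerivAt_prodMk_left x t)
    have hder : ∀ x, HasFDerivAt (fun x => ∫ t in (0 : ℝ)..1, F x t)
        (∫ t in (0 : ℝ)..1, F' x t) x := by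
      intro x
      obtain ⟨C, hC⟩ := ((isCompact_closedBall x 1).prod (isCompact_Icc (a := (0 : ℝ)) (b := 1))
        ).exists_bound_of_continuousOn hF's.continuous.continuousOn
      refine intervalIntegral.hasFDerivAt_integral_of_dominated_of_fderiv_le
        (bound := fun _ => C) (Metric.closedBall_mem_nhds x one_pos) ?_ ?_ ?_ ?_ ?_ ?_
      · exact Filter.Eventually.of_forall fun y =>
          (hF.continuous.comp (Continuous.prodMk_right y)).aestronglyMeasurable
      · exact (hF.continuous.comp (Continuous.prodMk_right x)).intervalIntegrable _ _
      · exact (hF's.continuous.comp (Continuous.prodMk_right x)).aestronglyMeasurable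
      · refine Filter.Eventually.of_forall fun t ht y hy => hC (y, t) ⟨hy, ?_⟩
        rw [Set.uIoc_of_le zero_le_one] at ht
        exact ⟨ht.1.le, ht.2⟩
      · exact intervalIntegrable_const
      · exact Filter.Eventually.of_forall fun t _ y _ => hpart y t
    rw [Nat.cast_succ, contDiff_succ_iff_fderiv_apply]
    refine ⟨fun x => (hder x).differentiableAt, by simp, fun v => ?_⟩
    have : (fun x => fderiv ℝ (fun x => ∫ t in (0 : ℝ)..1, F x t) x v)
        = fun x => ∫ t in (0 : ℝ)..1, F' x t v := by
      funext x
      rw [(hder x).fderiv, ContinuousLinearMap.intervalIntegral_apply]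
      exact (hF's.continuous.comp (Continuous.prodMk_right x)).intervalIntegrable _ _
    rw [this]
    exact ih (hF's.clm_apply contDiff_const)

/-- Hadamard's lemma: a smooth function vanishing on the hyperplane `ℓ = 0` is a smooth multiple
of `ℓ`. -/
theorem exists_contDiff_eq_mul_of_linear {b : D → ℝ} (hb : ContDiff ℝ ∞ b) {ℓ : D →L[ℝ] ℝ} {v : D}
    (hv : ℓ v = 1) (h0 : ∀ z, ℓ z = 0 → b z = 0) :
    ∃ h : D → ℝ, ContDiff ℝ ∞ h ∧ ∀ z, b z = ℓ z * h z := by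
  refine ⟨fun z => ∫ t in (0 : ℝ)..1, fderiv ℝ b (z - ((1 - t) * ℓ z) • v) v, ?_, fun z => ?_⟩
  · refine contDiff_infty.2 fun n => contDiff_intervalIntegral n ?_
    refine ((hb.fderiv_right (m := ∞) (by simp)).comp ?_).clm_apply contDiff_const
    exact contDiff_fst.sub (((contDiff_const.sub contDiff_snd).mul
      (ℓ.contDiff.comp contDiff_fst)).smul contDiff_const)
  · have hd : ∀ t ∈ Set.uIcc (0 : ℝ) 1, HasDerivAt (fun t : ℝ => b (z - ((1 - t) * ℓ z) • v))
        (ℓ z * fderiv ℝ b (z - ((1 - t) * ℓ z) • v) v) t := by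
      intro t _
      have h1 : HasDerivAt (fun t : ℝ => z - ((1 - t) * ℓ z) • v) (ℓ z • v) t := by
        have := ((((hasDerivAt_id t).const_sub 1).mul_const (ℓ z)).smul_const v).const_sub z
        simpa using this
      have h2 := (hb.differentiable (by simp)
        (z - ((1 - t) * ℓ z) • v)).hasFDerivAt.comp_hasDerivAt t h1
      rw [map_smul, smul_eq_mul] at h2
      exact h2
    have hcont : Continuous fun t : ℝ => ℓ z * fderiv ℝ b (z - ((1 - t) * ℓ z) • v) v := by
      have := (hb.fderiv_right (m := ∞) (by simp)).continuous
      fun_prop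
    have h3 := intervalIntegral.integral_eq_sub_of_hasDerivAt hd (hcont.intervalIntegrable _ _)
    rw [intervalIntegral.integral_const_mul] at h3
    have h4 : b (z - ((1 - 0) * ℓ z) • v) = 0 := h0 _ (by simp [hv])
    rw [h4] at h3
    rw [h3]
    simp

/-- If `a` has nonzero derivative at `z₀` and `b` vanishes where `a` does, then `b / a` is smooth:
a diffeomorphism makes `a` linear, and Hadamard's lemma applies. -/
theorem exists_contDiffAt_eq_mul {a b : D → ℝ} {s : Set D} (hs : IsOpen s) {z₀ : D} (hz₀ : z₀ ∈ s)
    (ha : ContDiffOn ℝ ∞ a s) (hb : ContDiffOn ℝ ∞ b s) (hda : fderiv ℝ a z₀ ≠ 0)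
    (h0 : ∀ z ∈ s, a z = 0 → b z = 0) :
    ∃ h : D → ℝ, ContDiffAt ℝ ∞ h z₀ ∧ ∀ᶠ z in 𝓝 z₀, b z = a z * h z := by
  have haa : ∀ z ∈ s, ContDiffAt ℝ ∞ a z := fun z hz => ha.contDiffAt (hs.mem_nhds hz)
  have hba : ∀ z ∈ s, ContDiffAt ℝ ∞ b z := fun z hz => hb.contDiffAt (hs.mem_nhds hz)
  set ℓ := fderiv ℝ a z₀ with hℓ
  obtain ⟨v, hv⟩ : ∃ v, ℓ v = 1 := by
    obtain ⟨u, hu⟩ : ∃ u, ℓ u ≠ 0 := by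
      by_contra! hc
      exact hda (ContinuousLinearMap.ext hc)
    exact ⟨(ℓ u)⁻¹ • u, by simp [hu]⟩
  -- a local diffeomorphism carrying `a` to the linear function `ℓ`
  set Ψ : D → D := fun z => z + (a z - ℓ z) • v with hΨ
  have hℓΨ : ∀ z, ℓ (Ψ z) = a z := fun z => by simp [hΨ, hv]
  have hΨs : ∀ z ∈ s, ContDiffAt ℝ ∞ Ψ z := fun z hz =>
    contDiffAt_id.add (((haa z hz).sub ℓ.contDiff.contDiffAt).smul contDiffAt_const)
  have hΨd : HasFDerivAt Ψ ((ContinuousLinearEquiv.refl ℝ D : D ≃L[ℝ] D) : D →L[ℝ] D) z₀ := by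
    have h1 := (((haa z₀ hz₀).differentiableAt (by simp)).hasFDerivAt.sub
      (ℓ.hasFDerivAt (x := z₀))).smul_const v
    have h2 := (hasFDerivAt_id z₀).add h1
    refine h2.congr_fderiv ?_
    ext w
    simp [← hℓ]
  set Φ := (hΨs z₀ hz₀).toOpenPartialHomeomorph Ψ hΨd (by simp) with hΦ
  have hΦc : (Φ : D → D) = Ψ := rfl
  have hz₀Φ : z₀ ∈ Φ.source := (hΨs z₀ hz₀).mem_toOpenPartialHomeomorph_source hΨd (by simp)
  -- near `Ψ z₀` the inverse of `Ψ` is smooth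
  have hnear : ∀ᶠ w in 𝓝 (Ψ z₀), w ∈ Φ.target ∧ Φ.symm w ∈ s ∧ ContDiffAt ℝ ∞ Φ.symm w := by
    have h1 : ∀ᶠ z in 𝓝 z₀, z ∈ s ∧ fderiv ℝ Ψ z ∈ Set.range ((↑) : (D ≃L[ℝ] D) → D →L[ℝ] D) := by
      refine Filter.Eventually.and (hs.mem_nhds hz₀) ?_
      have hc : ContinuousAt (fderiv ℝ Ψ) z₀ :=
        ((hΨs z₀ hz₀).fderiv_right (m := 0) (by simp)).continuousAt
      refine hc.eventually ?_
      rw [hΨd.fderiv]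
      exact ContinuousLinearEquiv.nhds (ContinuousLinearEquiv.refl ℝ D)
    have h2 : ContinuousAt Φ.symm (Ψ z₀) := Φ.continuousAt_symm (Φ.map_source hz₀Φ)
    have h3 : Φ.symm (Ψ z₀) = z₀ := Φ.left_inv hz₀Φ
    have h4 : ∀ᶠ w in 𝓝 (Ψ z₀), Φ.symm w ∈ s ∧
        fderiv ℝ Ψ (Φ.symm w) ∈ Set.range ((↑) : (D ≃L[ℝ] D) → D →L[ℝ] D) :=
      h2.eventually (by rw [h3]; exact h1)
    filter_upwards [h4, Φ.open_target.mem_nhds (Φ.map_source hz₀Φ)] with w hw hwt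
    obtain ⟨hws, e, he⟩ := hw
    refine ⟨hwt, hws, Φ.contDiffAt_symm hwt (f₀' := e) ?_ (hΨs _ hws)⟩
    rw [he]
    exact ((hΨs _ hws).differentiableAt (by simp)).hasFDerivAt
  obtain ⟨r, hr, hball⟩ := Metric.eventually_nhds_iff_ball.1 hnear
  -- Hadamard's lemma needs a function on the whole space, so `b ∘ Ψ⁻¹` is cut off
  let χ : ContDiffBump (Ψ z₀) := ⟨r / 3, r / 2, by positivity, by linarith⟩
  have hsmooth : ContDiff ℝ ∞ (fun w => χ w * b (Φ.symm w)) := by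
    rw [contDiff_iff_contDiffAt]
    intro w
    by_cases hw : w ∈ Metric.ball (Ψ z₀) r
    · exact χ.contDiffAt.mul ((hba _ (hball w hw).2.1).comp w (hball w hw).2.2)
    · have : w ∉ tsupport χ := by
        rw [χ.tsupport_eq]
        intro hw'
        refine hw (Metric.closedBall_subset_ball ?_ hw')
        change r / 2 < r
        linarith
      refine contDiffAt_const (c := (0 : ℝ)) |>.congr_of_eventuallyEq ?_
      filter_upwards [notMem_tsupport_iff_eventuallyEq.1 this] with y hy
      simp [hy]
  obtain ⟨h, hh, hbh⟩ := exists_contDiff_eq_mul_of_linear hsmooth hv (fun w hw => by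
    by_cases hw' : w ∈ Metric.ball (Ψ z₀) r
    · have : b (Φ.symm w) = 0 := by
        refine h0 _ (hball w hw').2.1 ?_
        rw [← hℓΨ, ← hΦc, Φ.right_inv (hball w hw').1, hw]
      simp [this]
    · have : χ w = 0 := by
        by_contra hc
        have h1 : w ∈ Function.support χ := hc
        rw [χ.support_eq] at h1
        refine hw' (Metric.ball_subset_ball ?_ h1)
        change r / 2 ≤ r
        linarith
      simp [this])
  refine ⟨h ∘ Ψ, hh.contDiffAt.comp z₀ (hΨs z₀ hz₀), ?_⟩
  filter_upwards [(hΨs z₀ hz₀).continuousAt.eventually χ.eventuallyEq_one,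
    Φ.open_source.mem_nhds hz₀Φ] with z hz hzs
  have h1 := hbh (Ψ z)
  rw [hz, hℓΨ, ← hΦc, Φ.left_inv hzs] at h1
  simpa [hΦc] using h1

end Division

/-! ### Locally constant functions off a set of codimension two -/

section LocallyConstant

theorem IsPreconnected.eq_of_eventually_eq {X Y : Type*} [TopologicalSpace X] {S : Set X}
    (hS : IsPreconnected S) {f : X → Y} (hf : ∀ y ∈ S, ∀ᶠ z in 𝓝 y, f z = f y) {p q : X}
    (hp : p ∈ S) (hq : q ∈ S) : f q = f p := by
  by_contra hne
  rw [isPreconnected_iff_subset_of_disjoint] at hS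
  have hu : IsOpen {z | ∀ᶠ w in 𝓝 z, f w = f p} :=
    isOpen_iff_eventually.2 fun z hz => eventually_eventually_nhds.2 hz
  have hv : IsOpen {z | ∀ᶠ w in 𝓝 z, f w ≠ f p} :=
    isOpen_iff_eventually.2 fun z hz => eventually_eventually_nhds.2 hz
  have hsub : S ⊆ {z | ∀ᶠ w in 𝓝 z, f w = f p} ∪ {z | ∀ᶠ w in 𝓝 z, f w ≠ f p} := by
    intro y hy
    by_cases h : f y = f p
    · left; filter_upwards [hf y hy] with z hz using hz.trans h
    · right; filter_upwards [hf y hy] with z hz using hz ▸ h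
  have hdisj : S ∩ ({z | ∀ᶠ w in 𝓝 z, f w = f p} ∩ {z | ∀ᶠ w in 𝓝 z, f w ≠ f p}) = ∅ := by
    ext z
    simp only [Set.mem_inter_iff, Set.mem_ofPred_eq, Set.mem_empty_iff_false, iff_false]
    rintro ⟨-, h1, h2⟩
    exact h2.self_of_nhds h1.self_of_nhds
  rcases hS _ _ hu hv hsub hdisj with h | h
  · exact hne (h hq).self_of_nhds
  · exact (h hp).self_of_nhds rfl

/-- A function that is constant on `U` near every point is constant on the dense set `U`. -/
theorem exists_eq_of_dense {X Y : Type*} [TopologicalSpace X] [PreconnectedSpace X] [Nonempty X]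
    {U : Set X} (hU : Dense U) {f : X → Y} (hf : ∀ x, ∃ k, ∀ᶠ y in 𝓝 x, y ∈ U → f y = k) :
    ∃ k, ∀ y ∈ U, f y = k := by
  choose k hk using hf
  have hloc : ∀ y ∈ (Set.univ : Set X), ∀ᶠ z in 𝓝 y, k z = k y := by
    intro y _
    filter_upwards [eventually_eventually_nhds.2 (hk y)] with z hz
    obtain ⟨w, hw, hwU⟩ := mem_closure_iff_frequently.1 (hU z) |>.and_eventually (hz.and (hk z))
      |>.exists
    rw [← hwU.1 hw, ← hwU.2 hw]
  obtain ⟨x⟩ := ‹Nonempty X›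
  refine ⟨k x, fun y hy => ?_⟩
  rw [(hk y).self_of_nhds hy]
  exact IsPreconnected.eq_of_eventually_eq isPreconnected_univ hloc trivial trivial

variable {D : Type*} [NormedAddCommGroup D] [NormedSpace ℝ D] [FiniteDimensional ℝ D]

/-- A locally constant function on the complement of a subset of `{a = b = 0}`, where `a`, `b` have
linearly independent differentials at `z₀`, is constant near `z₀`: after straightening `a` and `b`,
the four half-balls `a > 0`, `a < 0`, `b > 0`, `b < 0` overlap in a cycle. -/
theorem exists_eventually_eq_of_codim_two {a b : D → ℝ} {z₀ : D} (ha : ContDiffAt ℝ 1 a z₀)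
    (hb : ContDiffAt ℝ 1 b z₀) (ha0 : a z₀ = 0) (hb0 : b z₀ = 0) {v w : D}
    (hav : fderiv ℝ a z₀ v = 1) (haw : fderiv ℝ a z₀ w = 0) (hbv : fderiv ℝ b z₀ v = 0)
    (hbw : fderiv ℝ b z₀ w = 1) {Y : Type*} {f : D → Y} {U : Set D}
    (hU : ∀ᶠ z in 𝓝 z₀, z ∉ U → a z = 0 ∧ b z = 0)
    (hf : ∀ z ∈ U, ∀ᶠ y in 𝓝 z, f y = f z) :
    ∃ k, ∀ᶠ z in 𝓝 z₀, z ∈ U → f z = k := by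
  set ℓ := fderiv ℝ a z₀ with hℓ
  set m := fderiv ℝ b z₀ with hm
  -- a local diffeomorphism carrying `a` and `b` to the linear functions `ℓ` and `m`
  set Ψ : D → D := fun z => z + ((a z - ℓ z) • v + (b z - m z) • w) with hΨ
  have hℓΨ : ∀ z, ℓ (Ψ z) = a z := fun z => by simp [hΨ, hav, haw]
  have hmΨ : ∀ z, m (Ψ z) = b z := fun z => by simp [hΨ, hbv, hbw]
  have hΨs : ContDiffAt ℝ 1 Ψ z₀ :=
    contDiffAt_id.add (((ha.sub ℓ.contDiff.contDiffAt).smul contDiffAt_const).add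
      ((hb.sub m.contDiff.contDiffAt).smul contDiffAt_const))
  have hΨd : HasFDerivAt Ψ ((ContinuousLinearEquiv.refl ℝ D : D ≃L[ℝ] D) : D →L[ℝ] D) z₀ := by
    have h1 := ((ha.differentiableAt (by simp)).hasFDerivAt.sub
      (ℓ.hasFDerivAt (x := z₀))).smul_const v
    have h1' := ((hb.differentiableAt (by simp)).hasFDerivAt.sub
      (m.hasFDerivAt (x := z₀))).smul_const w
    have h2 := (hasFDerivAt_id z₀).add (h1.add h1')
    refine h2.congr_fderiv ?_
    ext w
    simp [← hℓ, ← hm]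
  set Φ := hΨs.toOpenPartialHomeomorph Ψ hΨd (by simp) with hΦ
  have hΦc : (Φ : D → D) = Ψ := rfl
  have hz₀Φ : z₀ ∈ Φ.source := hΨs.mem_toOpenPartialHomeomorph_source hΨd (by simp)
  have hnear : ∀ᶠ q in 𝓝 (Ψ z₀), q ∈ Φ.target ∧
      (Φ.symm q ∉ U → a (Φ.symm q) = 0 ∧ b (Φ.symm q) = 0) := by
    have h2 : ContinuousAt Φ.symm (Ψ z₀) := Φ.continuousAt_symm (Φ.map_source hz₀Φ)
    have h3 : Φ.symm (Ψ z₀) = z₀ := Φ.left_inv hz₀Φ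
    exact Filter.Eventually.and (Φ.open_target.mem_nhds (Φ.map_source hz₀Φ))
      (h2.eventually (by rw [h3]; exact hU))
  obtain ⟨r, hr, hball⟩ := Metric.eventually_nhds_iff_ball.1 hnear
  have haΦ : ∀ q ∈ Metric.ball (Ψ z₀) r, a (Φ.symm q) = ℓ q := fun q hq => by
    rw [← hℓΨ, ← hΦc, Φ.right_inv (hball q hq).1]
  have hbΦ : ∀ q ∈ Metric.ball (Ψ z₀) r, b (Φ.symm q) = m q := fun q hq => by
    rw [← hmΨ, ← hΦc, Φ.right_inv (hball q hq).1]
  -- half-balls are convex, so `f` is constant on each half-ball contained in `U`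
  have hconst : ∀ ν : D →L[ℝ] ℝ, (∀ q ∈ Metric.ball (Ψ z₀) r, 0 < ν q → Φ.symm q ∈ U) →
      ∀ p ∈ Metric.ball (Ψ z₀) r, ∀ q ∈ Metric.ball (Ψ z₀) r, 0 < ν p → 0 < ν q →
        f (Φ.symm q) = f (Φ.symm p) := by
    intro ν hν p hp q hq hp0 hq0
    have hconv : Convex ℝ (Metric.ball (Ψ z₀) r ∩ {q | 0 < ν q}) :=
      (convex_ball _ _).inter (convex_halfSpace_gt ν.toLinearMap.isLinear 0)
    refine IsPreconnected.eq_of_eventually_eq hconv.isPreconnected (f := f ∘ Φ.symm) ?_ ⟨hp, hp0⟩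
      ⟨hq, hq0⟩
    rintro y ⟨hy, hy0⟩
    exact (Φ.continuousAt_symm (hball y hy).1).eventually (hf _ (hν y hy hy0))
  have hUa : ∀ q ∈ Metric.ball (Ψ z₀) r, ℓ q ≠ 0 → Φ.symm q ∈ U := fun q hq h => by
    by_contra hc
    exact h (haΦ q hq ▸ ((hball q hq).2 hc).1)
  have hUb : ∀ q ∈ Metric.ball (Ψ z₀) r, m q ≠ 0 → Φ.symm q ∈ U := fun q hq h => by
    by_contra hc
    exact h (hbΦ q hq ▸ ((hball q hq).2 hc).2)
  -- the points `ε (± v ± w)` lie in the intersections of consecutive half-balls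
  obtain ⟨ε, hε, hεb⟩ : ∃ ε : ℝ, 0 < ε ∧ ∀ s t : ℝ, |s| ≤ 1 → |t| ≤ 1 →
      Ψ z₀ + ε • (s • v + t • w) ∈ Metric.ball (Ψ z₀) r := by
    refine ⟨r / (2 * (‖v‖ + ‖w‖ + 1)), by positivity, fun s t hs ht => ?_⟩
    rw [mem_ball_iff_norm, add_sub_cancel_left, norm_smul]
    have h1 : ‖s • v + t • w‖ ≤ ‖v‖ + ‖w‖ := by
      refine (norm_add_le _ _).trans ?_
      rw [norm_smul, norm_smul, Real.norm_eq_abs, Real.norm_eq_abs]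
      have := norm_nonneg v
      have := norm_nonneg w
      nlinarith
    have h2 : ‖r / (2 * (‖v‖ + ‖w‖ + 1))‖ = r / (2 * (‖v‖ + ‖w‖ + 1)) := by
      rw [Real.norm_eq_abs, abs_of_pos (by positivity)]
    rw [h2, div_mul_eq_mul_div, div_lt_iff₀ (by positivity)]
    have := norm_nonneg v
    have := norm_nonneg w
    nlinarith
  have hℓp : ∀ s t : ℝ, ℓ (Ψ z₀ + ε • (s • v + t • w)) = ε * s := fun s t => by
    simp [hℓΨ, ha0, hav, haw]
  have hmp : ∀ s t : ℝ, m (Ψ z₀ + ε • (s • v + t • w)) = ε * t := fun s t => by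
    simp [hmΨ, hb0, hbv, hbw]
  set k := f (Φ.symm (Ψ z₀ + ε • ((1 : ℝ) • v + (1 : ℝ) • w))) with hk
  have hB := hεb 1 1 (by simp) (by simp)
  have hB1 := hεb (-1) 1 (by simp) (by simp)
  have hB2 := hεb 1 (-1) (by simp) (by simp)
  have hℓpos : ∀ q ∈ Metric.ball (Ψ z₀) r, 0 < ℓ q → f (Φ.symm q) = k := fun q hq h =>
    hconst ℓ (fun q hq h => hUa q hq h.ne') _ hB q hq (by rw [hℓp]; linarith) h
  have hmpos : ∀ q ∈ Metric.ball (Ψ z₀) r, 0 < m q → f (Φ.symm q) = k := fun q hq h =>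
    hconst m (fun q hq h => hUb q hq h.ne') _ hB q hq (by rw [hmp]; linarith) h
  have hℓneg : ∀ q ∈ Metric.ball (Ψ z₀) r, ℓ q < 0 → f (Φ.symm q) = k := fun q hq h => by
    rw [← hmpos _ hB1 (by rw [hmp]; linarith)]
    refine hconst (-ℓ) (fun q hq h => hUa q hq ?_) _ hB1 q hq ?_ ?_
    · intro h0; simp [h0] at h
    · rw [neg_apply, hℓp]; linarith
    · rw [neg_apply]; linarith
  have hmneg : ∀ q ∈ Metric.ball (Ψ z₀) r, m q < 0 → f (Φ.symm q) = k := fun q hq h => by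
    rw [← hℓpos _ hB2 (by rw [hℓp]; linarith)]
    refine hconst (-m) (fun q hq h => hUb q hq ?_) _ hB2 q hq ?_ ?_
    · intro h0; simp [h0] at h
    · rw [neg_apply, hmp]; linarith
    · rw [neg_apply]; linarith
  have hall : ∀ q ∈ Metric.ball (Ψ z₀) r, ℓ q ≠ 0 → f (Φ.symm q) = k := fun q hq h =>
    h.lt_or_gt.elim (hℓneg q hq) (hℓpos q hq)
  refine ⟨k, ?_⟩
  filter_upwards [hΨs.continuousAt.eventually (Metric.ball_mem_nhds _ hr),
    Φ.open_source.mem_nhds hz₀Φ] with z hz hzs hzU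
  have hzΦ : Φ.symm (Ψ z) = z := Φ.left_inv hzs
  -- a point of `U` with `a = 0` is a limit of points with `a > 0`, and `f` is constant near it
  have h1 : ∀ᶠ q in 𝓝 (Ψ z), f (Φ.symm q) = f z ∧ q ∈ Metric.ball (Ψ z₀) r := by
    refine Filter.Eventually.and ?_ (Metric.isOpen_ball.mem_nhds hz)
    have := hf z hzU
    rw [← hzΦ] at this
    have h2 := (Φ.continuousAt_symm (hball _ hz).1).eventually this
    filter_upwards [h2] with q hq
    rw [hq, hzΦ]
  rcases eq_or_ne (ℓ (Ψ z)) 0 with h0 | h0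
  · have ht : Filter.Tendsto (fun t : ℝ => Ψ z + t • v) (𝓝[>] 0) (𝓝 (Ψ z)) := by
      have : Continuous fun t : ℝ => Ψ z + t • v := by fun_prop
      have h3 := this.tendsto 0
      simp only [zero_smul, add_zero] at h3
      exact h3.mono_left nhdsWithin_le_nhds
    obtain ⟨t, ⟨ht1, ht2⟩, ht0⟩ := ((ht.eventually h1).and self_mem_nhdsWithin).exists
    rw [← ht1]
    refine hall _ ht2 ?_
    rw [map_add, h0, map_smul, hav]
    simpa using (ne_of_gt ht0)
  · have := hall _ hz h0
    rwa [hzΦ] at this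

end LocallyConstant

/-! ### Local arguments in charts -/

section Charts

set_option linter.unusedSectionVars false

variable {E : Type*} [NormedAddCommGroup E] [NormedSpace ℝ E] [FiniteDimensional ℝ E]
  {M : Type*} [TopologicalSpace M] [ChartedSpace E M] [IsManifold 𝓘(ℝ, E) ∞ M]

theorem contDiffOn_comp_extChartAt_symm {a : M → ℝ}
    (ha : ContMDiff 𝓘(ℝ, E) 𝓘(ℝ, ℝ) ∞ a) (x : M) :
    ContDiffOn ℝ ∞ (a ∘ (extChartAt 𝓘(ℝ, E) x).symm) (extChartAt 𝓘(ℝ, E) x).target := by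
  rw [← contMDiffOn_iff_contDiffOn]
  exact ha.comp_contMDiffOn (contMDiffOn_extChartAt_symm x)

/-- The derivative in a chart. -/
theorem hasFDerivAt_comp_extChartAt_symm {F : Type*} [NormedAddCommGroup F] [NormedSpace ℝ F]
    {u : M → F} {x : M} {z : E}
    (hz : z ∈ (extChartAt 𝓘(ℝ, E) x).target) (hu : MDiffAt u ((extChartAt 𝓘(ℝ, E) x).symm z)) :
    HasFDerivAt (u ∘ (extChartAt 𝓘(ℝ, E) x).symm)
      ((mvfderiv 𝓘(ℝ, E) u ((extChartAt 𝓘(ℝ, E) x).symm z)).comp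
        ((trivializationAt E (TangentSpace 𝓘(ℝ, E)) x).symmL ℝ
          ((extChartAt 𝓘(ℝ, E) x).symm z))) z := by
  have hd : MDiffAt (extChartAt 𝓘(ℝ, E) x).symm z :=
    ((contMDiffOn_extChartAt_symm (n := ∞) x).contMDiffAt
      ((isOpen_extChartAt_target x).mem_nhds hz)).mdifferentiableAt (by simp)
  have h1 := (hu.hasMFDerivAt.comp z hd.hasMFDerivAt).hasFDerivAt
  refine h1.congr_fderiv ?_
  have hs : (extChartAt 𝓘(ℝ, E) x).symm z ∈ (chartAt E x).source := by
    rw [← extChartAt_source 𝓘(ℝ, E)]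
    exact (extChartAt 𝓘(ℝ, E) x).map_target hz
  have h2 := TangentBundle.symmL_trivializationAt (I := 𝓘(ℝ, E)) hs
  rw [(extChartAt 𝓘(ℝ, E) x).right_inv hz, modelWithCornersSelf_coe, Set.range_id,
    mfderivWithin_univ] at h2
  rw [h2]
  rfl

/-- Grönwall: near a zero `x` of `u`, a bound on the derivatives of `u` along the coordinate fields
by `u` itself forces `u = 0`. -/
theorem eventually_eq_zero_of_norm_mvfderiv_le {F : Type*} [NormedAddCommGroup F] [NormedSpace ℝ F]
    {u : M → F} {x : M} (hu : ∀ᶠ y in 𝓝 x, MDiffAt u y) {ι : Type*} [Fintype ι]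
    (b : Module.Basis ι ℝ E) {K : ℝ}
    (h : ∀ᶠ y in 𝓝 x, ∀ i, ‖mvfderiv 𝓘(ℝ, E) u y
      ((trivializationAt E (fun x : M => TangentSpace 𝓘(ℝ, E) x) x).symm y (b i))‖ ≤ K * ‖u y‖)
    (hx : u x = 0) : ∀ᶠ y in 𝓝 x, u y = 0 := by
  set φ := extChartAt 𝓘(ℝ, E) x with hφ
  set e := trivializationAt E (fun x : M => TangentSpace 𝓘(ℝ, E) x) x with he
  have hxφ : φ.symm (φ x) = x := extChartAt_to_inv x
  have hev : ∀ᶠ z in 𝓝 (φ x), z ∈ φ.target ∧ φ.symm z ∈ e.baseSet ∧ MDiffAt u (φ.symm z) ∧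
      ∀ i, ‖mvfderiv 𝓘(ℝ, E) u (φ.symm z) (e.symm (φ.symm z) (b i))‖ ≤ K * ‖u (φ.symm z)‖ := by
    have hc : ContinuousAt φ.symm (φ x) := continuousAt_extChartAt_symm x
    have hx' : ∀ᶠ y in 𝓝 (φ.symm (φ x)), y ∈ e.baseSet ∧ MDifferentiableAt 𝓘(ℝ, E) 𝓘(ℝ, F) u y ∧
        ∀ i, ‖mvfderiv 𝓘(ℝ, E) u y (e.symm y (b i))‖ ≤ K * ‖u y‖ := by
      rw [hxφ]
      exact Filter.Eventually.and (e.open_baseSet.mem_nhds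
        (FiberBundle.mem_baseSet_trivializationAt' x)) (hu.and h)
    exact Filter.Eventually.and ((isOpen_extChartAt_target x).mem_nhds (mem_extChartAt_target x))
      (hc.eventually hx')
  obtain ⟨r, hr, hball⟩ := Metric.eventually_nhds_iff_ball.1 hev
  filter_upwards [(continuousAt_extChartAt (I := 𝓘(ℝ, E)) x).eventually (Metric.ball_mem_nhds _ hr),
    extChartAt_source_mem_nhds (I := 𝓘(ℝ, E)) x] with y hy hys
  set w := φ y - φ x with hw
  have hseg : ∀ s ∈ Set.Icc (0 : ℝ) 1, φ x + s • w ∈ Metric.ball (φ x) r := by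
    intro s hs
    refine (convex_ball _ _).segment_subset (Metric.mem_ball_self hr) hy ?_
    rw [segment_eq_image']
    exact ⟨s, hs, rfl⟩
  have hder : ∀ s ∈ Set.Icc (0 : ℝ) 1, HasDerivAt (fun s : ℝ => u (φ.symm (φ x + s • w)))
      (mvfderiv 𝓘(ℝ, E) u (φ.symm (φ x + s • w)) (e.symmL ℝ (φ.symm (φ x + s • w)) w)) s := by
    intro s hs
    have hz := hball _ (hseg s hs)
    have h1 := hasFDerivAt_comp_extChartAt_symm hz.1 hz.2.2.1
    have h2 : HasDerivAt (fun s : ℝ => φ x + s • w) w s := by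
      simpa using ((hasDerivAt_id s).smul_const w).const_add (φ x)
    exact h1.comp_hasDerivAt s h2
  have h0 := eq_zero_of_abs_deriv_le_mul_abs_self_of_eq_zero_right
    (f := fun s : ℝ => u (φ.symm (φ x + s • w))) (K := (∑ i, |b.repr w i|) * K)
    (fun s hs => (hder s hs).continuousAt.continuousWithinAt)
    (fun s hs => (hder s (Set.Ico_subset_Icc_self hs)).hasDerivWithinAt) (by simp [hxφ, hx])
    (fun s hs => by
      have hz := hball _ (hseg s (Set.Ico_subset_Icc_self hs))
      have e1 : e.symmL ℝ (φ.symm (φ x + s • w)) w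
          = ∑ i, b.repr w i • e.symm (φ.symm (φ x + s • w)) (b i) := by
        refine (congrArg (e.symmL ℝ (φ.symm (φ x + s • w))) (b.sum_repr w).symm).trans ?_
        rw [map_sum]
        refine Finset.sum_congr rfl fun i _ => ?_
        rw [map_smul, Trivialization.symmL_apply _ hz.2.1]
      rw [e1, map_sum, mul_assoc, Finset.sum_mul]
      refine (norm_sum_le _ _).trans (Finset.sum_le_sum fun i _ => ?_)
      rw [map_smul, norm_smul, Real.norm_eq_abs]
      exact mul_le_mul_of_nonneg_left (hz.2.2.2 i) (abs_nonneg _)) 1 (by simp)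
  simp only [one_smul, hw, add_sub_cancel] at h0
  rwa [φ.left_inv hys] at h0

/-- A function with vanishing differential near `x` is constant near `x`. -/
theorem eventually_eq_of_mvfderiv_eq_zero {f : M → ℝ} {x : M} (hf : ∀ᶠ y in 𝓝 x, MDiffAt f y)
    (h : ∀ᶠ y in 𝓝 x, mvfderiv 𝓘(ℝ, E) f y = 0) : ∀ᶠ y in 𝓝 x, f y = f x := by
  have := eventually_eq_zero_of_norm_mvfderiv_le (u := f - fun _ => f x) (x := x) (K := 0)
    (hf.mono fun y hy => hy.sub mdifferentiableAt_const) (Module.finBasis ℝ E)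
    (by
      filter_upwards [hf, h] with y hy1 hy2 i
      rw [mvfderiv_sub hy1 mdifferentiableAt_const, mvfderiv_const, hy2]
      simp) (by simp)
  filter_upwards [this] with y hy
  exact sub_eq_zero.1 hy

/-- `exists_contDiffAt_eq_mul` on a manifold. -/
theorem exists_contMDiffAt_eq_mul {a b : M → ℝ} {x : M} (ha : ContMDiff 𝓘(ℝ, E) 𝓘(ℝ, ℝ) ∞ a)
    (hb : ContMDiff 𝓘(ℝ, E) 𝓘(ℝ, ℝ) ∞ b) {v : TangentSpace 𝓘(ℝ, E) x}
    (hda : mvfderiv 𝓘(ℝ, E) a x v ≠ 0) (h0 : ∀ᶠ y in 𝓝 x, a y = 0 → b y = 0) :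
    ∃ h : M → ℝ, ContMDiffAt 𝓘(ℝ, E) 𝓘(ℝ, ℝ) ∞ h x ∧ ∀ᶠ y in 𝓝 x, b y = a y * h y := by
  set φ := extChartAt 𝓘(ℝ, E) x with hφ
  have hxφ : φ.symm (φ x) = x := extChartAt_to_inv x
  obtain ⟨V, hV, hVo, hxV⟩ := eventually_nhds_iff.1 h0
  set s := φ.target ∩ φ.symm ⁻¹' V with hs
  have hso : IsOpen s := (continuousOn_extChartAt_symm x).isOpen_inter_preimage
    (isOpen_extChartAt_target x) hVo
  have hda' : fderiv ℝ (a ∘ φ.symm) (φ x) ≠ 0 := by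
    intro hc
    have h1 := hasFDerivAt_comp_extChartAt_symm (u := a) (x := x) (mem_extChartAt_target x)
      ((ha _).mdifferentiableAt (by simp))
    have h2 := h1.fderiv
    rw [hc, hxφ] at h2
    have h3 := congrArg (fun L : E →L[ℝ] ℝ => L
      ((trivializationAt E (TangentSpace 𝓘(ℝ, E)) x).continuousLinearMapAt ℝ x v)) h2
    simp only [ContinuousLinearMap.comp_apply] at h3
    rw [Trivialization.symmL_continuousLinearMapAt _
      (FiberBundle.mem_baseSet_trivializationAt' x)] at h3
    exact hda h3.symm
  obtain ⟨h, hh, hbh⟩ := exists_contDiffAt_eq_mul hso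
    (z₀ := φ x) ⟨mem_extChartAt_target x, by simpa [hxφ] using hxV⟩
    ((contDiffOn_comp_extChartAt_symm ha x).mono Set.inter_subset_left)
    ((contDiffOn_comp_extChartAt_symm hb x).mono Set.inter_subset_left) hda'
    (fun z hz => hV _ hz.2)
  refine ⟨h ∘ φ, ContMDiffAt.comp x hh.contMDiffAt contMDiffAt_extChartAt, ?_⟩
  filter_upwards [(continuousAt_extChartAt x).eventually hbh,
    extChartAt_source_mem_nhds (I := 𝓘(ℝ, E)) x] with y hy hys
  have h1 : φ.symm (φ y) = y := φ.left_inv hys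
  rwa [Function.comp_apply, Function.comp_apply, h1] at hy

/-- `exists_eventually_eq_of_codim_two` on a manifold. -/
theorem exists_eventually_eq_of_codim_two_mfd {a b : M → ℝ} {x : M}
    (ha : ContMDiff 𝓘(ℝ, E) 𝓘(ℝ, ℝ) ∞ a) (hb : ContMDiff 𝓘(ℝ, E) 𝓘(ℝ, ℝ) ∞ b)
    (ha0 : a x = 0) (hb0 : b x = 0) {v w : TangentSpace 𝓘(ℝ, E) x}
    (hav : mvfderiv 𝓘(ℝ, E) a x v = 1) (haw : mvfderiv 𝓘(ℝ, E) a x w = 0)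
    (hbv : mvfderiv 𝓘(ℝ, E) b x v = 0) (hbw : mvfderiv 𝓘(ℝ, E) b x w = 1)
    {f : M → ℝ} {U : Set M} (hU : ∀ y, y ∉ U → a y = 0 ∧ b y = 0)
    (hf : ∀ z ∈ U, ∀ᶠ y in 𝓝 z, f y = f z) :
    ∃ k, ∀ᶠ z in 𝓝 x, z ∈ U → f z = k := by
  set φ := extChartAt 𝓘(ℝ, E) x with hφ
  have hxφ : φ.symm (φ x) = x := extChartAt_to_inv x
  have hxt : φ x ∈ φ.target := mem_extChartAt_target x
  set e := trivializationAt E (TangentSpace 𝓘(ℝ, E)) x with he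
  have hd : ∀ {a : M → ℝ}, ContMDiff 𝓘(ℝ, E) 𝓘(ℝ, ℝ) ∞ a → ∀ v : TangentSpace 𝓘(ℝ, E) x,
      fderiv ℝ (a ∘ φ.symm) (φ x) (e.continuousLinearMapAt ℝ x v) = mvfderiv 𝓘(ℝ, E) a x v := by
    intro a ha v
    have h1 := hasFDerivAt_comp_extChartAt_symm (u := a) (x := x) (mem_extChartAt_target x)
      ((ha _).mdifferentiableAt (by simp))
    rw [h1.fderiv, ← hφ, hxφ, ContinuousLinearMap.comp_apply,
      Trivialization.symmL_continuousLinearMapAt _ (FiberBundle.mem_baseSet_trivializationAt' x)]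
  have hs : ∀ {a : M → ℝ}, ContMDiff 𝓘(ℝ, E) 𝓘(ℝ, ℝ) ∞ a → ContDiffAt ℝ 1 (a ∘ φ.symm) (φ x) :=
    fun ha => ((contDiffOn_comp_extChartAt_symm ha x).contDiffAt
      ((isOpen_extChartAt_target x).mem_nhds hxt)).of_le (by norm_cast)
  obtain ⟨k, hk⟩ := exists_eventually_eq_of_codim_two (hs ha) (hs hb) (by simp [hxφ, ha0])
    (by simp [hxφ, hb0]) ((hd ha v).trans hav) ((hd ha w).trans haw) ((hd hb v).trans hbv)
    ((hd hb w).trans hbw) (f := f ∘ φ.symm) (U := φ.target ∩ φ.symm ⁻¹' U)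
    (by
      filter_upwards [(isOpen_extChartAt_target x).mem_nhds hxt] with z hz hzU
      exact hU _ fun hc => hzU ⟨hz, hc⟩)
    (fun z hz => (continuousAt_extChartAt_symm'' hz.1).eventually (hf _ hz.2))
  refine ⟨k, ?_⟩
  filter_upwards [(continuousAt_extChartAt x).eventually hk,
    extChartAt_source_mem_nhds (I := 𝓘(ℝ, E)) x] with y hy hys hyU
  have h1 : φ.symm (φ y) = y := φ.left_inv hys
  have := hy ⟨φ.map_source hys, by rw [Set.mem_preimage, h1]; exact hyU⟩
  rwa [Function.comp_apply, h1] at this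

/-- A function on a dense set that is locally the restriction of smooth functions extends
smoothly. -/
theorem contMDiff_extendFrom {U : Set M} (hU : Dense U) {f : M → ℝ}
    (hf : ∀ x, ∃ h : M → ℝ, ContMDiffAt 𝓘(ℝ, E) 𝓘(ℝ, ℝ) ∞ h x ∧ ∀ᶠ y in 𝓝 x, y ∈ U → f y = h y) :
    ContMDiff 𝓘(ℝ, E) 𝓘(ℝ, ℝ) ∞ (extendFrom U f) ∧ ∀ x ∈ U, extendFrom U f x = f x := by
  have key : ∀ x, ∀ h : M → ℝ, ContinuousAt h x → (∀ᶠ y in 𝓝 x, y ∈ U → f y = h y) →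
      extendFrom U f x = h x := by
    intro x h hc he
    refine extendFrom_eq (hU x) ?_
    refine (hc.tendsto.mono_left nhdsWithin_le_nhds).congr' ?_
    filter_upwards [nhdsWithin_le_nhds he, self_mem_nhdsWithin] with y hy hyU using (hy hyU).symm
  constructor
  · intro x
    obtain ⟨h, hh, he⟩ := hf x
    refine hh.congr_of_eventuallyEq ?_
    have h1 : ∀ᶠ y in 𝓝 x, ContMDiffAt 𝓘(ℝ, E) 𝓘(ℝ, ℝ) 1 h y :=
      (contMDiffAt_iff_contMDiffAt_nhds (by simp)).1 (hh.of_le (by norm_cast))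
    filter_upwards [h1, eventually_eventually_nhds.2 he] with y hy1 hy2
    exact key y h hy1.continuousAt hy2
  · intro x hx
    obtain ⟨h, hh, he⟩ := hf x
    rw [key x h hh.continuousAt he, he.self_of_nhds hx]

end Charts

/-! ### Traces, and linear first order systems -/

section UniqueContinuation

set_option linter.unusedSectionVars false

variable {E : Type*} [NormedAddCommGroup E] [NormedSpace ℝ E] [FiniteDimensional ℝ E]
  {M : Type*} [TopologicalSpace M] [ChartedSpace E M] [IsManifold 𝓘(ℝ, E) ∞ M] [T2Space M]

/-- The trace of a smooth endomorphism field is smooth. -/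
theorem IsSmoothEnd.trace {S : Π x : M, TangentSpace 𝓘(ℝ, E) x →L[ℝ] TangentSpace 𝓘(ℝ, E) x}
    (hS : IsSmoothEnd S) :
    ContMDiff 𝓘(ℝ, E) 𝓘(ℝ, ℝ) ∞
      (fun y => LinearMap.trace ℝ (TangentSpace 𝓘(ℝ, E) y) (S y).toLinearMap) := by
  intro x
  set e := trivializationAt E (fun x : M => TangentSpace 𝓘(ℝ, E) x) x with he
  have hxe : x ∈ e.baseSet := FiberBundle.mem_baseSet_trivializationAt' x
  let b := Module.finBasis ℝ E
  have h1 : ContMDiffAt 𝓘(ℝ, E) 𝓘(ℝ, ℝ) ∞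
      (fun y => ∑ i, e.localFrameCoeff 𝓘(ℝ, E) b i y (S y (e.localFrame b i y))) x := by
    refine ContMDiffAt.sum fun i _ => ?_
    refine contMDiffAt_localFrameCoeff b hxe ?_ i
    exact ContMDiffAt.clm_bundle_apply (b := fun y => y) (hS x)
      (contMDiffAt_localFrame_of_mem (I := 𝓘(ℝ, E)) ∞ e b i hxe)
  refine h1.congr_of_eventuallyEq ?_
  filter_upwards [e.open_baseSet.mem_nhds hxe] with y hy
  rw [LinearMap.trace_eq_matrix_trace ℝ (e.basisAt b hy), Matrix.trace]
  refine Finset.sum_congr rfl fun i _ => ?_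
  rw [e.localFrameCoeff_apply_of_mem_baseSet b hy (fun y => S y (e.localFrame b i y)),
    e.localFrame_apply_of_mem_baseSet b hy]
  simp [LinearMap.toMatrix_apply]

theorem mvfderiv_pi_apply {κ : Type*} [Fintype κ] {u : κ → M → ℝ} {y : M}
    (hu : ∀ k, ContMDiff 𝓘(ℝ, E) 𝓘(ℝ, ℝ) ∞ (u k)) (v : TangentSpace 𝓘(ℝ, E) y) (k : κ) :
    mvfderiv 𝓘(ℝ, E) (fun z k => u k z) y v k = mvfderiv 𝓘(ℝ, E) (u k) y v := by
  have h1 : MDifferentiableAt 𝓘(ℝ, E) 𝓘(ℝ, κ → ℝ) (fun z k => u k z) y :=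
    ((contMDiff_pi_space.2 hu) y).mdifferentiableAt (by simp)
  have h2 := ((ContinuousLinearMap.proj (R := ℝ) (φ := fun _ : κ => ℝ) k).hasMFDerivAt
    (x := fun k => u k y)).comp y h1.hasMFDerivAt
  have h3 := h2.mfderiv
  exact (congrArg (fun L : TangentSpace 𝓘(ℝ, E) y →L[ℝ] ℝ => L v) h3).symm

/-- Near `x`, the function `f` is a combination of the functions `u k` with coefficients
continuous at `x`. -/
def NearSpan {X κ : Type*} [TopologicalSpace X] [Fintype κ] (u : κ → X → ℝ) (x : X) (f : X → ℝ) :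
    Prop :=
  ∃ a : κ → X → ℝ, (∀ k, ContinuousAt (a k) x) ∧ ∀ᶠ y in 𝓝 x, f y = ∑ k, a k y * u k y

namespace NearSpan

variable {X κ : Type*} [TopologicalSpace X] [Fintype κ] {u : κ → X → ℝ} {x : X} {f g : X → ℝ}

theorem self [DecidableEq κ] (k : κ) : NearSpan u x (u k) :=
  ⟨fun l _ => if l = k then 1 else 0, fun _ => continuousAt_const, by simp⟩

theorem add (hf : NearSpan u x f) (hg : NearSpan u x g) : NearSpan u x (fun y => f y + g y) := by
  obtain ⟨a, ha, hfa⟩ := hf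
  obtain ⟨b, hb, hgb⟩ := hg
  refine ⟨fun k y => a k y + b k y, fun k => (ha k).add (hb k), ?_⟩
  filter_upwards [hfa, hgb] with y h1 h2
  rw [h1, h2, ← Finset.sum_add_distrib]
  exact Finset.sum_congr rfl fun k _ => by ring

theorem mul (hg : ContinuousAt g x) (hf : NearSpan u x f) : NearSpan u x (fun y => g y * f y) := by
  obtain ⟨a, ha, hfa⟩ := hf
  refine ⟨fun k y => g y * a k y, fun k => hg.mul (ha k), ?_⟩
  filter_upwards [hfa] with y h1
  rw [h1, Finset.mul_sum]
  exact Finset.sum_congr rfl fun k _ => by ring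

theorem congr (hf : NearSpan u x f) (h : ∀ᶠ y in 𝓝 x, g y = f y) : NearSpan u x g := by
  obtain ⟨a, ha, hfa⟩ := hf
  exact ⟨a, ha, by filter_upwards [h, hfa] with y h1 h2 using h1.trans h2⟩

theorem sum {ι : Type*} (s : Finset ι) {f : ι → X → ℝ} (hf : ∀ i, NearSpan u x (f i)) :
    NearSpan u x (fun y => ∑ i ∈ s, f i y) := by
  classical
  induction s using Finset.induction_on with
  | empty => exact ⟨fun _ _ => 0, fun _ => continuousAt_const, by simp⟩
  | insert i s hi ih => exact ((hf i).add ih).congr (by simp [Finset.sum_insert hi])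

end NearSpan

/-- A family of functions satisfying a linear homogeneous first order system vanishes near any of
its common zeros. -/
theorem eventually_eq_zero_of_nearSpan {κ ι : Type*} [Fintype κ] [Fintype ι] {u : κ → M → ℝ} {x : M}
    (b : Module.Basis ι ℝ E) (hu : ∀ k, ContMDiff 𝓘(ℝ, E) 𝓘(ℝ, ℝ) ∞ (u k))
    (h : ∀ i k, NearSpan u x (fun y => mvfderiv 𝓘(ℝ, E) (u k) y
      ((trivializationAt E (fun x : M => TangentSpace 𝓘(ℝ, E) x) x).symm y (b i))))
    (hx : ∀ k, u k x = 0) : ∀ᶠ y in 𝓝 x, ∀ k, u k y = 0 := by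
  choose a ha hua using h
  set C : ℝ := ∑ i, ∑ k, ∑ l, (|a i k l x| + 1) with hC
  have hC0 : ∀ i k l, 0 ≤ |a i k l x| + 1 := fun i k l => by positivity
  have hbd : ∀ᶠ y in 𝓝 x, ∀ i k l, |a i k l y| ≤ |a i k l x| + 1 := by
    simp only [Filter.eventually_all]
    intro i k l
    exact ((ha i k l).abs.eventually_lt continuousAt_const (lt_add_one _)).mono fun y hy => hy.le
  have := eventually_eq_zero_of_norm_mvfderiv_le (u := fun z k => u k z) (x := x)
    (.of_forall fun y => ((contMDiff_pi_space.2 hu) y).mdifferentiableAt (by simp)) b (K := C) (by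
      have hua' : ∀ᶠ y in 𝓝 x, ∀ i k, _ := Filter.eventually_all.2 fun i =>
        Filter.eventually_all.2 fun k => hua i k
      filter_upwards [hua', hbd] with y h1 h2 i
      have hCn : 0 ≤ C := Finset.sum_nonneg fun i _ => Finset.sum_nonneg fun k _ =>
        Finset.sum_nonneg fun l _ => hC0 i k l
      refine (pi_norm_le_iff_of_nonneg (by positivity)).2 fun k => ?_
      rw [mvfderiv_pi_apply hu, h1 i k]
      have h3 : ∑ l, (|a i k l x| + 1) ≤ C :=
        (Finset.single_le_sum (f := fun k => ∑ l, (|a i k l x| + 1))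
          (fun k _ => Finset.sum_nonneg fun l _ => hC0 i k l) (Finset.mem_univ k)).trans
        (Finset.single_le_sum (f := fun i => ∑ k, ∑ l, (|a i k l x| + 1))
          (fun i _ => Finset.sum_nonneg fun k _ => Finset.sum_nonneg fun l _ => hC0 i k l)
          (Finset.mem_univ i))
      refine le_trans ?_ (mul_le_mul_of_nonneg_right h3 (norm_nonneg _))
      rw [Finset.sum_mul]
      refine (norm_sum_le _ _).trans (Finset.sum_le_sum fun l _ => ?_)
      rw [norm_mul]
      exact mul_le_mul (h2 i k l) (norm_le_pi_norm (fun k => u k y) l) (norm_nonneg _) (hC0 i k l))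
    (funext hx)
  filter_upwards [this] with y hy k using congrFun hy k

/-- Near every point the coordinate fields agree with global smooth fields that form a frame, in which
smooth fields have smooth coefficients. -/
theorem exists_contMDiff_frame {ι : Type*} [Fintype ι] (b : Module.Basis ι ℝ E) (x : M) :
    ∃ F : ι → Π x : M, TangentSpace 𝓘(ℝ, E) x, (∀ i, IsSmoothField (F i)) ∧
      (∀ᶠ y in 𝓝 x, ∀ i, F i y
        = (trivializationAt E (fun x : M => TangentSpace 𝓘(ℝ, E) x) x).symm y (b i)) ∧
      (∀ᶠ y in 𝓝 x, ∀ v : TangentSpace 𝓘(ℝ, E) y, ∃ c : ι → ℝ, v = ∑ i, c i • F i y) ∧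
      ∀ Z : Π x : M, TangentSpace 𝓘(ℝ, E) x, IsSmoothField Z → ∃ c : ι → M → ℝ,
        (∀ i, ContMDiffAt 𝓘(ℝ, E) 𝓘(ℝ, ℝ) ∞ (c i) x) ∧ ∀ᶠ y in 𝓝 x, Z y = ∑ i, c i y • F i y := by
  choose F hF hFe using fun i => exists_contMDiff_eventuallyEq_symm x (b i)
  set e := trivializationAt E (fun x : M => TangentSpace 𝓘(ℝ, E) x) x with he
  have hxe : x ∈ e.baseSet := FiberBundle.mem_baseSet_trivializationAt' x
  have hFe' := Filter.eventually_all.2 hFe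
  have hb : ∀ᶠ y in 𝓝 x, ∃ hy : y ∈ e.baseSet, ∀ i, F i y = e.basisAt b hy i := by
    filter_upwards [hFe', e.open_baseSet.mem_nhds hxe] with y h1 h2
    refine ⟨h2, fun i => ?_⟩
    rw [h1 i]
    simp [Trivialization.basisAt]
  refine ⟨F, hF, hFe', ?_, fun Z hZ => ⟨fun i y => e.localFrameCoeff 𝓘(ℝ, E) b i y (Z y),
    fun i => ?_, ?_⟩⟩
  · filter_upwards [hb] with y ⟨hy, h⟩ v
    refine ⟨fun i => (e.basisAt b hy).repr v i, ?_⟩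
    simp only [h]
    exact ((e.basisAt b hy).sum_repr v).symm
  · exact contMDiffAt_localFrameCoeff b hxe (hZ x) i
  · filter_upwards [hb] with y ⟨hy, h⟩
    simp only [h, e.localFrameCoeff_apply_of_mem_baseSet b hy Z]
    exact ((e.basisAt b hy).sum_repr (Z y)).symm

end UniqueContinuation

/-! ### Unique continuation for Killing potentials -/

section KillingPotential

set_option linter.unusedSectionVars false

variable {E : Type*} [NormedAddCommGroup E] [NormedSpace ℝ E] [FiniteDimensional ℝ E]
  {M : Type*} [TopologicalSpace M] [ChartedSpace E M] [IsManifold 𝓘(ℝ, E) ∞ M] [T2Space M]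
  [RiemannianBundle (fun x : M => TangentSpace 𝓘(ℝ, E) x)]
  [IsContMDiffRiemannianBundle 𝓘(ℝ, E) ∞ E (fun x : M => TangentSpace 𝓘(ℝ, E) x)]
variable {X Y Z W : Π x : M, TangentSpace 𝓘(ℝ, E) x} {x : M} {τ : M → ℝ}
local notation "⟪" v ", " w "⟫" => inner ℝ v w
variable {J : Π x : M, TangentSpace 𝓘(ℝ, E) x →L[ℝ] TangentSpace 𝓘(ℝ, E) x}

theorem IsSmoothField.curvature (hX : IsSmoothField X) (hY : IsSmoothField Y)
    (hZ : IsSmoothField Z) : IsSmoothField (curvature X Y Z) :=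
  ((hX.nabla (hY.nabla hZ)).sub (hY.nabla (hX.nabla hZ))).sub ((hX.mlieBracket hY).nabla hZ)

theorem lieD_inner_hess (hτ : ContMDiff 𝓘(ℝ, E) 𝓘(ℝ, ℝ) ∞ τ) (hX : IsSmoothField X)
    (hY : IsSmoothField Y) (hZ : IsSmoothField Z) (x : M) :
    lieD X (fun y => ⟪hess τ y (Y y), Z y⟫) x
      = hessD τ X Y Z x + ⟪hess τ x (nabla X Y x), Z x⟫ + ⟪hess τ x (Y x), nabla X Z x⟫ := by
  rw [lieD_inner hX (hY.end_apply (isSmoothEnd_hess hτ)) hZ, hessD, covDerivEnd, ← inner_add_left]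
  congr 2
  exact (sub_add_cancel _ _).symm

theorem lieD_inner_grad (hτ : ContMDiff 𝓘(ℝ, E) 𝓘(ℝ, ℝ) ∞ τ) (hX : IsSmoothField X)
    (hY : IsSmoothField Y) (x : M) :
    lieD X (fun y => ⟪grad τ y, Y y⟫) x = ⟪hess τ x (X x), Y x⟫ + ⟪grad τ x, nabla X Y x⟫ :=
  lieD_inner hX (IsSmoothField.grad hτ) hY x

namespace IsKillingPotential

variable (h : IsKillingPotential J τ)
include h

/-- The pair `(∇τ, ∇∇τ)` satisfies a linear first order system (Kostant), so it vanishes near any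
of its zeros. -/
theorem eventually_grad_eq_zero {x : M} (hg : grad (E := E) τ x = 0) (hH : hess (E := E) τ x = 0) :
    ∀ᶠ y in 𝓝 x, grad (E := E) τ y = 0 ∧ hess (E := E) τ y = 0 := by
  classical
  let b := Module.finBasis ℝ E
  obtain ⟨F, hF, hFe, hspan, hcoef⟩ := exists_contMDiff_frame b x
  -- the components of `∇τ` and `∇∇τ` in a local frame
  let u : (Fin (Module.finrank ℝ E) ⊕ Fin (Module.finrank ℝ E) × Fin (Module.finrank ℝ E)) →
      M → ℝ := Sum.elim (fun j y => ⟪grad τ y, F j y⟫) (fun p y => ⟪hess τ y (F p.1 y), F p.2 y⟫)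
  have hgrad : ∀ {Z : Π x : M, TangentSpace 𝓘(ℝ, E) x}, IsSmoothField Z →
      NearSpan u x (fun y => ⟪grad τ y, Z y⟫) := by
    intro Z hZ
    obtain ⟨c, hc, hZc⟩ := hcoef Z hZ
    refine (NearSpan.sum Finset.univ fun i => NearSpan.mul (hc i).continuousAt
      (NearSpan.self (Sum.inl i))).congr ?_
    filter_upwards [hZc] with y hy
    rw [hy, inner_sum]
    simp only [real_inner_smul_right, u, Sum.elim_inl]
  have hhess : ∀ {Z W : Π x : M, TangentSpace 𝓘(ℝ, E) x}, IsSmoothField Z → IsSmoothField W →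
      NearSpan u x (fun y => ⟪hess τ y (Z y), W y⟫) := by
    intro Z W hZ hW
    obtain ⟨c, hc, hZc⟩ := hcoef Z hZ
    obtain ⟨d, hd, hWd⟩ := hcoef W hW
    refine (NearSpan.sum Finset.univ fun i => NearSpan.sum Finset.univ fun j =>
      NearSpan.mul (hd i).continuousAt (NearSpan.mul (hc j).continuousAt
      (NearSpan.self (Sum.inr (j, i))))).congr ?_
    filter_upwards [hZc, hWd] with y hy1 hy2
    rw [hy1, hy2, inner_sum]
    simp only [map_sum, map_smul, sum_inner, real_inner_smul_right, real_inner_smul_left, u,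
      Sum.elim_inr]
  have hu : ∀ k, ContMDiff 𝓘(ℝ, E) 𝓘(ℝ, ℝ) ∞ (u k) := by
    rintro (j | ⟨j, k⟩)
    · exact h.smooth_grad.inner (hF j)
    · exact ((hF j).end_apply (isSmoothEnd_hess h.smooth)).inner (hF k)
  have key := eventually_eq_zero_of_nearSpan b hu (x := x) (by
    rintro i (j | ⟨j, k⟩)
    · refine ((hhess (hF i) (hF j)).add (hgrad ((hF i).nabla (hF j)))).congr ?_
      filter_upwards [hFe] with y hy
      rw [← hy i]
      exact lieD_inner_grad h.smooth (hF i) (hF j) y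
    · have hJk := (hF k).end_apply h.kahler.smooth
      have hR := ((hF j).curvature hJk (hF i)).end_apply h.kahler.smooth
      refine (((NearSpan.mul (g := fun _ => -1) continuousAt_const (hgrad hR)).add
        (hhess ((hF i).nabla (hF j)) (hF k))).add (hhess (hF j) ((hF i).nabla (hF k)))).congr ?_
      filter_upwards [hFe] with y hy
      rw [← hy i]
      refine (lieD_inner_hess h.smooth (hF i) (hF j) (hF k) y).trans ?_
      rw [h.hessD_eq_riem (hF j) (hF k) (hF i),
        riem_swap_right (hF j) hJk (h.smooth_grad.end_apply h.kahler.smooth) (hF i), neg_neg,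
        riem, real_inner_comm, h.kahler.inner_J_left]
      ring) (by rintro (j | ⟨j, k⟩) <;> simp [u, hg, hH])
  filter_upwards [key, hspan] with y hy hsp
  constructor
  · refine ext_inner_right ℝ fun v => ?_
    obtain ⟨c, rfl⟩ := hsp v
    rw [inner_sum, inner_zero_left]
    refine Finset.sum_eq_zero fun i _ => ?_
    rw [real_inner_smul_right, show ⟪grad τ y, F i y⟫ = 0 from hy (Sum.inl i), mul_zero]
  · ext v
    refine ext_inner_right ℝ fun w => ?_
    obtain ⟨c, rfl⟩ := hsp v
    obtain ⟨d, rfl⟩ := hsp w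
    have : ∀ i j, ⟪hess τ y (F i y), F j y⟫ = 0 := fun i j => hy (Sum.inr (i, j))
    simp [map_sum, sum_inner, inner_sum, real_inner_smul_left, real_inner_smul_right, this]

/-- The common zeros of `∇τ` and `∇∇τ` form an open and closed set, empty for nonconstant `τ`. -/
theorem hess_ne_zero_of_grad_eq_zero [PreconnectedSpace M] (hne : ∃ p q : M, τ p ≠ τ q) {x : M}
    (hg : grad (E := E) τ x = 0) : hess (E := E) τ x ≠ 0 := by
  intro hH
  set A : Set M := {y | grad (E := E) τ y = 0 ∧ hess (E := E) τ y = 0} with hA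
  have hopen : IsOpen A := isOpen_iff_eventually.2 fun y hy => h.eventually_grad_eq_zero hy.1 hy.2
  have hclosed : IsClosed A := by
    have e : A = ⋂ X : {X : Π x : M, TangentSpace 𝓘(ℝ, E) x // IsSmoothField X},
        ⋂ Y : {X : Π x : M, TangentSpace 𝓘(ℝ, E) x // IsSmoothField X},
          {y | ⟪grad τ y, X.1 y⟫ = 0} ∩ {y | ⟪hess τ y (X.1 y), Y.1 y⟫ = 0} := by
      ext y
      simp only [hA, Set.mem_ofPred_eq, Set.mem_iInter, Set.mem_inter_iff]
      refine ⟨fun hy X Y => by simp [hy.1, hy.2], fun hy => ⟨?_, ?_⟩⟩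
      · refine ext_inner_right ℝ fun v => ?_
        obtain ⟨X, hX, rfl, -⟩ := exists_contMDiff_extend v
        simpa using (hy ⟨X, hX⟩ ⟨X, hX⟩).1
      · ext v
        refine ext_inner_right ℝ fun w => ?_
        obtain ⟨X, hX, rfl, -⟩ := exists_contMDiff_extend v
        obtain ⟨Y, hY, rfl, -⟩ := exists_contMDiff_extend w
        simpa using (hy ⟨X, hX⟩ ⟨Y, hY⟩).2
    rw [e]
    refine isClosed_iInter fun X => isClosed_iInter fun Y => IsClosed.inter ?_ ?_
    · exact isClosed_eq (h.smooth_grad.inner X.2).continuous continuous_const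
    · exact isClosed_eq ((X.2.end_apply (isSmoothEnd_hess h.smooth)).inner Y.2).continuous
        continuous_const
  have huniv : A = Set.univ := IsClopen.eq_univ ⟨hclosed, hopen⟩ ⟨x, hg, hH⟩
  obtain ⟨p, q, hpq⟩ := hne
  refine hpq (IsPreconnected.eq_of_eventually_eq isPreconnected_univ (f := τ) (fun y _ => ?_)
    (Set.mem_univ q) (Set.mem_univ p))
  refine eventually_eq_of_mvfderiv_eq_zero (.of_forall fun z => (h.smooth z).mdifferentiableAt
    (by simp)) (.of_forall fun z => ?_)
  ext v
  have : z ∈ A := huniv ▸ Set.mem_univ z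
  rw [← inner_grad, this.1]
  simp

/-- On an open set where `∇τ = 0`, the Hessian would vanish too. -/
theorem dense_mvfderiv_ne_zero [PreconnectedSpace M] (hne : ∃ p q : M, τ p ≠ τ q) :
    Dense {y : M | mvfderiv 𝓘(ℝ, E) τ y ≠ 0} := by
  intro x
  by_contra hx
  rw [mem_closure_iff_frequently, Filter.not_frequently] at hx
  have hz : ∀ᶠ y in 𝓝 x, grad (E := E) τ y = 0 := by
    filter_upwards [hx] with y hy
    have : mvfderiv 𝓘(ℝ, E) τ y = 0 := not_not.1 hy
    refine ext_inner_right ℝ fun v => ?_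
    rw [inner_grad, this]
    simp
  refine h.hess_ne_zero_of_grad_eq_zero hne hz.self_of_nhds ?_
  have h0 : SmoothFieldAt (fun y => (0 : ℝ) • grad (E := E) τ y) x :=
    SmoothFieldAt.smul contMDiffAt_const (h.smooth_grad x)
  have h1 := leviCivita_congr (Y' := grad (E := E) τ) h0 (by
    filter_upwards [hz] with y hy
    simp [hy])
  ext v
  obtain ⟨X, hX, rfl, -⟩ := exists_contMDiff_extend v
  have h2 := nabla_smul (X := X) (f := fun _ => (0 : ℝ)) contMDiff_const h.smooth_grad x
  refine (congrArg (fun L : TangentSpace 𝓘(ℝ, E) x →L[ℝ] TangentSpace 𝓘(ℝ, E) x => L (X x)) h1).trans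
    (h2.trans ?_)
  rw [hz.self_of_nhds]
  simp

end IsKillingPotential

end KillingPotential

/-! ### The eigenvalue functions of the Hessian -/

section Eigenvalues

set_option linter.unusedSectionVars false

variable {E : Type*} [NormedAddCommGroup E] [NormedSpace ℝ E] [FiniteDimensional ℝ E]
  {M : Type*} [TopologicalSpace M] [ChartedSpace E M] [IsManifold 𝓘(ℝ, E) ∞ M] [T2Space M]
  [RiemannianBundle (fun x : M => TangentSpace 𝓘(ℝ, E) x)]
  [IsContMDiffRiemannianBundle 𝓘(ℝ, E) ∞ E (fun x : M => TangentSpace 𝓘(ℝ, E) x)]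
variable {X Y Z W : Π x : M, TangentSpace 𝓘(ℝ, E) x} {x : M} {τ : M → ℝ}
local notation "⟪" v ", " w "⟫" => inner ℝ v w
variable {J : Π x : M, TangentSpace 𝓘(ℝ, E) x →L[ℝ] TangentSpace 𝓘(ℝ, E) x}

local notation "∇" => grad (E := E)
local notation "∇∇" => hess (E := E)

theorem grad_eq_zero_iff : ∇ τ x = 0 ↔ mvfderiv 𝓘(ℝ, E) τ x = 0 := by
  constructor
  · intro h
    ext v
    rw [← inner_grad, h]
    simp
  · intro h
    refine ext_inner_right ℝ fun v => ?_
    rw [inner_grad, h]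
    simp

theorem mem_horiz_iff {v : TangentSpace 𝓘(ℝ, E) x} :
    v ∈ horiz J τ x ↔ ⟪grad τ x, v⟫ = 0 ∧ ⟪J x (grad τ x), v⟫ = 0 := by
  rw [horiz, vert, Submodule.mem_orthogonal]
  constructor
  · intro h
    exact ⟨h _ (Submodule.subset_span (by simp)), h _ (Submodule.subset_span (by simp))⟩
  · rintro ⟨h1, h2⟩ u hu
    induction hu using Submodule.span_induction with
    | mem u hu => rcases hu with rfl | rfl <;> assumption
    | zero => simp
    | add u w _ _ hu hw => rw [inner_add_left, hu, hw, add_zero]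
    | smul a u _ hu => rw [real_inner_smul_left, hu, mul_zero]

theorem IsKahler.inner_J_self (hJ : IsKahler J) (x : M) (v : TangentSpace 𝓘(ℝ, E) x) :
    ⟪J x v, v⟫ = 0 := by
  have := hJ.inner_J_left x v v
  rw [real_inner_comm (J x v) v] at this
  linarith

/-- The field of bilinear forms `dτ ⊗ dτ + d^cτ ⊗ d^cτ`. -/
def gradSq (J : Π x : M, TangentSpace 𝓘(ℝ, E) x →L[ℝ] TangentSpace 𝓘(ℝ, E) x) (τ : M → ℝ) (x : M)
    (v w : TangentSpace 𝓘(ℝ, E) x) : ℝ :=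
  ⟪∇ τ x, v⟫ * ⟪∇ τ x, w⟫ + ⟪J x (∇ τ x), v⟫ * ⟪J x (∇ τ x), w⟫

namespace IsKillingPotential

variable (h : IsKillingPotential J τ)
include h

theorem inner_hess_J_grad (x : M) : ⟪∇∇ τ x (∇ τ x), J x (∇ τ x)⟫ = 0 := by
  have h1 := inner_hess_comm h.smooth x (∇ τ x) (J x (∇ τ x))
  rw [h.hess_J, ← real_inner_comm, real_inner_comm _ (∇ τ x), h.kahler.inner_J_left,
    real_inner_comm] at h1
  have h2 := h.kahler.inner_J_left x (∇∇ τ x (∇ τ x)) (∇ τ x)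
  have h3 := real_inner_comm (J x (∇ τ x)) (∇∇ τ x (∇ τ x))
  linarith

variable {Θ : M → ℝ} (hΘ : ∀ x : M, grad (E := E) τ x ≠ 0 →
    ∀ v ∈ horiz J τ x, hess τ x v = Θ x • v)
include hΘ

/-- `∇τ` is an eigenvector of the Hessian, since the Hessian preserves `𝓗` and commutes with `J`. -/
theorem hess_grad_eq (hx : ∇ τ x ≠ 0) :
    ∇∇ τ x (∇ τ x) = (⟪∇∇ τ x (∇ τ x), ∇ τ x⟫ / ⟪∇ τ x, ∇ τ x⟫) • ∇ τ x := by
  have hQ : ⟪∇ τ x, ∇ τ x⟫ ≠ 0 := inner_self_ne_zero.2 hx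
  set l := ⟪∇∇ τ x (∇ τ x), ∇ τ x⟫ / ⟪∇ τ x, ∇ τ x⟫ with hl
  set w := ∇∇ τ x (∇ τ x) - l • ∇ τ x with hw
  have h1 : ⟪∇ τ x, w⟫ = 0 := by
    rw [hw, inner_sub_right, real_inner_smul_right, hl, div_mul_cancel₀ _ hQ, real_inner_comm,
      sub_self]
  have h2 : ⟪J x (∇ τ x), w⟫ = 0 := by
    rw [hw, inner_sub_right, real_inner_smul_right, h.kahler.inner_J_self, real_inner_comm,
      h.inner_hess_J_grad]
    ring
  have h3 : ⟪w, w⟫ = 0 := by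
    have e : ⟪w, w⟫ = ⟪∇∇ τ x (∇ τ x), w⟫ - l * ⟪∇ τ x, w⟫ := by
      conv_lhs => rw [hw, inner_sub_left, real_inner_smul_left, ← hw]
    rw [e, h1, inner_hess_comm h.smooth, hΘ x hx w (mem_horiz_iff.2 ⟨h1, h2⟩),
      real_inner_smul_right, h1]
    ring
  exact sub_eq_zero.1 (inner_self_eq_zero.1 h3)

/-- The Hessian is `l` on `𝓥` and `Θ` on `𝓗`, in tensorial form. -/
theorem hess_apply_eq (hx : ∇ τ x ≠ 0) {l : ℝ} (hl : ∇∇ τ x (∇ τ x) = l • ∇ τ x)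
    (v : TangentSpace 𝓘(ℝ, E) x) :
    ∇∇ τ x v = Θ x • v + ((l - Θ x) / ⟪∇ τ x, ∇ τ x⟫) •
      (⟪∇ τ x, v⟫ • ∇ τ x + ⟪J x (∇ τ x), v⟫ • J x (∇ τ x)) := by
  have hQ : ⟪∇ τ x, ∇ τ x⟫ ≠ 0 := inner_self_ne_zero.2 hx
  set Q := ⟪∇ τ x, ∇ τ x⟫ with hQdef
  have hgJ : ⟪∇ τ x, J x (∇ τ x)⟫ = 0 := by
    rw [real_inner_comm]; exact h.kahler.inner_J_self x _
  have hw : v - ((⟪∇ τ x, v⟫ / Q) • ∇ τ x + (⟪J x (∇ τ x), v⟫ / Q) • J x (∇ τ x))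
      ∈ horiz J τ x := by
    rw [mem_horiz_iff]
    constructor
    · rw [inner_sub_right, inner_add_right, real_inner_smul_right, real_inner_smul_right, hgJ,
        ← hQdef]
      field_simp
      ring
    · rw [inner_sub_right, inner_add_right, real_inner_smul_right, real_inner_smul_right,
        h.kahler.inner_J_self, h.kahler.orthogonal, ← hQdef]
      field_simp
      ring
  have h1 := hΘ x hx _ hw
  rw [map_sub, map_add, map_smul, map_smul, h.hess_J, hl, map_smul] at h1
  rw [sub_eq_iff_eq_add.1 h1]
  module

theorem trace_hess (hx : ∇ τ x ≠ 0) {l : ℝ}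
    (hl : ∇∇ τ x (∇ τ x) = l • ∇ τ x) :
    LinearMap.trace ℝ (TangentSpace 𝓘(ℝ, E) x) (∇∇ τ x).toLinearMap
      = Module.finrank ℝ E * Θ x + 2 * (l - Θ x) := by
  have hQ : ⟪∇ τ x, ∇ τ x⟫ ≠ 0 := inner_self_ne_zero.2 hx
  have e : (∇∇ τ x).toLinearMap = Θ x • LinearMap.id + ((l - Θ x) / ⟪∇ τ x, ∇ τ x⟫) •
      ((innerₗ _ (∇ τ x)).smulRight (∇ τ x)
        + (innerₗ _ (J x (∇ τ x))).smulRight (J x (∇ τ x))) := by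
    ext v
    exact h.hess_apply_eq hΘ hx hl v
  rw [e, map_add, map_smul, map_smul, map_add, LinearMap.trace_id, LinearMap.trace_smulRight,
    LinearMap.trace_smulRight, innerₗ_apply_apply, innerₗ_apply_apply, h.kahler.orthogonal]
  have : Module.finrank ℝ (TangentSpace 𝓘(ℝ, E) x) = Module.finrank ℝ E := rfl
  rw [this]
  simp only [smul_eq_mul]
  field_simp
  ring

/-- The eigenvalue of the Hessian on `∇τ` extends smoothly across the critical points: there it is
a quotient `⟨∇∇τ(∇τ), X⟩ / ⟨∇τ, X⟩`, whose denominator has nonzero differential for suitable `X` and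
whose numerator vanishes where the denominator does. -/
theorem exists_smooth_hess_grad_eq [PreconnectedSpace M] (hne : ∃ p q : M, τ p ≠ τ q) :
    ∃ l : M → ℝ, ContMDiff 𝓘(ℝ, E) 𝓘(ℝ, ℝ) ∞ l ∧ ∀ x, ∇∇ τ x (∇ τ x) = l x • ∇ τ x := by
  have hG := h.smooth_grad
  have hHG := hG.end_apply (isSmoothEnd_hess h.smooth)
  have hU : Dense {y : M | mvfderiv 𝓘(ℝ, E) τ y ≠ 0} := h.dense_mvfderiv_ne_zero hne
  set U := {y : M | mvfderiv 𝓘(ℝ, E) τ y ≠ 0} with hUdef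
  have hUg : ∀ y, y ∈ U ↔ ∇ τ y ≠ 0 := fun y => grad_eq_zero_iff.symm.not
  set lam : M → ℝ := fun y => ⟪∇∇ τ y (∇ τ y), ∇ τ y⟫ / ⟪∇ τ y, ∇ τ y⟫ with hlam
  have hlams : ∀ y ∈ U, ContMDiffAt 𝓘(ℝ, E) 𝓘(ℝ, ℝ) ∞ lam y := fun y hy =>
    (hHG.inner hG y).div₀ (hG.inner hG y) (inner_self_ne_zero.2 ((hUg y).1 hy))
  have hlamG : ∀ y, ∇∇ τ y (∇ τ y) = lam y • ∇ τ y := by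
    intro y
    by_cases hy : ∇ τ y = 0
    · simp [hy]
    · exact h.hess_grad_eq hΘ hy
  obtain ⟨h1, h2⟩ := contMDiff_extendFrom hU (f := lam) (by
    intro x
    by_cases hx : x ∈ U
    · exact ⟨lam, hlams x hx, .of_forall fun _ _ => rfl⟩
    have hx0 : ∇ τ x = 0 := by rwa [hUg, not_not] at hx
    obtain ⟨v, hv⟩ : ∃ v, ∇∇ τ x v ≠ 0 := by
      by_contra hc
      push Not at hc
      exact h.hess_ne_zero_of_grad_eq_zero hne hx0 (ContinuousLinearMap.ext hc)
    obtain ⟨X, hX, rfl, -⟩ := exists_contMDiff_extend v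
    obtain ⟨V, hV, hVx, -⟩ := exists_contMDiff_extend (∇∇ τ x (X x))
    have ha := hG.inner hX
    have hb := hHG.inner hX
    have hda : lieD V (fun y => ⟪∇ τ y, X y⟫) x ≠ 0 := by
      rw [lieD_inner_grad h.smooth hV hX, hx0, inner_zero_left, add_zero,
        inner_hess_comm h.smooth, hVx]
      exact inner_self_ne_zero.2 hv
    obtain ⟨q, hq, hbq⟩ := exists_contMDiffAt_eq_mul ha hb (x := x) (v := V x) hda
      (.of_forall fun y hy => by
        rw [hlamG y, real_inner_smul_left, hy, mul_zero])
    refine ⟨q, hq, ?_⟩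
    have hqs : ∀ᶠ y in 𝓝 x, ContMDiffAt 𝓘(ℝ, E) 𝓘(ℝ, ℝ) 1 q y :=
      (contMDiffAt_iff_contMDiffAt_nhds (by simp)).1 (hq.of_le (by norm_cast))
    have hda' : ∀ᶠ y in 𝓝 x, lieD V (fun y => ⟪∇ τ y, X y⟫) y ≠ 0 :=
      (hV.lieD ha).continuous.continuousAt.eventually_ne hda
    filter_upwards [hqs, hda', eventually_eventually_nhds.2 hbq] with y hy1 hy2 hy3 hyU
    -- the zero set of the denominator has empty interior
    have hfr : ∃ᶠ z in 𝓝 y, ⟪∇ τ z, X z⟫ ≠ 0 := by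
      intro hc
      refine hy2 ?_
      rw [lieD_congr (g := fun _ => 0) (hc.mono fun z hz => not_not.1 hz)]
      simp [lieD, mvfderiv_const]
    refine tendsto_nhds_unique_of_frequently_eq (hlams y hyU).continuousAt hy1.continuousAt
      ((hfr.and_eventually hy3).mono fun z hz => ?_)
    have := hz.2
    rw [hlamG z, real_inner_smul_left, mul_comm] at this
    exact mul_left_cancel₀ hz.1 this)
  refine ⟨_, h1, fun x => ?_⟩
  by_cases hx : x ∈ U
  · rw [h2 x hx]; exact hlamG x
  · rw [hUg, not_not] at hx
    simp [hx]

end IsKillingPotential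

/-- A Killing potential on a Kähler manifold whose Hessian is
`th g + (la - th) (dτ ⊗ dτ + d^cτ ⊗ d^cτ) / Q` off the critical points, with `th ≠ 0` there; the
eigenvalue functions `th` and `la` are smooth on the whole manifold. -/
structure IsSpecialPotential
    (J : Π x : M, TangentSpace 𝓘(ℝ, E) x →L[ℝ] TangentSpace 𝓘(ℝ, E) x) (τ th la : M → ℝ) : Prop
    extends IsKillingPotential J τ where
  nonconstant : ∃ p q : M, τ p ≠ τ q
  smooth_th : ContMDiff 𝓘(ℝ, E) 𝓘(ℝ, ℝ) ∞ th
  smooth_la : ContMDiff 𝓘(ℝ, E) 𝓘(ℝ, ℝ) ∞ la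
  hess_grad : ∀ x : M, ∇∇ τ x (∇ τ x) = la x • ∇ τ x
  inner_hess : ∀ (x : M) (v w : TangentSpace 𝓘(ℝ, E) x),
    ⟪∇ τ x, ∇ τ x⟫ * ⟪∇∇ τ x v, w⟫ = ⟪∇ τ x, ∇ τ x⟫ * (th x * ⟪v, w⟫)
      + (la x - th x) * gradSq J τ x v w
  th_ne_zero : ∀ x : M, ∇ τ x ≠ 0 → th x ≠ 0

/-- Both eigenvalue functions extend smoothly: the one on `∇τ` by `exists_smooth_hess_grad_eq`, and then
the one on `𝓗` by means of the trace of the Hessian. -/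
theorem IsKillingPotential.exists_isSpecialPotential [PreconnectedSpace M]
    (h : IsKillingPotential J τ) {n : ℕ} (hn : 2 ≤ n) (hdim : Module.finrank ℝ E = 2 * n)
    (hne : ∃ p q : M, τ p ≠ τ q) {Θ : M → ℝ} (hΘ : ∀ x : M, ∇ τ x ≠ 0 →
      ∀ v ∈ horiz J τ x, ∇∇ τ x v = Θ x • v)
    (hΘ0 : ∀ x : M, ∇ τ x ≠ 0 → Θ x ≠ 0) :
    ∃ th la : M → ℝ, IsSpecialPotential J τ th la ∧
      ∀ x, ∇ τ x ≠ 0 → th x = Θ x := by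
  obtain ⟨la, hla, hG⟩ := h.exists_smooth_hess_grad_eq hΘ hne
  have hn' : (2 * n - 2 : ℝ) ≠ 0 := by
    have : (2 : ℝ) ≤ n := by exact_mod_cast hn
    linarith
  -- `tr ∇∇ τ = 2 la + (2 n - 2) th`
  set th : M → ℝ := fun y =>
    (LinearMap.trace ℝ (TangentSpace 𝓘(ℝ, E) y) (∇∇ τ y).toLinearMap - 2 * la y) *
      (2 * n - 2 : ℝ)⁻¹ with hth
  have hthΘ : ∀ x, ∇ τ x ≠ 0 → th x = Θ x := by
    intro x hx
    simp only [hth]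
    rw [h.trace_hess hΘ hx (hG x), hdim, ← div_eq_mul_inv, div_eq_iff hn']
    push_cast
    ring
  have hths : ContMDiff 𝓘(ℝ, E) 𝓘(ℝ, ℝ) ∞ th :=
    ((isSmoothEnd_hess h.smooth).trace.sub (contMDiff_const.mul hla)).mul contMDiff_const
  refine ⟨th, la, ⟨h, hne, hths, hla, hG, fun x v w => ?_, fun x hx => ?_⟩, hthΘ⟩
  · by_cases hx : ∇ τ x = 0
    · simp [hx, gradSq]
    · have hQ : ⟪∇ τ x, ∇ τ x⟫ ≠ 0 := inner_self_ne_zero.2 hx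
      rw [h.hess_apply_eq hΘ hx (hG x), hthΘ x hx, gradSq, inner_add_left, real_inner_smul_left,
        real_inner_smul_left, inner_add_left, real_inner_smul_left, real_inner_smul_left]
      field_simp
  · rw [hthΘ x hx]; exact hΘ0 x hx

end Eigenvalues

/-! ### The differentials of the eigenvalue functions -/

section SpecialPotential

set_option linter.unusedSectionVars false

variable {E : Type*} [NormedAddCommGroup E] [NormedSpace ℝ E] [FiniteDimensional ℝ E]
  {M : Type*} [TopologicalSpace M] [ChartedSpace E M] [IsManifold 𝓘(ℝ, E) ∞ M] [T2Space M]
  [RiemannianBundle (fun x : M => TangentSpace 𝓘(ℝ, E) x)]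
  [IsContMDiffRiemannianBundle 𝓘(ℝ, E) ∞ E (fun x : M => TangentSpace 𝓘(ℝ, E) x)]
variable {X Y Z W : Π x : M, TangentSpace 𝓘(ℝ, E) x} {x : M} {τ : M → ℝ}
local notation "⟪" v ", " w "⟫" => inner ℝ v w
local notation "∇" => grad (E := E)
local notation "∇∇" => hess (E := E)
variable {J : Π x : M, TangentSpace 𝓘(ℝ, E) x →L[ℝ] TangentSpace 𝓘(ℝ, E) x}

theorem exists_ne_zero_orthogonal {V : Type*} [NormedAddCommGroup V] [InnerProductSpace ℝ V]
    [FiniteDimensional ℝ V] {k : ℕ} (w : Fin k → V) (hk : k < Module.finrank ℝ V) :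
    ∃ v : V, v ≠ 0 ∧ ∀ i, ⟪w i, v⟫ = 0 := by
  have h1 : Module.finrank ℝ (Submodule.span ℝ (Set.range w)) ≤ k :=
    (finrank_range_le_card (R := ℝ) w).trans (by simp)
  have h2 : (Submodule.span ℝ (Set.range w))ᗮ ≠ ⊥ := by
    intro hc
    rw [Submodule.orthogonal_eq_bot_iff] at hc
    rw [hc, finrank_top] at h1
    omega
  obtain ⟨v, hv, hv0⟩ := Submodule.exists_mem_ne_zero_of_ne_bot h2
  exact ⟨v, hv0, fun i => (Submodule.mem_orthogonal _ _).1 hv _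
    (Submodule.subset_span (Set.mem_range_self i))⟩

/-- The curvature depends only on the germs of the fields. -/
theorem curvature_congr {X' Y' Z' : Π x : M, TangentSpace 𝓘(ℝ, E) x} (hX : IsSmoothField X)
    (hY : IsSmoothField Y) (hZ : IsSmoothField Z) (hX' : ∀ᶠ y in 𝓝 x, X' y = X y)
    (hY' : ∀ᶠ y in 𝓝 x, Y' y = Y y) (hZ' : ∀ᶠ y in 𝓝 x, Z' y = Z y) :
    curvature X' Y' Z' x = curvature X Y Z x := by
  have h1 : ∀ {Y Y' : Π x : M, TangentSpace 𝓘(ℝ, E) x}, (∀ᶠ y in 𝓝 x, Y' y = Y y) →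
      ∀ᶠ y in 𝓝 x, leviCivita E M Z' y (Y' y) = leviCivita E M Z y (Y y) := by
    intro Y Y' hY'
    filter_upwards [eventually_eventually_nhds.2 hZ', hY'] with y hy1 hy2
    rw [leviCivita_congr (hZ.smoothAt y) hy1, hy2]
  have h2 : VectorField.mlieBracket 𝓘(ℝ, E) X' Y' x = VectorField.mlieBracket 𝓘(ℝ, E) X Y x :=
    Filter.EventuallyEq.mlieBracket_vectorField_eq hX' hY'
  unfold curvature
  rw [leviCivita_congr (Y := fun y => leviCivita E M Z y (Y y)) ((hY.nabla hZ).smoothAt x) (h1 hY'),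
    leviCivita_congr (Y := fun y => leviCivita E M Z y (X y)) ((hX.nabla hZ).smoothAt x) (h1 hX'),
    leviCivita_congr (hZ.smoothAt x) hZ', h2, hX'.self_of_nhds, hY'.self_of_nhds]

namespace IsSpecialPotential

variable {th la : M → ℝ} (h : IsSpecialPotential J τ th la)
include h

theorem inner_grad_J_grad (x : M) : ⟪∇ τ x, J x (∇ τ x)⟫ = 0 := by
  rw [real_inner_comm]; exact h.kahler.inner_J_self x _

/-- `dQ = 2 la dτ`. -/
theorem lieD_inner_grad_self (hX : IsSmoothField X) (x : M) :
    lieD X (fun y => ⟪∇ τ y, ∇ τ y⟫) x = 2 * la x * ⟪∇ τ x, X x⟫ := by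
  have hc : nabla X (∇ τ) x = ∇∇ τ x (X x) := rfl
  rw [lieD_inner hX h.smooth_grad h.smooth_grad, hc, real_inner_comm, ← two_mul,
    ← inner_hess_comm h.smooth, h.hess_grad, real_inner_smul_left, mul_assoc]

theorem hess_horiz (hx : ∇ τ x ≠ 0) {v : TangentSpace 𝓘(ℝ, E) x} (h1 : ⟪∇ τ x, v⟫ = 0)
    (h2 : ⟪J x (∇ τ x), v⟫ = 0) : ∇∇ τ x v = th x • v := by
  have hQ : ⟪∇ τ x, ∇ τ x⟫ ≠ 0 := inner_self_ne_zero.2 hx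
  refine ext_inner_right ℝ fun w => mul_left_cancel₀ hQ ?_
  rw [h.inner_hess, gradSq, h1, h2, real_inner_smul_left]
  ring

/-- The covariant derivative of the Hessian in terms of the differentials of its eigenvalues. -/
theorem inner_mul_hessD (hX : IsSmoothField X) (hY : IsSmoothField Y) (hZ : IsSmoothField Z)
    (x : M) :
    ⟪∇ τ x, ∇ τ x⟫ * hessD τ X Y Z x = ⟪∇ τ x, ∇ τ x⟫ * lieD X th x * ⟪Y x, Z x⟫
      + 2 * la x * ⟪∇ τ x, X x⟫ * (th x * ⟪Y x, Z x⟫ - ⟪∇∇ τ x (Y x), Z x⟫)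
      + (lieD X la x - lieD X th x) * gradSq J τ x (Y x) (Z x)
      + (la x - th x) * (⟪∇∇ τ x (X x), Y x⟫ * ⟪∇ τ x, Z x⟫ + ⟪∇ τ x, Y x⟫ * ⟪∇∇ τ x (X x), Z x⟫
        + ⟪J x (∇∇ τ x (X x)), Y x⟫ * ⟪J x (∇ τ x), Z x⟫
        + ⟪J x (∇ τ x), Y x⟫ * ⟪J x (∇∇ τ x (X x)), Z x⟫) := by
  have d : ∀ {f : M → ℝ}, ContMDiff 𝓘(ℝ, E) 𝓘(ℝ, ℝ) ∞ f → MDiffAt f x :=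
    fun hf => (hf x).mdifferentiableAt (by simp)
  have mul : ∀ {f g : M → ℝ}, ContMDiff 𝓘(ℝ, E) 𝓘(ℝ, ℝ) ∞ f → ContMDiff 𝓘(ℝ, E) 𝓘(ℝ, ℝ) ∞ g →
      ContMDiff 𝓘(ℝ, E) 𝓘(ℝ, ℝ) ∞ (fun y => f y * g y) := fun hf hg => hf.mul hg
  have add : ∀ {f g : M → ℝ}, ContMDiff 𝓘(ℝ, E) 𝓘(ℝ, ℝ) ∞ f → ContMDiff 𝓘(ℝ, E) 𝓘(ℝ, ℝ) ∞ g →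
      ContMDiff 𝓘(ℝ, E) 𝓘(ℝ, ℝ) ∞ (fun y => f y + g y) := fun hf hg => hf.add hg
  have sub : ∀ {f g : M → ℝ}, ContMDiff 𝓘(ℝ, E) 𝓘(ℝ, ℝ) ∞ f → ContMDiff 𝓘(ℝ, E) 𝓘(ℝ, ℝ) ∞ g →
      ContMDiff 𝓘(ℝ, E) 𝓘(ℝ, ℝ) ∞ (fun y => f y - g y) := fun hf hg => hf.sub hg
  have hG := h.smooth_grad
  have hξ : IsSmoothField (fun y => J y (∇ τ y)) := hG.end_apply h.kahler.smooth
  have hQ := hG.inner hG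
  have hξd : ∀ {Y : Π x : M, TangentSpace 𝓘(ℝ, E) x}, IsSmoothField Y →
      lieD X (fun y => ⟪J y (∇ τ y), Y y⟫) x
        = ⟪J x (∇∇ τ x (X x)), Y x⟫ + ⟪J x (∇ τ x), nabla X Y x⟫ := by
    intro Y hY
    rw [lieD_inner hX hξ hY, h.nabla_J_grad hX]
  have hYZ := hY.inner hZ
  have hGY := hG.inner hY
  have hGZ := hG.inner hZ
  have hξY := hξ.inner hY
  have hξZ := hξ.inner hZ
  have hH := (hY.end_apply (isSmoothEnd_hess h.smooth)).inner hZ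
  have e : (fun y => ⟪∇ τ y, ∇ τ y⟫ * ⟪∇∇ τ y (Y y), Z y⟫)
      = fun y => ⟪∇ τ y, ∇ τ y⟫ * (th y * ⟪Y y, Z y⟫) + (la y - th y) *
        (⟪∇ τ y, Y y⟫ * ⟪∇ τ y, Z y⟫ + ⟪J y (∇ τ y), Y y⟫ * ⟪J y (∇ τ y), Z y⟫) :=
    funext fun y => h.inner_hess y (Y y) (Z y)
  have e1 := congrArg (fun f => lieD X f x) e
  rw [lieD_mul (d hQ) (d hH),
    lieD_add (d (mul hQ (mul h.smooth_th hYZ)))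
      (d (mul (sub h.smooth_la h.smooth_th) (add (mul hGY hGZ) (mul hξY hξZ)))),
    lieD_mul (d hQ) (d (mul h.smooth_th hYZ)), lieD_mul (d h.smooth_th) (d hYZ),
    lieD_mul (d (sub h.smooth_la h.smooth_th)) (d (add (mul hGY hGZ) (mul hξY hξZ))),
    lieD_sub (d h.smooth_la) (d h.smooth_th), lieD_add (d (mul hGY hGZ)) (d (mul hξY hξZ)),
    lieD_mul (d hGY) (d hGZ), lieD_mul (d hξY) (d hξZ), h.lieD_inner_grad_self hX,
    lieD_inner hX hY hZ, lieD_inner_hess h.smooth hX hY hZ, hξd hY, hξd hZ,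
    lieD_inner_grad h.smooth hX hY, lieD_inner_grad h.smooth hX hZ] at e1
  have e2 := h.inner_hess x (nabla X Y x) (Z x)
  have e3 := h.inner_hess x (Y x) (nabla X Z x)
  simp only [gradSq] at e2 e3 ⊢
  linear_combination e1 - e2 - e3

/-- Closedness of `⟨∇(J∇τ), ·⟩` determines the derivative of `th` along `u` if there is a vector
orthogonal to the complex span of `∇τ` and `u`. -/
theorem inner_mul_mvfderiv_th_of_orthogonal (hx : ∇ τ x ≠ 0) {u v : TangentSpace 𝓘(ℝ, E) x}
    (hv : v ≠ 0) (hGv : ⟪∇ τ x, v⟫ = 0) (hξv : ⟪J x (∇ τ x), v⟫ = 0) (huv : ⟪u, v⟫ = 0)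
    (hJuv : ⟪J x u, v⟫ = 0) :
    ⟪∇ τ x, ∇ τ x⟫ * mvfderiv 𝓘(ℝ, E) th x u = 2 * th x * (la x - th x) * ⟪∇ τ x, u⟫ := by
  obtain ⟨X, hX, rfl, -⟩ := exists_contMDiff_extend u
  obtain ⟨V, hV, rfl, -⟩ := exists_contMDiff_extend v
  have hJ := h.kahler
  have hJV : IsSmoothField (fun y => J y (V y)) := hV.end_apply hJ.smooth
  have hGJv : ⟪∇ τ x, J x (V x)⟫ = 0 := by
    have := hJ.inner_J_left x (∇ τ x) (V x); linarith
  have hξJv : ⟪J x (∇ τ x), J x (V x)⟫ = 0 := by rw [hJ.orthogonal, hGv]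
  have huJv : ⟪X x, J x (V x)⟫ = 0 := by
    have := hJ.inner_J_left x (X x) (V x); linarith
  have hHv : ∇∇ τ x (V x) = th x • V x := h.hess_horiz hx hGv hξv
  have hvv : ⟪J x (V x), V x⟫ = 0 := hJ.inner_J_self x _
  have hvv' : ⟪V x, J x (V x)⟫ = 0 := by rw [real_inner_comm, hvv]
  have huX : ⟪∇∇ τ x (X x), V x⟫ = 0 := by
    rw [inner_hess_comm h.smooth, hHv, real_inner_smul_right, huv, mul_zero]
  have huX' : ⟪∇∇ τ x (X x), J x (V x)⟫ = 0 := by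
    rw [inner_hess_comm h.smooth, h.hess_J, hHv, map_smul, real_inner_smul_right, huJv, mul_zero]
  -- closedness evaluated on `u`, `v`, `Jv`
  have e0 := h.hessD_cyclic hX hV hV x
  have e1 := h.inner_mul_hessD hX hV hV x
  have e2 := h.inner_mul_hessD hV hX hV x
  have e3 := h.inner_mul_hessD hJV hX hJV x
  have hvu : ⟪V x, X x⟫ = 0 := by rw [real_inner_comm, huv]
  have hJvu : ⟪J x (V x), X x⟫ = 0 := by rw [real_inner_comm, huJv]
  simp only [gradSq, hGv, hξv, hGJv, hξJv, h.hess_J, hHv, map_smul, real_inner_smul_left, huv, huJv,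
    hvv, hvv', huX, huX', hJ.sq, inner_neg_left, hJ.orthogonal, hvu, hJvu, mul_zero, zero_mul,
    add_zero, zero_add, sub_self, neg_zero] at e1 e2 e3
  have hv0 : ⟪V x, V x⟫ ≠ 0 := inner_self_ne_zero.2 hv
  refine mul_right_cancel₀ hv0 ?_
  change ⟪∇ τ x, ∇ τ x⟫ * lieD X th x * ⟪V x, V x⟫ = _
  linear_combination ⟪∇ τ x, ∇ τ x⟫ * e0 - e1 + e2 + e3

/-- Closedness of `⟨∇(J∇τ), ·⟩`, evaluated on `w`, `∇τ` and `J∇τ`. -/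
theorem mvfderiv_la_horiz (hx : ∇ τ x ≠ 0) {w : TangentSpace 𝓘(ℝ, E) x}
    (hGw : ⟪∇ τ x, w⟫ = 0) (hξw : ⟪J x (∇ τ x), w⟫ = 0) : mvfderiv 𝓘(ℝ, E) la x w = 0 := by
  obtain ⟨W, hW, rfl, -⟩ := exists_contMDiff_extend w
  have hJ := h.kahler
  have hG := h.smooth_grad
  have hξ : IsSmoothField (fun y => J y (∇ τ y)) := hG.end_apply hJ.smooth
  have e0 := h.hessD_cyclic hW hG hG x
  have e1 := h.inner_mul_hessD hW hG hG x
  have e2 := h.inner_mul_hessD hG hW hG x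
  have e3 := h.inner_mul_hessD hξ hW hξ x
  have hHw : ∇∇ τ x (W x) = th x • W x := h.hess_horiz hx hGw hξw
  have hwG : ⟪W x, ∇ τ x⟫ = 0 := by rw [real_inner_comm, hGw]
  have hwξ : ⟪W x, J x (∇ τ x)⟫ = 0 := by rw [real_inner_comm, hξw]
  simp only [gradSq, h.hess_J, hHw, h.hess_grad, map_smul, hJ.sq, inner_neg_left, hJ.orthogonal,
    real_inner_smul_left, hGw, hξw, hwG, hwξ, h.inner_grad_J_grad,
    hJ.inner_J_self, smul_neg, mul_zero, zero_mul,
    add_zero, sub_self, neg_zero] at e1 e2 e3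
  have hQ : ⟪∇ τ x, ∇ τ x⟫ ≠ 0 := inner_self_ne_zero.2 hx
  have e4 : ⟪∇ τ x, ∇ τ x⟫ * (⟪∇ τ x, ∇ τ x⟫ * lieD W la x) = 0 := by
    linear_combination ⟪∇ τ x, ∇ τ x⟫ * e0 - e1 + e2 + e3
  exact (mul_eq_zero.1 ((mul_eq_zero.1 e4).resolve_left hQ)).resolve_left hQ

/-- For horizontal `w` the condition `Ric(∇τ, w) = 0` becomes, by the Ricci identity, a relation between
traces of the covariant derivative of the Hessian. The frame is orthonormal only at `x`. -/
theorem sum_hessD_sub_eq_zero (hRic : IsRicciEigenGrad (E := E) τ) {w : TangentSpace 𝓘(ℝ, E) x}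
    (hGw : ⟪∇ τ x, w⟫ = 0) :
    ∃ (W : Π x : M, TangentSpace 𝓘(ℝ, E) x)
      (F : Fin (Module.finrank ℝ (TangentSpace 𝓘(ℝ, E) x)) → Π x : M, TangentSpace 𝓘(ℝ, E) x),
      IsSmoothField W ∧ W x = w ∧ (∀ i, IsSmoothField (F i)) ∧
      (∀ i, F i x = stdOrthonormalBasis ℝ (TangentSpace 𝓘(ℝ, E) x) i) ∧
      ∑ i, (hessD τ W (F i) (F i) x - hessD τ (F i) W (F i) x) = 0 := by
  obtain ⟨W, hW, hWx, hWe⟩ := exists_contMDiff_extend w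
  obtain ⟨V, hV, hVx, hVe⟩ := exists_contMDiff_extend (∇ τ x)
  choose F hF hFx hFe using fun i =>
    exists_contMDiff_extend (stdOrthonormalBasis ℝ (TangentSpace 𝓘(ℝ, E) x) i)
  refine ⟨W, F, hW, hWx, hF, hFx, ?_⟩
  obtain ⟨a, ha⟩ := hRic x
  have h1 := ha w
  rw [hGw, mul_zero, ricci] at h1
  rw [← neg_eq_zero, ← h1, ← Finset.sum_neg_distrib]
  refine Finset.sum_congr rfl fun i _ => ?_
  rw [hessD_sub_hessD hW (hF i), riem_swap_right hW (hF i) h.smooth_grad (hF i), neg_neg]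
  have h2 : riem W (F i) (F i) (∇ τ) x = riem W (F i) (F i) V x := by rw [riem, riem, hVx]
  rw [h2, riem_pair_symm hW (hF i) (hF i) hV, riem, hFx,
    ← curvature_congr (hF i) hV hW ((hFe i).mono fun _ hy => hy.symm)
      (hVe.mono fun _ hy => hy.symm) (hWe.mono fun _ hy => hy.symm)]

/-- The contracted Ricci identity reads `(2n - 3) Q dth(w) = 0` for horizontal `w`. -/
theorem mvfderiv_th_horiz_of_ricci (hRic : IsRicciEigenGrad (E := E) τ) {n : ℕ} (hn : 2 ≤ n)
    (hdim : Module.finrank ℝ E = 2 * n) (hx : ∇ τ x ≠ 0) {w : TangentSpace 𝓘(ℝ, E) x}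
    (hGw : ⟪∇ τ x, w⟫ = 0) (hξw : ⟪J x (∇ τ x), w⟫ = 0) : mvfderiv 𝓘(ℝ, E) th x w = 0 := by
  have hJ := h.kahler
  have hQ : ⟪∇ τ x, ∇ τ x⟫ ≠ 0 := inner_self_ne_zero.2 hx
  obtain ⟨W, F, hW, hWx, hF, hFx, hsum⟩ := h.sum_hessD_sub_eq_zero hRic hGw
  have hla : lieD W la x = 0 := by
    rw [lieD, hWx]; exact h.mvfderiv_la_horiz hx hGw hξw
  have hHw : ∇∇ τ x w = th x • w := h.hess_horiz hx hGw hξw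
  have hHJw : ∇∇ τ x (J x w) = th x • J x w := by rw [h.hess_J, hHw, map_smul]
  set b := stdOrthonormalBasis ℝ (TangentSpace 𝓘(ℝ, E) x) with hb
  have key : ∀ i, ⟪∇ τ x, ∇ τ x⟫ * (hessD τ W (F i) (F i) x - hessD τ (F i) W (F i) x)
      = ⟪∇ τ x, ∇ τ x⟫ * lieD W th x
        - lieD W th x * (⟪∇ τ x, b i⟫ * ⟪b i, ∇ τ x⟫ + ⟪J x (∇ τ x), b i⟫ * ⟪b i, J x (∇ τ x)⟫)
        + (la x - th x) * th x * (⟪w, b i⟫ * ⟪b i, ∇ τ x⟫ + 3 * (⟪J x w, b i⟫ * ⟪b i, J x (∇ τ x)⟫))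
        - ⟪∇ τ x, ∇ τ x⟫ * (⟪∇ th x, b i⟫ * ⟪b i, w⟫) := by
    intro i
    have e1 := h.inner_mul_hessD hW (hF i) (hF i) x
    have e2 := h.inner_mul_hessD (hF i) hW (hF i) x
    have hbb : ⟪b i, b i⟫ = 1 := by
      rw [real_inner_self_eq_norm_sq, b.orthonormal.1 i]; norm_num
    have hJe : ⟪J x (∇∇ τ x (b i)), w⟫ = -(th x * ⟪J x w, b i⟫) := by
      rw [hJ.inner_J_left, inner_hess_comm h.smooth, hHJw, real_inner_smul_right,
        real_inner_comm]
    have hHe : ⟪∇∇ τ x (b i), w⟫ = th x * ⟪w, b i⟫ := by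
      rw [inner_hess_comm h.smooth, hHw, real_inner_smul_right, real_inner_comm]
    have hFth : lieD (F i) th x = ⟪∇ th x, b i⟫ := by rw [lieD, hFx, inner_grad]
    simp only [gradSq, hFx, hWx, hHw, hla, hGw, hξw, hbb, map_smul, real_inner_smul_left, hJe, hHe,
      hFth] at e1 e2
    simp only [real_inner_comm (b i)]
    rw [mul_sub, e1, e2]
    simp only [real_inner_comm (b i)]
    ring
  have h1 := congrArg (fun s => ⟪∇ τ x, ∇ τ x⟫ * s) hsum
  simp only [Finset.mul_sum, key, mul_zero] at h1
  simp only [Finset.sum_add_distrib, Finset.sum_sub_distrib, ← Finset.mul_sum,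
    b.sum_inner_mul_inner, Finset.sum_const, Finset.card_univ, Fintype.card_fin] at h1
  have hfin : Module.finrank ℝ (TangentSpace 𝓘(ℝ, E) x) = 2 * n := hdim
  have hwG : ⟪w, ∇ τ x⟫ = 0 := by rw [real_inner_comm, hGw]
  have hth : ⟪∇ th x, w⟫ = lieD W th x := by rw [inner_grad, lieD, hWx]
  rw [hfin, hJ.orthogonal, hJ.orthogonal, hwG, hth, nsmul_eq_mul] at h1
  push_cast at h1
  have hn' : (2 : ℝ) ≤ n := by exact_mod_cast hn
  have h2 : (⟪∇ τ x, ∇ τ x⟫ * (2 * n - 3)) * lieD W th x = 0 := by linear_combination h1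
  rcases mul_eq_zero.1 h2 with h3 | h3
  · rcases mul_eq_zero.1 h3 with h4 | h4
    · exact absurd h4 hQ
    · linarith
  · rwa [lieD, hWx] at h3

/-- `Q dth = 2 th (la - th) dτ`. In real dimension at least six every vector `u` admits a nonzero
vector orthogonal to `∇τ`, `J∇τ`, `u`, `Ju`, and closedness suffices. In dimension four such a vector
exists only for vertical `u`, and the Ricci condition is needed. -/
theorem inner_mul_mvfderiv_th {n : ℕ} (hn : 2 ≤ n) (hdim : Module.finrank ℝ E = 2 * n)
    (hRic : n = 2 → IsRicciEigenGrad (E := E) τ) (x : M) (u : TangentSpace 𝓘(ℝ, E) x) :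
    ⟪∇ τ x, ∇ τ x⟫ * mvfderiv 𝓘(ℝ, E) th x u = 2 * th x * (la x - th x) * ⟪∇ τ x, u⟫ := by
  by_cases hx : ∇ τ x = 0
  · simp [hx]
  have hJ := h.kahler
  have hQ : ⟪∇ τ x, ∇ τ x⟫ ≠ 0 := inner_self_ne_zero.2 hx
  have hfin : Module.finrank ℝ (TangentSpace 𝓘(ℝ, E) x) = 2 * n := hdim
  rcases hn.eq_or_lt with hn2 | hn3
  · -- vertical directions are covered by closedness, horizontal ones by the Ricci condition
    obtain ⟨v, hv, hvo⟩ := exists_ne_zero_orthogonal ![∇ τ x, J x (∇ τ x)] (by rw [hfin]; omega)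
    have hGv : ⟪∇ τ x, v⟫ = 0 := hvo 0
    have hξv : ⟪J x (∇ τ x), v⟫ = 0 := hvo 1
    have h1 := h.inner_mul_mvfderiv_th_of_orthogonal hx hv hGv hξv hGv hξv
    have h2 := h.inner_mul_mvfderiv_th_of_orthogonal hx hv hGv hξv hξv
      (by rw [hJ.sq, inner_neg_left, hGv, neg_zero])
    rw [h.inner_grad_J_grad, mul_zero] at h2
    set p := ⟪∇ τ x, u⟫ / ⟪∇ τ x, ∇ τ x⟫ with hp
    set q := ⟪J x (∇ τ x), u⟫ / ⟪∇ τ x, ∇ τ x⟫ with hq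
    have h3 := h.mvfderiv_th_horiz_of_ricci (hRic hn2.symm) hn hdim hx
      (w := u - p • ∇ τ x - q • J x (∇ τ x))
      (by
        rw [inner_sub_right, inner_sub_right, real_inner_smul_right, real_inner_smul_right,
          h.inner_grad_J_grad, hp]
        field_simp
        ring)
      (by
        rw [inner_sub_right, inner_sub_right, real_inner_smul_right, real_inner_smul_right,
          hJ.inner_J_self, hJ.orthogonal, hq]
        field_simp
        ring)
    rw [map_sub, map_sub, map_smul, map_smul, smul_eq_mul, smul_eq_mul] at h3
    have h4 : p * ⟪∇ τ x, ∇ τ x⟫ = ⟪∇ τ x, u⟫ := div_mul_cancel₀ _ hQ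
    linear_combination ⟪∇ τ x, ∇ τ x⟫ * h3 + p * h1 + q * h2 + 2 * th x * (la x - th x) * h4
  · obtain ⟨v, hv, hvo⟩ := exists_ne_zero_orthogonal ![∇ τ x, J x (∇ τ x), u, J x u]
      (by rw [hfin]; omega)
    exact h.inner_mul_mvfderiv_th_of_orthogonal hx hv (hvo 0) (hvo 1) (hvo 2) (hvo 3)

end IsSpecialPotential

end SpecialPotential

/-! ### The constant -/

section Constant

set_option linter.unusedSectionVars false

variable {E : Type*} [NormedAddCommGroup E] [NormedSpace ℝ E] [FiniteDimensional ℝ E]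
  {M : Type*} [TopologicalSpace M] [ChartedSpace E M] [IsManifold 𝓘(ℝ, E) ∞ M] [T2Space M]
  [RiemannianBundle (fun x : M => TangentSpace 𝓘(ℝ, E) x)]
  [IsContMDiffRiemannianBundle 𝓘(ℝ, E) ∞ E (fun x : M => TangentSpace 𝓘(ℝ, E) x)]
variable {X Y Z W : Π x : M, TangentSpace 𝓘(ℝ, E) x} {x : M} {τ : M → ℝ}
local notation "⟪" v ", " w "⟫" => inner ℝ v w
local notation "∇" => grad (E := E)
local notation "∇∇" => hess (E := E)
variable {J : Π x : M, TangentSpace 𝓘(ℝ, E) x →L[ℝ] TangentSpace 𝓘(ℝ, E) x}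

/-- A special potential together with its constant `c`: `Q = 2 th (τ - c)`, and the resulting
formula for `dth`. -/
structure IsNormalizedPotential
    (J : Π x : M, TangentSpace 𝓘(ℝ, E) x →L[ℝ] TangentSpace 𝓘(ℝ, E) x) (τ th la : M → ℝ) (c : ℝ) :
    Prop extends IsSpecialPotential J τ th la where
  inner_grad_self : ∀ x : M, ⟪∇ τ x, ∇ τ x⟫ = 2 * th x * (τ x - c)
  inner_mul_mvfderiv_th : ∀ (x : M) (u : TangentSpace 𝓘(ℝ, E) x),
    ⟪∇ τ x, ∇ τ x⟫ * mvfderiv 𝓘(ℝ, E) th x u = 2 * th x * (la x - th x) * ⟪∇ τ x, u⟫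

namespace IsSpecialPotential

variable {th la : M → ℝ} (h : IsSpecialPotential J τ th la)
include h

/-- The formulas `dQ = 2 la dτ` and `Q dth = 2 th (la - th) dτ` give `d(Q / (2 th)) = dτ`. -/
theorem mvfderiv_sub_div_eq_zero (hth : ∀ (x : M) (u : TangentSpace 𝓘(ℝ, E) x),
      ⟪∇ τ x, ∇ τ x⟫ * mvfderiv 𝓘(ℝ, E) th x u = 2 * th x * (la x - th x) * ⟪∇ τ x, u⟫)
    (hx : ∇ τ x ≠ 0) :
    MDiffAt (fun y => τ y - ⟪∇ τ y, ∇ τ y⟫ / (2 * th y)) x ∧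
      mvfderiv 𝓘(ℝ, E) (fun y => τ y - ⟪∇ τ y, ∇ τ y⟫ / (2 * th y)) x = 0 := by
  have d : ∀ {f : M → ℝ}, ContMDiff 𝓘(ℝ, E) 𝓘(ℝ, ℝ) ∞ f → MDiffAt f x :=
    fun hf => (hf x).mdifferentiableAt (by simp)
  have hthx := h.th_ne_zero x hx
  have hQ := h.smooth_grad.inner h.smooth_grad
  set f : M → ℝ := fun y => τ y - ⟪∇ τ y, ∇ τ y⟫ / (2 * th y) with hf
  have hfd : MDiffAt f x :=
    ContMDiffAt.mdifferentiableAt (n := ∞) ((h.smooth x).sub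
      ((hQ x).div₀ (contMDiffAt_const.mul (h.smooth_th x)) (mul_ne_zero two_ne_zero hthx)))
      (by simp)
  refine ⟨hfd, ?_⟩
  ext u
  obtain ⟨X, hX, rfl, -⟩ := exists_contMDiff_extend u
  have hne : ∀ᶠ y in 𝓝 x, th y ≠ 0 := h.smooth_th.continuous.continuousAt.eventually_ne hthx
  have h1 : lieD X (fun y => ⟪∇ τ y, ∇ τ y⟫) x
      = lieD X (fun y => (th y + th y) * (τ y - f y)) x := by
    refine lieD_congr ?_
    filter_upwards [hne] with y hy
    simp only [hf]
    field_simp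
    ring
  have hτf : MDiffAt (fun y => τ y - f y) x := (d h.smooth).sub hfd
  have hth2 : MDiffAt (fun y => th y + th y) x := (d h.smooth_th).add (d h.smooth_th)
  rw [h.lieD_inner_grad_self hX, lieD_mul hth2 hτf, lieD_add (d h.smooth_th) (d h.smooth_th),
    lieD_sub (d h.smooth) hfd] at h1
  have h2 : lieD X τ x = ⟪∇ τ x, X x⟫ := (inner_grad τ x (X x)).symm
  have h3 := hth x (X x)
  change _ * lieD X th x = _ at h3
  have h4 : 2 * th x * (τ x - f x) = ⟪∇ τ x, ∇ τ x⟫ := by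
    simp only [hf]
    field_simp
    ring
  have h5 : th x * (th x * lieD X f x) = 0 := by
    rw [h2] at h1
    clear_value f
    linear_combination (1 / 2) * (th x * h1 + h3 + lieD X th x * h4)
  have h6 := (mul_eq_zero.1 ((mul_eq_zero.1 h5).resolve_left hthx)).resolve_left hthx
  rw [zero_apply]
  exact h6

/-- `τ - Q / (2 th)` has zero differential off the critical points. Near a critical point `x`, the
critical set lies in the common zero set of two functions `dτ(X)`, `d^cτ(X)` with independent
differentials at `x`, which does not separate. -/
theorem exists_isNormalizedPotential [ConnectedSpace M]
    (hth : ∀ (x : M) (u : TangentSpace 𝓘(ℝ, E) x),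
      ⟪∇ τ x, ∇ τ x⟫ * mvfderiv 𝓘(ℝ, E) th x u = 2 * th x * (la x - th x) * ⟪∇ τ x, u⟫) :
    ∃ c, IsNormalizedPotential J τ th la c := by
  have hG := h.smooth_grad
  have hξ : IsSmoothField (fun y => J y (∇ τ y)) := hG.end_apply h.kahler.smooth
  have hU := h.dense_mvfderiv_ne_zero h.nonconstant
  set U := {y : M | mvfderiv 𝓘(ℝ, E) τ y ≠ 0} with hUdef
  have hUg : ∀ y, y ∈ U ↔ ∇ τ y ≠ 0 := fun y => grad_eq_zero_iff.symm.not
  have hUo : ∀ y ∈ U, ∀ᶠ z in 𝓝 y, z ∈ U := by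
    intro y hy
    have h1 : ⟪∇ τ y, ∇ τ y⟫ ≠ 0 := inner_self_ne_zero.2 ((hUg y).1 hy)
    filter_upwards [(hG.inner hG).continuous.continuousAt.eventually_ne h1] with z hz
    exact (hUg z).2 fun hc => hz (by rw [hc, inner_zero_left])
  set f : M → ℝ := fun y => τ y - ⟪∇ τ y, ∇ τ y⟫ / (2 * th y) with hf
  have hfU : ∀ y ∈ U, ∀ᶠ z in 𝓝 y, f z = f y := fun y hy =>
    eventually_eq_of_mvfderiv_eq_zero
      ((hUo y hy).mono fun z hz => (h.mvfderiv_sub_div_eq_zero hth ((hUg z).1 hz)).1)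
      ((hUo y hy).mono fun z hz => (h.mvfderiv_sub_div_eq_zero hth ((hUg z).1 hz)).2)
  obtain ⟨c, hc⟩ := exists_eq_of_dense hU (f := f) (by
    intro x
    by_cases hx : x ∈ U
    · exact ⟨f x, (hfU x hx).mono fun y hy _ => hy⟩
    have hx0 : ∇ τ x = 0 := by rwa [hUg, not_not] at hx
    obtain ⟨v, hv⟩ : ∃ v, ∇∇ τ x v ≠ 0 := by
      by_contra hc
      push Not at hc
      exact h.hess_ne_zero_of_grad_eq_zero h.nonconstant hx0 (ContinuousLinearMap.ext hc)
    obtain ⟨X, hX, rfl, -⟩ := exists_contMDiff_extend v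
    have hp : ⟪∇∇ τ x (X x), ∇∇ τ x (X x)⟫ ≠ 0 := inner_self_ne_zero.2 hv
    have hda : ∀ w : TangentSpace 𝓘(ℝ, E) x,
        mvfderiv 𝓘(ℝ, E) (fun y => ⟪∇ τ y, X y⟫) x w = ⟪w, ∇∇ τ x (X x)⟫ := by
      intro w
      obtain ⟨W, hW, rfl, -⟩ := exists_contMDiff_extend w
      have := lieD_inner_grad h.smooth hW hX x
      rw [hx0, inner_zero_left, add_zero, inner_hess_comm h.smooth] at this
      exact this
    have hdb : ∀ w : TangentSpace 𝓘(ℝ, E) x,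
        mvfderiv 𝓘(ℝ, E) (fun y => ⟪J y (∇ τ y), X y⟫) x w = -⟪w, J x (∇∇ τ x (X x))⟫ := by
      intro w
      obtain ⟨W, hW, rfl, -⟩ := exists_contMDiff_extend w
      have := lieD_inner hW hξ hX x
      rw [hx0, map_zero, inner_zero_left, add_zero, h.nabla_J_grad hW, h.kahler.inner_J_left,
        inner_hess_comm h.smooth, h.hess_J] at this
      exact this
    refine exists_eventually_eq_of_codim_two_mfd (hG.inner hX) (hξ.inner hX)
      (v := ⟪∇∇ τ x (X x), ∇∇ τ x (X x)⟫⁻¹ • ∇∇ τ x (X x))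
      (w := -⟪∇∇ τ x (X x), ∇∇ τ x (X x)⟫⁻¹ • J x (∇∇ τ x (X x)))
      (by simp [hx0]) (by simp [hx0]) ?_ ?_ ?_ ?_ ?_ hfU
    · rw [hda, real_inner_smul_left, inv_mul_cancel₀ hp]
    · rw [hda, real_inner_smul_left, h.kahler.inner_J_self, mul_zero]
    · rw [hdb, real_inner_smul_left, real_inner_comm (J x (∇∇ τ x (X x))), h.kahler.inner_J_self,
        mul_zero, neg_zero]
    · rw [hdb, real_inner_smul_left, h.kahler.orthogonal, neg_mul, neg_neg, inv_mul_cancel₀ hp]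
    · intro y hy
      rw [hUg, not_not] at hy
      simp [hy])
  refine ⟨c, h, fun x => ?_, hth⟩
  have h1 := Continuous.ext_on hU (f := fun x => ⟪∇ τ x, ∇ τ x⟫)
    (g := fun x => 2 * th x * (τ x - c)) (hG.inner hG).continuous
    ((continuous_const.mul h.smooth_th.continuous).mul (h.smooth.continuous.sub continuous_const))
    (fun y hy => by
      have hthy := h.th_ne_zero y ((hUg y).1 hy)
      have := hc y hy
      simp only [← this, hf]
      field_simp
      ring)
  exact congrFun h1 x

end IsSpecialPotential

end Constant

/-! ### The Killing tensor and the Hamiltonian form -/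

section Tensors

set_option linter.unusedSectionVars false

variable {E : Type*} [NormedAddCommGroup E] [NormedSpace ℝ E] [FiniteDimensional ℝ E]
  {M : Type*} [TopologicalSpace M] [ChartedSpace E M] [IsManifold 𝓘(ℝ, E) ∞ M] [T2Space M]
  [RiemannianBundle (fun x : M => TangentSpace 𝓘(ℝ, E) x)]
  [IsContMDiffRiemannianBundle 𝓘(ℝ, E) ∞ E (fun x : M => TangentSpace 𝓘(ℝ, E) x)]
variable {X Y Z W : Π x : M, TangentSpace 𝓘(ℝ, E) x} {x : M} {τ : M → ℝ}
local notation "⟪" v ", " w "⟫" => inner ℝ v w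
local notation "∇" => grad (E := E)
local notation "∇∇" => hess (E := E)
variable {J : Π x : M, TangentSpace 𝓘(ℝ, E) x →L[ℝ] TangentSpace 𝓘(ℝ, E) x}

theorem dc_eq_inner (hJ : IsKahler J) (x : M) (v : TangentSpace 𝓘(ℝ, E) x) :
    dc J τ x v = ⟪J x (∇ τ x), v⟫ := by
  rw [dc, ← inner_grad, hJ.inner_J_left]

open scoped Classical in
/-- The tensor `(τ - c) Id - (∇τ ⊗ ∇τ + J∇τ ⊗ J∇τ) / (2 th)`, which is `0` on `𝓥` and
`(τ - c) Id` on `𝓗`. Where `th` vanishes (only at critical points), the value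
`(τ - c) (la Id - ∇∇τ) / la` is the one that makes the tensor smooth. -/
def killingTensor (J : Π x : M, TangentSpace 𝓘(ℝ, E) x →L[ℝ] TangentSpace 𝓘(ℝ, E) x)
    (τ th la : M → ℝ) (c : ℝ) (x : M) : TangentSpace 𝓘(ℝ, E) x →L[ℝ] TangentSpace 𝓘(ℝ, E) x :=
  if th x = 0 then
    ((τ x - c) / la x) • (la x • ContinuousLinearMap.id ℝ (TangentSpace 𝓘(ℝ, E) x) - hess τ x)
  else
    (τ x - c) • ContinuousLinearMap.id ℝ (TangentSpace 𝓘(ℝ, E) x) - (2 * th x)⁻¹ •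
      ((innerSL ℝ (∇ τ x)).smulRight (∇ τ x)
        + (innerSL ℝ (J x (∇ τ x))).smulRight (J x (∇ τ x)))

/-- The 2-form `φ(v, w) = (τ - c) g(J v, w) - g(S J v, w)`, with `S = killingTensor`. -/
def hamiltonianForm (J : Π x : M, TangentSpace 𝓘(ℝ, E) x →L[ℝ] TangentSpace 𝓘(ℝ, E) x)
    (τ th la : M → ℝ) (c : ℝ) (x : M) :
    TangentSpace 𝓘(ℝ, E) x →L[ℝ] TangentSpace 𝓘(ℝ, E) x →L[ℝ] ℝ :=
  (isBoundedBilinearMap_inner (𝕜 := ℝ)).toContinuousLinearMap.comp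
    ((τ x - c) • J x - (killingTensor J τ th la c x).comp (J x))

theorem hamiltonianForm_apply (τ th la : M → ℝ) (c : ℝ) (v w : TangentSpace 𝓘(ℝ, E) x) :
    hamiltonianForm J τ th la c x v w
      = (τ x - c) * ⟪J x v, w⟫ - ⟪killingTensor J τ th la c x (J x v), w⟫ := by
  rw [← real_inner_smul_left, ← inner_sub_left]
  rfl

theorem killingTensor_of_eq_zero {τ th la : M → ℝ} {c : ℝ} (hth : th x = 0)
    (v : TangentSpace 𝓘(ℝ, E) x) : killingTensor J τ th la c x v
      = ((τ x - c) / la x) • (la x • v - ∇∇ τ x v) := by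
  rw [killingTensor, if_pos hth]
  rfl

theorem killingTensor_of_ne_zero {τ th la : M → ℝ} {c : ℝ} (hth : th x ≠ 0)
    (v : TangentSpace 𝓘(ℝ, E) x) : killingTensor J τ th la c x v
      = (τ x - c) • v - (2 * th x)⁻¹ •
        (⟪∇ τ x, v⟫ • ∇ τ x + ⟪J x (∇ τ x), v⟫ • J x (∇ τ x)) := by
  rw [killingTensor, if_neg hth]
  rfl

/-- Two continuous tensorial expressions that agree off the critical points agree. -/
theorem IsKillingPotential.eq_of_eq_off_critical [PreconnectedSpace M]
    (h : IsKillingPotential J τ) (hne : ∃ p q : M, τ p ≠ τ q) {f g : M → ℝ} (hf : Continuous f)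
    (hg : Continuous g) (hfg : ∀ x, ∇ τ x ≠ 0 → f x = g x) (x : M) : f x = g x :=
  congrFun (Continuous.ext_on (h.dense_mvfderiv_ne_zero hne) hf hg
    fun y hy => hfg y (grad_eq_zero_iff.not.2 hy)) x

namespace IsNormalizedPotential

variable {th la : M → ℝ} {c : ℝ} (h : IsNormalizedPotential J τ th la c)
include h

theorem grad_eq_zero_of_th_eq_zero (hth : th x = 0) : ∇ τ x = 0 := by
  by_contra hc
  exact h.th_ne_zero x hc hth

theorem inner_smul_hess (x : M) (v : TangentSpace 𝓘(ℝ, E) x) :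
    ⟪∇ τ x, ∇ τ x⟫ • ∇∇ τ x v = (⟪∇ τ x, ∇ τ x⟫ * th x) • v
      + (la x - th x) • (⟪∇ τ x, v⟫ • ∇ τ x + ⟪J x (∇ τ x), v⟫ • J x (∇ τ x)) := by
  refine ext_inner_right ℝ fun w => ?_
  simp only [inner_add_left, real_inner_smul_left]
  rw [h.inner_hess, gradSq]
  ring

/-- The polynomial `(t - th) (t - la)` annihilates the Hessian, also at the critical points. -/
theorem hess_hess [PreconnectedSpace M] (x : M) (v w : TangentSpace 𝓘(ℝ, E) x) :
    ⟪∇∇ τ x (∇∇ τ x v), w⟫ = (th x + la x) * ⟪∇∇ τ x v, w⟫ - th x * la x * ⟪v, w⟫ := by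
  obtain ⟨V, hV, rfl, -⟩ := exists_contMDiff_extend v
  obtain ⟨W, hW, rfl, -⟩ := exists_contMDiff_extend w
  have hs := isSmoothEnd_hess (E := E) h.smooth
  have hHV := hV.end_apply hs
  refine h.eq_of_eq_off_critical h.nonconstant (f := fun x => ⟪∇∇ τ x (∇∇ τ x (V x)), W x⟫)
    (g := fun x => (th x + la x) * ⟪∇∇ τ x (V x), W x⟫ - th x * la x * ⟪V x, W x⟫)
    ((hHV.end_apply hs).inner hW).continuous
    (((h.smooth_th.continuous.add h.smooth_la.continuous).mul (hHV.inner hW).continuous).sub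
      ((h.smooth_th.continuous.mul h.smooth_la.continuous).mul (hV.inner hW).continuous))
    (fun x hx => ?_) x
  have hQ : ⟪∇ τ x, ∇ τ x⟫ ≠ 0 := inner_self_ne_zero.2 hx
  refine mul_left_cancel₀ hQ ?_
  have e := congrArg (fun u => ⟪∇∇ τ x u, W x⟫) (h.inner_smul_hess x (V x))
  have e2 := congrArg (fun u => ⟪u, W x⟫) (h.inner_smul_hess x (V x))
  simp only [map_add, map_smul, h.hess_J, h.hess_grad, inner_add_left, real_inner_smul_left]
    at e e2
  linear_combination e - la x * e2

/-- If both eigenvalues vanished, the self-adjoint Hessian would have square zero at a critical point. -/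
theorem la_ne_zero_of_th_eq_zero [PreconnectedSpace M] (hth : th x = 0) : la x ≠ 0 := by
  intro hla
  refine h.hess_ne_zero_of_grad_eq_zero h.nonconstant (h.grad_eq_zero_of_th_eq_zero hth) ?_
  ext v
  rw [zero_apply]
  refine (inner_self_eq_zero (𝕜 := ℝ)).1 ?_
  rw [inner_hess_comm h.smooth, real_inner_comm, h.hess_hess, hth, hla]
  ring

/-- A single expression for the tensor wherever the eigenvalues differ, in particular near the zeros
of `th`, where it is smooth. -/
theorem killingTensor_of_la_ne_th (hla : la x ≠ th x) (v : TangentSpace 𝓘(ℝ, E) x) :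
    killingTensor J τ th la c x v = ((τ x - c) / (la x - th x)) • (la x • v - ∇∇ τ x v) := by
  by_cases hth : th x = 0
  · rw [killingTensor_of_eq_zero hth, hth, sub_zero]
  rw [killingTensor_of_ne_zero hth]
  have hd : la x - th x ≠ 0 := sub_ne_zero.2 hla
  by_cases hx : ∇ τ x = 0
  · have hτ : τ x - c = 0 := by
      have := h.inner_grad_self x
      rw [hx, inner_zero_left] at this
      exact (mul_eq_zero.1 this.symm).resolve_left (mul_ne_zero two_ne_zero hth)
    simp [hx, hτ]
  have hQ : ⟪∇ τ x, ∇ τ x⟫ ≠ 0 := inner_self_ne_zero.2 hx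
  refine ext_inner_right ℝ fun w => mul_left_cancel₀ hQ ?_
  have e := h.inner_hess x v w
  have e2 := h.inner_grad_self x
  simp only [inner_sub_left, inner_add_left, real_inner_smul_left]
  rw [gradSq] at e
  have hτ : τ x - c = ⟪∇ τ x, ∇ τ x⟫ / (2 * th x) := by
    rw [e2]; field_simp
  rw [hτ]
  field_simp
  linear_combination e

/-- Each of the two expressions for the tensor is smooth on its open domain, `th ≠ 0` or `la ≠ th`, and
these cover the manifold. -/
theorem isSmoothEnd_killingTensor [PreconnectedSpace M] :
    IsSmoothEnd (killingTensor J τ th la c) := by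
  intro x
  refine contMDiffAt_end_of_forall fun Y hY => ?_
  have hG := h.smooth_grad
  have hξ : IsSmoothField (fun y => J y (∇ τ y)) := hG.end_apply h.kahler.smooth
  by_cases hth : th x = 0
  · have hd : la x - th x ≠ 0 := by
      rw [hth, sub_zero]; exact h.la_ne_zero_of_th_eq_zero hth
    have h1 : SmoothFieldAt
        (fun y => ((τ y - c) / (la y - th y)) • (la y • Y y - ∇∇ τ y (Y y))) x :=
      SmoothFieldAt.smul
        (((h.smooth x).sub contMDiffAt_const).div₀ ((h.smooth_la x).sub (h.smooth_th x)) hd)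
        ((SmoothFieldAt.smul (h.smooth_la x) (hY x)).sub
          ((hY.end_apply (isSmoothEnd_hess h.smooth)).smoothAt x))
    refine h1.congr ?_
    filter_upwards [(h.smooth_la.sub h.smooth_th).continuous.continuousAt.eventually_ne hd]
      with y hy
    exact h.killingTensor_of_la_ne_th (sub_ne_zero.1 hy) (Y y)
  · have h1 : SmoothFieldAt (fun y => (τ y - c) • Y y - (2 * th y)⁻¹ •
        (⟪∇ τ y, Y y⟫ • ∇ τ y + ⟪J y (∇ τ y), Y y⟫ • J y (∇ τ y))) x :=
      (SmoothFieldAt.smul ((h.smooth x).sub contMDiffAt_const) (hY x)).sub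
        (SmoothFieldAt.smul ((contMDiffAt_const.mul (h.smooth_th x)).inv₀
          (mul_ne_zero two_ne_zero hth))
          ((SmoothFieldAt.smul (hG.inner hY x) (hG x)).add
            (SmoothFieldAt.smul (hξ.inner hY x) (hξ x))))
    refine h1.congr ?_
    filter_upwards [h.smooth_th.continuous.continuousAt.eventually_ne hth] with y hy
    exact killingTensor_of_ne_zero hy (Y y)

theorem inner_killingTensor_comm (x : M) (v w : TangentSpace 𝓘(ℝ, E) x) :
    ⟪killingTensor J τ th la c x v, w⟫ = ⟪v, killingTensor J τ th la c x w⟫ := by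
  by_cases hth : th x = 0
  · rw [killingTensor_of_eq_zero hth, killingTensor_of_eq_zero hth, real_inner_smul_left,
      real_inner_smul_right, inner_sub_left, inner_sub_right, real_inner_smul_left,
      real_inner_smul_right, inner_hess_comm h.smooth]
  · rw [killingTensor_of_ne_zero hth, killingTensor_of_ne_zero hth]
    simp only [inner_sub_left, inner_sub_right, inner_add_left, inner_add_right,
      real_inner_smul_left, real_inner_smul_right, real_inner_comm (∇ τ x),
      real_inner_comm (J x (∇ τ x))]
    ring

theorem killingTensor_J (x : M) (v : TangentSpace 𝓘(ℝ, E) x) :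
    killingTensor J τ th la c x (J x v) = J x (killingTensor J τ th la c x v) := by
  by_cases hth : th x = 0
  · rw [killingTensor_of_eq_zero hth, killingTensor_of_eq_zero hth, map_smul, map_sub, map_smul,
      h.hess_J]
  · have h1 : ⟪∇ τ x, J x v⟫ = -⟪J x (∇ τ x), v⟫ := by
      rw [h.kahler.inner_J_left, neg_neg]
    rw [killingTensor_of_ne_zero hth, killingTensor_of_ne_zero hth, h.kahler.orthogonal, h1]
    simp only [map_sub, map_add, map_smul, h.kahler.sq]
    module

theorem trace_killingTensor [PreconnectedSpace M] (x : M) :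
    LinearMap.trace ℝ (TangentSpace 𝓘(ℝ, E) x) (killingTensor J τ th la c x).toLinearMap
      = (Module.finrank ℝ E - 2) * (τ x - c) := by
  refine h.eq_of_eq_off_critical h.nonconstant
    (f := fun x => LinearMap.trace ℝ (TangentSpace 𝓘(ℝ, E) x)
      (killingTensor J τ th la c x).toLinearMap)
    (g := fun x => (Module.finrank ℝ E - 2) * (τ x - c))
    h.isSmoothEnd_killingTensor.trace.continuous
    (continuous_const.mul (h.smooth.continuous.sub continuous_const)) (fun x hx => ?_) x
  have hth := h.th_ne_zero x hx
  have e : (killingTensor J τ th la c x).toLinearMap = (τ x - c) • LinearMap.id - (2 * th x)⁻¹ •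
      ((innerₗ _ (∇ τ x)).smulRight (∇ τ x)
        + (innerₗ _ (J x (∇ τ x))).smulRight (J x (∇ τ x))) := by
    ext v
    exact killingTensor_of_ne_zero hth v
  have hfin : Module.finrank ℝ (TangentSpace 𝓘(ℝ, E) x) = Module.finrank ℝ E := rfl
  rw [e, map_sub, map_smul, map_smul, map_add, LinearMap.trace_id, LinearMap.trace_smulRight,
    LinearMap.trace_smulRight, innerₗ_apply_apply, innerₗ_apply_apply, h.kahler.orthogonal, hfin,
    h.inner_grad_self]
  simp only [smul_eq_mul]
  field_simp
  ring

theorem isSmoothBilin_hamiltonianForm [PreconnectedSpace M] :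
    IsSmoothBilin (hamiltonianForm J τ th la c) := by
  intro x
  refine contMDiffAt_bilin_of_forall fun Y Z hY hZ => ?_
  have hJY := hY.end_apply h.kahler.smooth
  simp only [hamiltonianForm_apply]
  exact (((h.smooth x).sub contMDiffAt_const).mul (hJY.inner hZ x)).sub
    ((hJY.end_apply h.isSmoothEnd_killingTensor).inner hZ x)

theorem contMDiff_hamiltonianForm_apply [PreconnectedSpace M] (hY : IsSmoothField Y)
    (hZ : IsSmoothField Z) :
    ContMDiff 𝓘(ℝ, E) 𝓘(ℝ, ℝ) ∞ (fun y => hamiltonianForm J τ th la c y (Y y) (Z y)) := by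
  have hJY := hY.end_apply h.kahler.smooth
  simp only [hamiltonianForm_apply]
  exact ((h.smooth.sub contMDiff_const).mul (hJY.inner hZ)).sub
    ((hJY.end_apply h.isSmoothEnd_killingTensor).inner hZ)

/-- `2 th φ = dτ ∧ d^cτ`, also where `th = 0`. -/
theorem th_mul_hamiltonianForm (x : M) (v w : TangentSpace 𝓘(ℝ, E) x) :
    2 * th x * hamiltonianForm J τ th la c x v w
      = ⟪∇ τ x, v⟫ * ⟪J x (∇ τ x), w⟫ - ⟪∇ τ x, w⟫ * ⟪J x (∇ τ x), v⟫ := by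
  by_cases hth : th x = 0
  · simp [hth, h.grad_eq_zero_of_th_eq_zero hth]
  · have h1 : ⟪∇ τ x, J x v⟫ = -⟪J x (∇ τ x), v⟫ := by
      rw [h.kahler.inner_J_left, neg_neg]
    rw [hamiltonianForm_apply, killingTensor_of_ne_zero hth, h.kahler.orthogonal, h1,
      inner_sub_left, real_inner_smul_left, real_inner_smul_left, inner_add_left,
      real_inner_smul_left, real_inner_smul_left]
    field_simp
    ring

theorem hamiltonianForm_self (x : M) (v : TangentSpace 𝓘(ℝ, E) x) :
    hamiltonianForm J τ th la c x v v = 0 := by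
  have h1 := h.inner_killingTensor_comm x (J x v) v
  rw [h.kahler.inner_J_left, ← h.killingTensor_J, real_inner_comm] at h1
  rw [hamiltonianForm_apply, h.kahler.inner_J_self, real_inner_comm]
  linarith

theorem hamiltonianForm_J (x : M) (v w : TangentSpace 𝓘(ℝ, E) x) :
    hamiltonianForm J τ th la c x (J x v) (J x w) = hamiltonianForm J τ th la c x v w := by
  rw [hamiltonianForm_apply, hamiltonianForm_apply, h.kahler.orthogonal, h.killingTensor_J,
    h.kahler.orthogonal]

theorem omegaTrace_hamiltonianForm [PreconnectedSpace M] (x : M) :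
    omegaTrace J (hamiltonianForm J τ th la c) x = τ x - c := by
  set b := stdOrthonormalBasis ℝ (TangentSpace 𝓘(ℝ, E) x) with hb
  have h1 : ∀ i, hamiltonianForm J τ th la c x (b i) (J x (b i))
      = (τ x - c) - ⟪b i, killingTensor J τ th la c x (b i)⟫ := by
    intro i
    have hbb : ⟪b i, b i⟫ = 1 := by
      rw [real_inner_self_eq_norm_sq, b.orthonormal.1 i]; norm_num
    rw [hamiltonianForm_apply, h.kahler.orthogonal, h.killingTensor_J, h.kahler.orthogonal, hbb,
      mul_one, real_inner_comm]
  have h2 := LinearMap.trace_eq_sum_inner (killingTensor J τ th la c x).toLinearMap b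
  rw [h.trace_killingTensor] at h2
  have hfin : Module.finrank ℝ (TangentSpace 𝓘(ℝ, E) x) = Module.finrank ℝ E := rfl
  rw [omegaTrace, ← hb]
  simp only [h1, Finset.sum_sub_distrib, Finset.sum_const, Finset.card_univ, Fintype.card_fin]
  simp only [ContinuousLinearMap.coe_coe] at h2
  rw [← h2, hfin, nsmul_eq_mul]
  ring

/-- The Hamiltonian equation. Off the critical points it results from differentiating
`2 th φ = dτ ∧ d^cτ`; both sides are continuous, so it holds everywhere. -/
theorem covDerivBilin_hamiltonianForm [PreconnectedSpace M] (hX : IsSmoothField X)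
    (hY : IsSmoothField Y) (hZ : IsSmoothField Z) (x : M) :
    covDerivBilin (hamiltonianForm J τ th la c) X Y Z x
      = (1 / 2) * ((⟪∇ τ x, Y x⟫ * ⟪J x (X x), Z x⟫ - ⟪∇ τ x, Z x⟫ * ⟪J x (X x), Y x⟫)
        - (⟪J x (∇ τ x), Y x⟫ * ⟪X x, Z x⟫ - ⟪J x (∇ τ x), Z x⟫ * ⟪X x, Y x⟫)) := by
  have hJ := h.kahler
  have hG := h.smooth_grad
  have hξ : IsSmoothField (fun y => J y (∇ τ y)) := hG.end_apply hJ.smooth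
  have hJX := hX.end_apply hJ.smooth
  refine h.eq_of_eq_off_critical h.nonconstant
    (f := fun x => covDerivBilin (hamiltonianForm J τ th la c) X Y Z x)
    (g := fun x => (1 / 2) * ((⟪∇ τ x, Y x⟫ * ⟪J x (X x), Z x⟫ - ⟪∇ τ x, Z x⟫ * ⟪J x (X x), Y x⟫)
        - (⟪J x (∇ τ x), Y x⟫ * ⟪X x, Z x⟫ - ⟪J x (∇ τ x), Z x⟫ * ⟪X x, Y x⟫)))
    ?_ ?_ (fun x hx => ?_) x
  · exact (((hX.lieD (h.contMDiff_hamiltonianForm_apply hY hZ)).continuous.sub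
      (h.contMDiff_hamiltonianForm_apply (hX.nabla hY) hZ).continuous).sub
      (h.contMDiff_hamiltonianForm_apply hY (hX.nabla hZ)).continuous)
  · exact continuous_const.mul
      ((((hG.inner hY).continuous.mul (hJX.inner hZ).continuous).sub
        ((hG.inner hZ).continuous.mul (hJX.inner hY).continuous)).sub
      (((hξ.inner hY).continuous.mul (hX.inner hZ).continuous).sub
        ((hξ.inner hZ).continuous.mul (hX.inner hY).continuous)))
  have d : ∀ {f : M → ℝ}, ContMDiff 𝓘(ℝ, E) 𝓘(ℝ, ℝ) ∞ f → MDiffAt f x :=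
    fun hf => (hf x).mdifferentiableAt (by simp)
  have mul : ∀ {f g : M → ℝ}, ContMDiff 𝓘(ℝ, E) 𝓘(ℝ, ℝ) ∞ f → ContMDiff 𝓘(ℝ, E) 𝓘(ℝ, ℝ) ∞ g →
      ContMDiff 𝓘(ℝ, E) 𝓘(ℝ, ℝ) ∞ (fun y => f y * g y) := fun hf hg => hf.mul hg
  have add : ∀ {f g : M → ℝ}, ContMDiff 𝓘(ℝ, E) 𝓘(ℝ, ℝ) ∞ f → ContMDiff 𝓘(ℝ, E) 𝓘(ℝ, ℝ) ∞ g →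
      ContMDiff 𝓘(ℝ, E) 𝓘(ℝ, ℝ) ∞ (fun y => f y + g y) := fun hf hg => hf.add hg
  have hξd : ∀ {Y : Π x : M, TangentSpace 𝓘(ℝ, E) x}, IsSmoothField Y →
      lieD X (fun y => ⟪J y (∇ τ y), Y y⟫) x
        = ⟪J x (∇∇ τ x (X x)), Y x⟫ + ⟪J x (∇ τ x), nabla X Y x⟫ := by
    intro Y hY
    rw [lieD_inner hX hξ hY, h.nabla_J_grad hX]
  have hφ := h.contMDiff_hamiltonianForm_apply hY hZ
  -- differentiate `2 th φ = dτ ∧ d^cτ`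
  have e : (fun y => (th y + th y) * hamiltonianForm J τ th la c y (Y y) (Z y))
      = fun y => ⟪∇ τ y, Y y⟫ * ⟪J y (∇ τ y), Z y⟫ - ⟪∇ τ y, Z y⟫ * ⟪J y (∇ τ y), Y y⟫ :=
    funext fun y => by rw [← two_mul, h.th_mul_hamiltonianForm]
  have e1 := congrArg (fun f => lieD X f x) e
  rw [lieD_mul (d (add h.smooth_th h.smooth_th)) (d hφ), lieD_add (d h.smooth_th) (d h.smooth_th),
    lieD_sub (d (mul (hG.inner hY) (hξ.inner hZ))) (d (mul (hG.inner hZ) (hξ.inner hY))),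
    lieD_mul (d (hG.inner hY)) (d (hξ.inner hZ)), lieD_mul (d (hG.inner hZ)) (d (hξ.inner hY)),
    hξd hY, hξd hZ, lieD_inner_grad h.smooth hX hY, lieD_inner_grad h.smooth hX hZ] at e1
  have e2 := h.th_mul_hamiltonianForm x (nabla X Y x) (Z x)
  have e3 := h.th_mul_hamiltonianForm x (Y x) (nabla X Z x)
  have e4 := h.th_mul_hamiltonianForm x (Y x) (Z x)
  have e5 := h.inner_mul_mvfderiv_th x (X x)
  change _ * lieD X th x = _ at e5
  have eH := fun v : TangentSpace 𝓘(ℝ, E) x => h.inner_hess x (X x) v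
  have eJH : ∀ v : TangentSpace 𝓘(ℝ, E) x, ⟪∇ τ x, ∇ τ x⟫ * ⟪J x (∇∇ τ x (X x)), v⟫
      = ⟪∇ τ x, ∇ τ x⟫ * (th x * ⟪J x (X x), v⟫)
        + (la x - th x) * (⟪∇ τ x, X x⟫ * ⟪J x (∇ τ x), v⟫ - ⟪J x (∇ τ x), X x⟫ * ⟪∇ τ x, v⟫) := by
    intro v
    have h1 := h.inner_hess x (X x) (J x v)
    have h2 := hJ.inner_J_left x (∇∇ τ x (X x)) v
    have h3 := hJ.inner_J_left x (X x) v
    have h4 := hJ.inner_J_left x (∇ τ x) v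
    rw [gradSq, hJ.orthogonal] at h1
    rw [h2, h3, h4]
    linear_combination -h1
  simp only [gradSq] at eH
  -- the formula for `dth` and the eigenvalue form of the Hessian are multiplied by `Q`
  have hQ : ⟪∇ τ x, ∇ τ x⟫ ≠ 0 := inner_self_ne_zero.2 hx
  have hth := h.th_ne_zero x hx
  refine mul_left_cancel₀ (mul_ne_zero (mul_ne_zero two_ne_zero hth) hQ) ?_
  have hcov : covDerivBilin (hamiltonianForm J τ th la c) X Y Z x
      = lieD X (fun y => hamiltonianForm J τ th la c y (Y y) (Z y)) x
        - hamiltonianForm J τ th la c x (nabla X Y x) (Z x)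
        - hamiltonianForm J τ th la c x (Y x) (nabla X Z x) := rfl
  simp only [hcov]
  linear_combination ⟪∇ τ x, ∇ τ x⟫ * (e1 - e2 - e3)
    - 2 * hamiltonianForm J τ th la c x (Y x) (Z x) * e5
    - 2 * (la x - th x) * ⟪∇ τ x, X x⟫ * e4
    + ⟪J x (∇ τ x), Z x⟫ * eH (Y x) - ⟪J x (∇ τ x), Y x⟫ * eH (Z x)
    + ⟪∇ τ x, Y x⟫ * eJH (Z x) - ⟪∇ τ x, Z x⟫ * eJH (Y x)

theorem isHamiltonianTwoForm [PreconnectedSpace M] :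
    IsHamiltonianTwoForm J (hamiltonianForm J τ th la c) where
  smooth := h.isSmoothBilin_hamiltonianForm
  alternating := h.hamiltonianForm_self
  invariant := h.hamiltonianForm_J
  equation := by
    refine ⟨fun x => τ x - c, h.smooth.sub contMDiff_const,
      fun x => (h.omegaTrace_hamiltonianForm x).symm, fun X Y Z hX hY hZ x => ?_⟩
    have e : mvfderiv 𝓘(ℝ, E) (fun y => τ y - c) x = mvfderiv 𝓘(ℝ, E) τ x := by
      rw [show (fun y => τ y - c) = τ - fun _ => c from rfl,
        mvfderiv_sub ((h.smooth x).mdifferentiableAt (by simp)) mdifferentiableAt_const,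
        mvfderiv_const, sub_zero]
    have e2 : ∀ v : TangentSpace 𝓘(ℝ, E) x,
        dc J (fun y => τ y - c) x v = ⟪J x (∇ τ x), v⟫ := fun v => by
      rw [← dc_eq_inner h.kahler, dc, dc, e]
    rw [h.covDerivBilin_hamiltonianForm hX hY hZ, e2, e2, e, inner_grad, inner_grad]

/-- The covariant derivative of the Killing tensor, from the Hamiltonian equation and
`g(S v, w) = (τ - c) g(v, w) + φ(Jv, w)`. -/
theorem inner_covDerivEnd_killingTensor [PreconnectedSpace M] (hX : IsSmoothField X)
    (hY : IsSmoothField Y) (hZ : IsSmoothField Z) (x : M) :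
    ⟪covDerivEnd (killingTensor J τ th la c) X Y x, Z x⟫
      = ⟪∇ τ x, X x⟫ * ⟪Y x, Z x⟫ - (1 / 2) * (⟪∇ τ x, Z x⟫ * ⟪X x, Y x⟫
        + ⟪∇ τ x, Y x⟫ * ⟪X x, Z x⟫ + ⟪J x (∇ τ x), Y x⟫ * ⟪J x (X x), Z x⟫
        + ⟪J x (∇ τ x), Z x⟫ * ⟪J x (X x), Y x⟫) := by
  have hJ := h.kahler
  have hS := h.isSmoothEnd_killingTensor
  have hJY := hY.end_apply hJ.smooth
  have key : ∀ (y : M) (v w : TangentSpace 𝓘(ℝ, E) y), ⟪killingTensor J τ th la c y v, w⟫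
      = (τ y - c) * ⟪v, w⟫ + hamiltonianForm J τ th la c y (J y v) w := by
    intro y v w
    rw [hamiltonianForm_apply, hJ.sq, map_neg, inner_neg_left, inner_neg_left]
    ring
  have d : ∀ {f : M → ℝ}, ContMDiff 𝓘(ℝ, E) 𝓘(ℝ, ℝ) ∞ f → MDiffAt f x :=
    fun hf => (hf x).mdifferentiableAt (by simp)
  have hτc : ContMDiff 𝓘(ℝ, E) 𝓘(ℝ, ℝ) ∞ (fun y => τ y - c) := h.smooth.sub contMDiff_const
  have hτYZ : ContMDiff 𝓘(ℝ, E) 𝓘(ℝ, ℝ) ∞ (fun y => (τ y - c) * ⟪Y y, Z y⟫) :=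
    hτc.mul (hY.inner hZ)
  have e0 : lieD X (fun y => τ y - c) x = ⟪∇ τ x, X x⟫ := by
    rw [lieD_sub (d h.smooth) mdifferentiableAt_const, inner_grad]
    simp [lieD, mvfderiv_const]
  have e1 := lieD_inner hX (hY.end_apply hS) hZ x
  rw [show (fun y => ⟪killingTensor J τ th la c y (Y y), Z y⟫) = fun y => (τ y - c) * ⟪Y y, Z y⟫
    + hamiltonianForm J τ th la c y (J y (Y y)) (Z y) from funext fun y => key y (Y y) (Z y),
    lieD_add (d hτYZ) (d (h.contMDiff_hamiltonianForm_apply hJY hZ)),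
    lieD_mul (d hτc) (d (hY.inner hZ)), lieD_inner hX hY hZ, e0] at e1
  have e2 := h.covDerivBilin_hamiltonianForm hX hJY hZ x
  have e3 := key x (nabla X Y x) (Z x)
  have e4 := key x (Y x) (nabla X Z x)
  have hcov : covDerivBilin (hamiltonianForm J τ th la c) X (fun y => J y (Y y)) Z x
      = lieD X (fun y => hamiltonianForm J τ th la c y (J y (Y y)) (Z y)) x
        - hamiltonianForm J τ th la c x (nabla X (fun y => J y (Y y)) x) (Z x)
        - hamiltonianForm J τ th la c x (J x (Y x)) (nabla X Z x) := rfl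
  rw [hcov, hJ.nabla_J hX hY, hJ.orthogonal, hJ.orthogonal] at e2
  have hdef : ⟪covDerivEnd (killingTensor J τ th la c) X Y x, Z x⟫
      = ⟪nabla X (fun y => killingTensor J τ th la c y (Y y)) x, Z x⟫
        - ⟪killingTensor J τ th la c x (nabla X Y x), Z x⟫ := inner_sub_left _ _ _
  have e5 : ⟪∇ τ x, J x (Y x)⟫ = -⟪J x (∇ τ x), Y x⟫ := by rw [hJ.inner_J_left, neg_neg]
  have e6 : ⟪X x, J x (Y x)⟫ = -⟪J x (X x), Y x⟫ := by rw [hJ.inner_J_left, neg_neg]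
  rw [e5, e6] at e2
  rw [hdef]
  linear_combination -e1 + e2 - e3 - e4

theorem isKillingTensor [PreconnectedSpace M] : IsKillingTensor (killingTensor J τ th la c) where
  smooth := h.isSmoothEnd_killingTensor
  symm := h.inner_killingTensor_comm
  cyclic X Y Z hX hY hZ x := by
    have hJ := h.kahler
    rw [h.inner_covDerivEnd_killingTensor hX hY hZ, h.inner_covDerivEnd_killingTensor hZ hX hY,
      h.inner_covDerivEnd_killingTensor hY hZ hX]
    have c1 : ∀ v w : TangentSpace 𝓘(ℝ, E) x, ⟪J x v, w⟫ = -⟪J x w, v⟫ := fun v w => by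
      rw [hJ.inner_J_left, real_inner_comm]
    rw [c1 (Z x) (X x), c1 (Y x) (X x), c1 (Z x) (Y x), real_inner_comm (X x) (Z x),
      real_inner_comm (Y x) (Z x), real_inner_comm (X x) (Y x)]
    ring

theorem killingTensor_vert (hx : ∇ τ x ≠ 0) {v : TangentSpace 𝓘(ℝ, E) x} (hv : v ∈ vert J τ x) :
    killingTensor J τ th la c x v = 0 := by
  have hth := h.th_ne_zero x hx
  have h1 : killingTensor J τ th la c x (∇ τ x) = 0 := by
    rw [killingTensor_of_ne_zero hth, h.kahler.inner_J_self, h.inner_grad_self, zero_smul, add_zero,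
      smul_smul, ← sub_smul]
    convert zero_smul ℝ (∇ τ x)
    field_simp
    ring
  induction hv using Submodule.span_induction with
  | mem u hu =>
    rcases hu with rfl | rfl
    · exact h1
    · rw [h.killingTensor_J, h1, map_zero]
  | zero => simp
  | add u w _ _ hu hw => rw [map_add, hu, hw, add_zero]
  | smul a u _ hu => rw [map_smul, hu, smul_zero]

theorem killingTensor_horiz (hx : ∇ τ x ≠ 0) {v : TangentSpace 𝓘(ℝ, E) x} (hv : v ∈ horiz J τ x) :
    killingTensor J τ th la c x v = (τ x - c) • v := by
  rw [killingTensor_of_ne_zero (h.th_ne_zero x hx), (mem_horiz_iff.1 hv).1, (mem_horiz_iff.1 hv).2]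
  simp

/-- Points with `τ = c` are critical, because `Q = 2 th (τ - c)`. -/
theorem killingTensor_eq_zero (hx : τ x = c) : killingTensor J τ th la c x = 0 := by
  have hG : ∇ τ x = 0 := by
    have := h.inner_grad_self x
    rw [hx, sub_self, mul_zero] at this
    exact inner_self_eq_zero.1 this
  ext v
  by_cases hth : th x = 0
  · rw [killingTensor_of_eq_zero hth, hx]
    simp
  · rw [killingTensor_of_ne_zero hth, hx, hG]
    simp

end IsNormalizedPotential

end Tensors

end KahlerGeom

end

theorem mainTheorem8
    {E : Type*} [NormedAddCommGroup E] [NormedSpace ℝ E] [FiniteDimensional ℝ E]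
    {M : Type*} [TopologicalSpace M] [ChartedSpace E M] [IsManifold 𝓘(ℝ, E) ∞ M]
    [T2Space M] [CompactSpace M] [ConnectedSpace M]
    [RiemannianBundle (fun x : M => TangentSpace 𝓘(ℝ, E) x)]
    [IsContMDiffRiemannianBundle 𝓘(ℝ, E) ∞ E (fun x : M => TangentSpace 𝓘(ℝ, E) x)]
    (n : ℕ) (hn : 2 ≤ n) (hdim : Module.finrank ℝ E = 2 * n)
    (J : Π x : M, TangentSpace 𝓘(ℝ, E) x →L[ℝ] TangentSpace 𝓘(ℝ, E) x)
    (hJ : KahlerGeom.IsKahler J)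
    (τ : M → ℝ) (hτ : KahlerGeom.IsSpecialKahlerPotential J τ)
    (hRic : n = 2 → KahlerGeom.IsRicciEigenGrad (E := E) τ)
    (Θ : M → ℝ)
    (hΘ : ∀ x : M, mvfderiv 𝓘(ℝ, E) τ x ≠ 0 → ∀ v ∈ KahlerGeom.horiz J τ x,
      KahlerGeom.hess τ x v = Θ x • v)
    (hΘ0 : ∀ x : M, mvfderiv 𝓘(ℝ, E) τ x ≠ 0 → Θ x ≠ 0) :
    ∃ c : ℝ,
      (∀ x : M, mvfderiv 𝓘(ℝ, E) τ x ≠ 0 →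
        inner ℝ (KahlerGeom.grad (E := E) τ x) (KahlerGeom.grad (E := E) τ x) / Θ x
          = 2 * (τ x - c)) ∧
      ∃ φ : Π x : M, TangentSpace 𝓘(ℝ, E) x →L[ℝ] TangentSpace 𝓘(ℝ, E) x →L[ℝ] ℝ,
        KahlerGeom.IsHamiltonianTwoForm J φ ∧
        (∀ x : M, mvfderiv 𝓘(ℝ, E) τ x ≠ 0 → ∀ v w : TangentSpace 𝓘(ℝ, E) x,
          φ x v w =
            (τ x - c) /
                inner ℝ (KahlerGeom.grad (E := E) τ x) (KahlerGeom.grad (E := E) τ x) *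
              (mvfderiv 𝓘(ℝ, E) τ x v * KahlerGeom.dc J τ x w
                - mvfderiv 𝓘(ℝ, E) τ x w * KahlerGeom.dc J τ x v)) ∧
        (∀ x : M, KahlerGeom.omegaTrace J φ x = τ x - c) ∧
        ∃ S : Π x : M, TangentSpace 𝓘(ℝ, E) x →L[ℝ] TangentSpace 𝓘(ℝ, E) x,
          KahlerGeom.IsKillingTensor S ∧
          (∀ x : M, mvfderiv 𝓘(ℝ, E) τ x ≠ 0 →
            (∀ v ∈ KahlerGeom.vert J τ x, S x v = 0) ∧
            (∀ v ∈ KahlerGeom.horiz J τ x, S x v = (τ x - c) • v)) ∧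
          (∀ x : M, τ x = c → S x = 0) ∧
          (∀ (x : M) (v w : TangentSpace 𝓘(ℝ, E) x),
            inner ℝ (S x (J x v)) w = (τ x - c) * inner ℝ (J x v) w - φ x v w) := by
  have hU : ∀ x : M, KahlerGeom.grad (E := E) τ x ≠ 0 ↔ mvfderiv 𝓘(ℝ, E) τ x ≠ 0 :=
    fun x => KahlerGeom.grad_eq_zero_iff.not
  have hK : KahlerGeom.IsKillingPotential J τ := ⟨hJ, hτ.smooth, hτ.killing⟩
  obtain ⟨th, la, hS, hth⟩ := hK.exists_isSpecialPotential hn hdim hτ.nonconstant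
    (fun x hx => hΘ x ((hU x).1 hx)) (fun x hx => hΘ0 x ((hU x).1 hx))
  obtain ⟨c, h⟩ := hS.exists_isNormalizedPotential (hS.inner_mul_mvfderiv_th hn hdim hRic)
  refine ⟨c, fun x hx => ?_, KahlerGeom.hamiltonianForm J τ th la c, h.isHamiltonianTwoForm,
    fun x hx v w => ?_, h.omegaTrace_hamiltonianForm, KahlerGeom.killingTensor J τ th la c,
    h.isKillingTensor, fun x hx => ⟨fun v => h.killingTensor_vert ((hU x).2 hx),
      fun v => h.killingTensor_horiz ((hU x).2 hx)⟩, fun x => h.killingTensor_eq_zero,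
    fun x v w => ?_⟩
  · rw [← hth x ((hU x).2 hx), h.inner_grad_self]
    have := h.th_ne_zero x ((hU x).2 hx)
    field_simp
  · have h1 := h.th_ne_zero x ((hU x).2 hx)
    have h2 := h.th_mul_hamiltonianForm x v w
    have h3 : inner ℝ (KahlerGeom.grad (E := E) τ x) (KahlerGeom.grad (E := E) τ x) ≠ 0 :=
      inner_self_ne_zero.2 ((hU x).2 hx)
    have h4 := h.inner_grad_self x
    rw [KahlerGeom.dc_eq_inner hJ, KahlerGeom.dc_eq_inner hJ, ← KahlerGeom.inner_grad,
      ← KahlerGeom.inner_grad, ← h2, div_mul_eq_mul_div, eq_div_iff h3]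
    linear_combination KahlerGeom.hamiltonianForm J τ th la c x v w * h4
  · rw [KahlerGeom.hamiltonianForm_apply]
    ring
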